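/- Let $K$ be an algebraically closed field. **Setting.** Let $Q$ be a finite quiver with source and target maps $s,t$, and write paths from left to right. Let $\Lambda=KQ/I$ be a gentle algebra. This means that $I$ is admissible and generated by paths of length two; at every vertex at most two arrows start and at most two end; for every arrow $\alpha$ there is at most one arrow $\beta$ with $\alpha\beta\notin I$ and at most one $\gamma$ with $\gamma\alpha\notin I$; and for every $\alpha$ there is at most one arrow $\beta$ with $t(\alpha)=s(\beta)$, $\alpha\beta\in I$, and at most one $\gamma$ with $t(\gamma)=s(\alpha)$, $\gamma\alpha\in I$. Modules are right modules. For an arrow $\alpha$ put $R(\alpha)=\alpha\Lambda$. Write $\Omega^0(X)=X$, let $\Omega^1(X)$ be the kernel of a projective cover of $X$, and put $\Omega^{j}(X)=\Omega^1(\Omega^{j-1}(X))$ for $j\geq 2$; syzygies are taken up to isomorphism. **Higher extensions over gentle algebras.** Let $M=M(v)$ and $N=M(w)$ be string modules over $\Lambda$. There is a decomposition $$\Omega^1(M)\cong L_0\oplus L_1\oplus\cdots\oplus L_k,\qquad k\geq 1,$$ in which $L_1,\dots,L_{k-1}$ are projective and each of $L_0$ and $L_k$ is uniserial or zero. For every such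 decomposition there is a $K$-linear isomorphism $$\operatorname{Ext}^2_\Lambda(M,N)\cong \operatorname{Ext}^1_\Lambda(L_0,N)\oplus\operatorname{Ext}^1_\Lambda(L_k,N),$$ and, more generally, for every $n\ge 2$ the syzygies $\Omega^{n-2}(L_0)$ and $\Omega^{n-2}(L_k)$ exist, there is a $K$-linear isomorphism $$\operatorname{Ext}^n_\Lambda(M,N)\cong \operatorname{Ext}^1_\Lambda(\Omega^{n-2}(L_0),N)\oplus\operatorname{Ext}^1_\Lambda(\Omega^{n-2}(L_k),N),$$ and for $i\in\{0,k\}$ the module $\Omega^{n-2}(L_i)$ is zero or isomorphic to $R(\alpha)$ for some arrow $\alpha$ of $Q$. **Algebras of triangulations.** Let $T$ be a triangulation of a compact oriented surface $S$ with marked points, all on the boundary of $S$; that is, $S$ is glued from finitely many oriented triangles by identifying some of their sides in pairs, compatibly with the orientation, and the marked points are the vertices of the triangles. Let $\Lambda(T)=KQ(T)/I(T)$ be the algebra of $T$. Here the vertices of $Q(T)$ are the arcs of $T$ (the pairs of identified sides); there is an arrow from one arc to another for every triangle in which the second follows the first in the orientation of $S$; and $I(T)$ is generated by the paths of two consecutive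 arrows inside one triangle whose three sides are arcs. Then for all string modules $M,N$ over $\Lambda(T)$ and all $n\geq 2$ there is a $K$-linear isomorphism $$\operatorname{Ext}^n_{\Lambda(T)}(M,N)\cong\operatorname{Ext}^{n+3}_{\Lambda(T)}(M,N).$$ -/

import Mathlib

universe u

namespace GentleExt

open CategoryTheory

/-! ### Quivers and path algebras -/

/-- A finite quiver: vertices `V`, arrows `E`, source `s` and target `t`. -/
structure FinQuiver : Type (u + 1) where
  V : Type u
  E : Type u
  [fintypeV : Fintype V]
  [fintypeE : Fintype E]
  s : E → V
  t : E → V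

attribute [instance] FinQuiver.fintypeV FinQuiver.fintypeE

section PathAlgebra

variable (K : Type u) [Field K] (Q : FinQuiver.{u})

/-- The defining relations of the path algebra: the trivial paths `e_v` are orthogonal idempotents
with sum `1`, and `e_{s(a)} a = a = a e_{t(a)}` for every arrow `a`. -/
inductive PathRel : FreeAlgebra K (Q.V ⊕ Q.E) → FreeAlgebra K (Q.V ⊕ Q.E) → Prop
  | idem (v : Q.V) :
      PathRel (FreeAlgebra.ι K (Sum.inl v) * FreeAlgebra.ι K (Sum.inl v))
        (FreeAlgebra.ι K (Sum.inl v))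
  | orth (v w : Q.V) (h : v ≠ w) :
      PathRel (FreeAlgebra.ι K (Sum.inl v) * FreeAlgebra.ι K (Sum.inl w)) 0
  | one : PathRel (∑ v : Q.V, FreeAlgebra.ι K (Sum.inl v)) 1
  | source (a : Q.E) :
      PathRel (FreeAlgebra.ι K (Sum.inl (Q.s a)) * FreeAlgebra.ι K (Sum.inr a))
        (FreeAlgebra.ι K (Sum.inr a))
  | target (a : Q.E) :
      PathRel (FreeAlgebra.ι K (Sum.inr a) * FreeAlgebra.ι K (Sum.inl (Q.t a)))
        (FreeAlgebra.ι K (Sum.inr a))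

/-- The path algebra `KQ`, with paths composed from left to right: `a * b` is the path `a` followed
by `b` if `t(a) = s(b)`, and it is `0` otherwise. -/
def PathAlgebra : Type u := RingQuot (PathRel K Q)

noncomputable instance : Ring (PathAlgebra K Q) := inferInstanceAs (Ring (RingQuot _))

noncomputable instance : Algebra K (PathAlgebra K Q) :=
  inferInstanceAs (Algebra K (RingQuot (PathRel K Q)))

variable {Q}

/-- The trivial path `e_v`. -/
noncomputable def vert (v : Q.V) : PathAlgebra K Q :=
  RingQuot.mkAlgHom K (PathRel K Q) (FreeAlgebra.ι K (Sum.inl v))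

/-- An arrow as an element of the path algebra. -/
noncomputable def arrow (a : Q.E) : PathAlgebra K Q :=
  RingQuot.mkAlgHom K (PathRel K Q) (FreeAlgebra.ι K (Sum.inr a))

variable (Q)

/-- The `n`-th power of the arrow ideal of `KQ`, for `n ≥ 1`: the two-sided ideal generated by the
products of `n` arrows, that is, by the paths of length `n`. -/
noncomputable def arrowIdealPow (n : ℕ) : TwoSidedIdeal (PathAlgebra K Q) :=
  TwoSidedIdeal.span {x | ∃ l : List Q.E, l.length = n ∧ x = (l.map (arrow K)).prod}

end PathAlgebra

/-! ### Gentle algebras -/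

section Gentle

variable {K : Type u} [Field K] {Q : FinQuiver.{u}}

/-- `I` is admissible: `R ^ m ⊆ I ⊆ R ^ 2` for some `m ≥ 2`, where `R` is the arrow ideal. -/
def IsAdmissible (I : TwoSidedIdeal (PathAlgebra K Q)) : Prop :=
  (∃ m : ℕ, 2 ≤ m ∧ arrowIdealPow K Q m ≤ I) ∧ I ≤ arrowIdealPow K Q 2

/-- `I` is generated by paths of length two. -/
def GeneratedByQuadraticPaths (I : TwoSidedIdeal (PathAlgebra K Q)) : Prop :=
  ∃ ρ : Set (Q.E × Q.E), (∀ p ∈ ρ, Q.t p.1 = Q.s p.2) ∧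
    I = TwoSidedIdeal.span ((fun p : Q.E × Q.E => arrow K p.1 * arrow K p.2) '' ρ)

/-- `KQ/I` is a gentle algebra. -/
structure IsGentle (I : TwoSidedIdeal (PathAlgebra K Q)) : Prop where
  admissible : IsAdmissible I
  start_le : ∀ v : Q.V, {a : Q.E | Q.s a = v}.ncard ≤ 2
  end_le : ∀ v : Q.V, {a : Q.E | Q.t a = v}.ncard ≤ 2
  right_notMem : ∀ a b b' : Q.E,
    arrow K a * arrow K b ∉ I → arrow K a * arrow K b' ∉ I → b = b'
  left_notMem : ∀ a c c' : Q.E,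
    arrow K c * arrow K a ∉ I → arrow K c' * arrow K a ∉ I → c = c'
  right_mem : ∀ a b b' : Q.E, Q.t a = Q.s b → Q.t a = Q.s b' →
    arrow K a * arrow K b ∈ I → arrow K a * arrow K b' ∈ I → b = b'
  left_mem : ∀ a c c' : Q.E, Q.t c = Q.s a → Q.t c' = Q.s a →
    arrow K c * arrow K a ∈ I → arrow K c' * arrow K a ∈ I → c = c'
  quadratic : GeneratedByQuadraticPaths I

/-- The algebra `Λ = KQ/I`. -/
abbrev BoundAlgebra (I : TwoSidedIdeal (PathAlgebra K Q)) : Type u := I.ringCon.Quotient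

/-- The category of right `Λ`-modules, `Λ = KQ/I`. -/
abbrev RightMod (I : TwoSidedIdeal (PathAlgebra K Q)) : Type (u + 1) :=
  ModuleCat.{u} (BoundAlgebra I)ᵐᵒᵖ

/-- The right ideal `R(a) = aΛ` generated by an arrow `a`, as a right `Λ`-module. -/
noncomputable def arrowModule (I : TwoSidedIdeal (PathAlgebra K Q)) (a : Q.E) : RightMod I :=
  ModuleCat.of (BoundAlgebra I)ᵐᵒᵖ
    (Submodule.span (BoundAlgebra I)ᵐᵒᵖ {(I.ringCon.mk' (arrow K a) : BoundAlgebra I)})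

/-! ### Strings and string modules -/

/-- The source of a letter: `(a, true)` is the arrow `a`, `(a, false)` its formal inverse. -/
def letterSource (x : Q.E × Bool) : Q.V := if x.2 then Q.s x.1 else Q.t x.1

/-- The target of a letter. -/
def letterTarget (x : Q.E × Bool) : Q.V := if x.2 then Q.t x.1 else Q.s x.1

/-- A string for `KQ/I` of length `len ≥ 0`: a walk with letters `letter i`, passing through the
vertices `vertex 0, …, vertex len`, that contains neither `x x⁻¹` nor a path `ab ∈ I` of length two
nor the inverse of such a path. For `len = 0` it is the trivial string at `vertex 0`. -/
structure GString (I : TwoSidedIdeal (PathAlgebra K Q)) : Type u where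
  len : ℕ
  letter : Fin len → Q.E × Bool
  vertex : Fin (len + 1) → Q.V
  source_letter : ∀ i, letterSource (letter i) = vertex i.castSucc
  target_letter : ∀ i, letterTarget (letter i) = vertex i.succ
  reduced : ∀ i j : Fin len, (j : ℕ) = i + 1 → letter j ≠ ((letter i).1, !(letter i).2)
  direct : ∀ i j : Fin len, (j : ℕ) = i + 1 → (letter i).2 = true → (letter j).2 = true →
    arrow K (letter i).1 * arrow K (letter j).1 ∉ I
  inverse : ∀ i j : Fin len, (j : ℕ) = i + 1 → (letter i).2 = false → (letter j).2 = false →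
    arrow K (letter j).1 * arrow K (letter i).1 ∉ I

variable {I : TwoSidedIdeal (PathAlgebra K Q)}

open Classical in
/-- The action of `e_v` on the basis `z_0, …, z_len` of the string module:
`z_i e_v = z_i` if the `i`-th vertex of the string is `v`, and `z_i e_v = 0` otherwise. -/
noncomputable def GString.vertexMatrix (w : GString I) (v : Q.V) :
    Matrix (Fin (w.len + 1)) (Fin (w.len + 1)) K :=
  Matrix.diagonal fun i => if w.vertex i = v then 1 else 0

/-- The arrow `a` labels the edge of the string between `i` and `j`, pointing from `i` to `j`. -/
def GString.Step (w : GString I) (a : Q.E) (i j : Fin (w.len + 1)) : Prop :=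
  ∃ k : Fin w.len, (w.letter k = (a, true) ∧ i = k.castSucc ∧ j = k.succ) ∨
    (w.letter k = (a, false) ∧ i = k.succ ∧ j = k.castSucc)

open Classical in
/-- The action of an arrow `a` on the basis `z_0, …, z_len` of the string module: `z_i a = z_j` if
`a` labels the edge between `i` and `j` and points from `i` to `j`, and `z_i a = 0` if there is no
such `j`. -/
noncomputable def GString.arrowMatrix (w : GString I) (a : Q.E) :
    Matrix (Fin (w.len + 1)) (Fin (w.len + 1)) K :=
  Matrix.of fun i j => if w.Step a i j then 1 else 0

theorem GString.Step.source {w : GString I} {a : Q.E} {i j : Fin (w.len + 1)}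
    (h : w.Step a i j) : w.vertex i = Q.s a := by
  obtain ⟨k, ⟨h, rfl, rfl⟩ | ⟨h, rfl, rfl⟩⟩ := h
  · rw [← w.source_letter, h]; rfl
  · rw [← w.target_letter, h]; rfl

theorem GString.Step.target {w : GString I} {a : Q.E} {i j : Fin (w.len + 1)}
    (h : w.Step a i j) : w.vertex j = Q.t a := by
  obtain ⟨k, ⟨h, rfl, rfl⟩ | ⟨h, rfl, rfl⟩⟩ := h
  · rw [← w.target_letter, h]; rfl
  · rw [← w.source_letter, h]; rfl

/-- The right action of `KQ` on the string module of `w`, with `x : KQ` acting on row vectors in the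
basis `z_0, …, z_len`. -/
noncomputable def GString.pathRep (w : GString I) :
    PathAlgebra K Q →ₐ[K] Matrix (Fin (w.len + 1)) (Fin (w.len + 1)) K :=
  RingQuot.liftAlgHom K ⟨FreeAlgebra.lift K (Sum.elim w.vertexMatrix w.arrowMatrix), by
    classical
    intro x y h
    induction h with
    | idem v =>
      simp only [map_mul, FreeAlgebra.lift_ι_apply, Sum.elim_inl, vertexMatrix,
        Matrix.diagonal_mul_diagonal]
      congr 1; funext i; split_ifs <;> simp
    | orth v v' h =>
      simp only [map_mul, FreeAlgebra.lift_ι_apply, Sum.elim_inl, vertexMatrix,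
        Matrix.diagonal_mul_diagonal, map_zero]
      rw [← Matrix.diagonal_zero]
      congr 1; funext i
      split_ifs with h1 h2 <;> simp
      exact h (h1.symm.trans h2)
    | one =>
      simp only [map_sum, FreeAlgebra.lift_ι_apply, Sum.elim_inl, map_one, vertexMatrix]
      ext i j
      rw [Matrix.sum_apply]
      by_cases hij : i = j
      · subst hij; simp
      · simp [hij]
    | source a =>
      simp only [map_mul, FreeAlgebra.lift_ι_apply, Sum.elim_inl, Sum.elim_inr, vertexMatrix]
      ext i j
      rw [Matrix.diagonal_mul]
      by_cases h : w.Step a i j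
      · simp [arrowMatrix, h, h.source]
      · simp [arrowMatrix, h]
    | target a =>
      simp only [map_mul, FreeAlgebra.lift_ι_apply, Sum.elim_inl, Sum.elim_inr, vertexMatrix]
      ext i j
      rw [Matrix.mul_diagonal]
      by_cases h : w.Step a i j
      · simp [arrowMatrix, h, h.target]
      · simp [arrowMatrix, h]⟩

theorem GString.pathRep_vert (w : GString I) (v : Q.V) :
    w.pathRep (vert K v) = w.vertexMatrix v := by
  unfold pathRep vert
  erw [RingQuot.liftAlgHom_mkAlgHom_apply]
  simp

theorem GString.pathRep_arrow (w : GString I) (a : Q.E) :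
    w.pathRep (arrow K a) = w.arrowMatrix a := by
  unfold pathRep arrow
  erw [RingQuot.liftAlgHom_mkAlgHom_apply]
  simp

theorem GString.pathRep_arrow_mul_arrow (w : GString I) {a b : Q.E}
    (h : arrow K a * arrow K b ∈ I) : w.pathRep (arrow K a * arrow K b) = 0 := by
  classical
  rw [map_mul, pathRep_arrow, pathRep_arrow]
  ext i j
  rw [Matrix.mul_apply, Matrix.zero_apply]
  refine Finset.sum_eq_zero fun l _ => ?_
  by_cases h1 : w.Step a i l
  swap
  · simp [arrowMatrix, h1]
  by_cases h2 : w.Step b l j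
  swap
  · simp [arrowMatrix, h2]
  exfalso
  obtain ⟨k, ⟨hk, -, hl⟩ | ⟨hk, -, hl⟩⟩ := h1 <;>
    obtain ⟨k', ⟨hk', hl', -⟩ | ⟨hk', hl', -⟩⟩ := h2
  · have e : (k' : ℕ) = k + 1 := by
      have := congrArg Fin.val (hl.symm.trans hl'); simp at this; omega
    have := w.direct k k' e (by rw [hk]) (by rw [hk'])
    rw [hk, hk'] at this
    exact this h
  · have e : k = k' := Fin.succ_injective _ (hl.symm.trans hl')
    subst e
    simp [hk] at hk'
  · have e : k = k' := Fin.castSucc_injective _ (hl.symm.trans hl')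
    subst e
    simp [hk] at hk'
  · have e : (k : ℕ) = k' + 1 := by
      have := congrArg Fin.val (hl.symm.trans hl'); simp at this; omega
    have := w.inverse k' k e (by rw [hk']) (by rw [hk])
    rw [hk, hk'] at this
    exact this h

theorem GString.pathRep_eq_zero (hI : GeneratedByQuadraticPaths I) (w : GString I)
    {x : PathAlgebra K Q} (hx : x ∈ I) : w.pathRep x = 0 := by
  have key : I ≤ TwoSidedIdeal.ker w.pathRep := by
    obtain ⟨ρ, -, hρ⟩ := hI
    conv_lhs => rw [hρ]
    rw [TwoSidedIdeal.span_le]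
    rintro _ ⟨p, hp, rfl⟩
    refine (TwoSidedIdeal.mem_ker _).2 (w.pathRep_arrow_mul_arrow ?_)
    rw [hρ]
    exact TwoSidedIdeal.subset_span ⟨p, hp, rfl⟩
  exact (TwoSidedIdeal.mem_ker _).1 (key hx)

/-- The right action of `Λ = KQ/I` on the string module of `w`. -/
noncomputable def GString.rep (hI : GeneratedByQuadraticPaths I) (w : GString I) :
    BoundAlgebra I →+* Matrix (Fin (w.len + 1)) (Fin (w.len + 1)) K :=
  I.ringCon.lift (w.pathRep : PathAlgebra K Q →+* _) <| by
    intro x y hxy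
    have : x - y ∈ I := (TwoSidedIdeal.rel_iff I x y).1 hxy
    have h := w.pathRep_eq_zero hI this
    rw [map_sub, sub_eq_zero] at h
    exact h

/-- The underlying vector space of the string module of `w`. -/
def GString.Space (_ : GeneratedByQuadraticPaths I) (w : GString I) : Type u :=
  Fin (w.len + 1) → K

noncomputable instance (hI : GeneratedByQuadraticPaths I) (w : GString I) :
    AddCommGroup (w.Space hI) :=
  inferInstanceAs (AddCommGroup (Fin (w.len + 1) → K))

/-- The right `Λ`-module structure: `z · x` is the product of the row vector `z` with the matrix of
`x`. -/
noncomputable abbrev GString.rowModule (hI : GeneratedByQuadraticPaths I) (w : GString I) :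
    Module (BoundAlgebra I)ᵐᵒᵖ (Fin (w.len + 1) → K) where
  smul x z := Matrix.vecMul z (w.rep hI x.unop)
  one_smul z := by
    change Matrix.vecMul z _ = z
    rw [MulOpposite.unop_one, map_one, Matrix.vecMul_one]
  mul_smul x y z := by
    change Matrix.vecMul z _ = Matrix.vecMul (Matrix.vecMul z _) _
    rw [MulOpposite.unop_mul, map_mul, Matrix.vecMul_vecMul]
  smul_zero x := Matrix.zero_vecMul _
  smul_add x z z' := Matrix.add_vecMul _ _ _
  add_smul x y z := by
    change Matrix.vecMul z _ = Matrix.vecMul z _ + Matrix.vecMul z _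
    rw [MulOpposite.unop_add, map_add, Matrix.vecMul_add]
  zero_smul z := by
    change Matrix.vecMul z _ = 0
    rw [MulOpposite.unop_zero, map_zero, Matrix.vecMul_zero]

noncomputable instance (hI : GeneratedByQuadraticPaths I) (w : GString I) :
    Module (BoundAlgebra I)ᵐᵒᵖ (w.Space hI) :=
  w.rowModule hI

/-- The string module `M(w)`, a right `Λ`-module. -/
noncomputable def GString.module (hI : GeneratedByQuadraticPaths I) (w : GString I) : RightMod I :=
  ModuleCat.of (BoundAlgebra I)ᵐᵒᵖ (w.Space hI)

end Gentle

/-! ### Syzygies -/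

section Syzygy

variable {A : Type u} [Ring A]

/-- `f : P → M` is a projective cover: `P` is projective, `f` is surjective, and the kernel of `f`
is a superfluous submodule of `P`. -/
def IsProjectiveCover {P M : ModuleCat.{u} A} (f : P →ₗ[A] M) : Prop :=
  Module.Projective A P ∧ Function.Surjective f ∧
    ∀ U : Submodule A P, U ⊔ LinearMap.ker f = ⊤ → U = ⊤

/-- `X` is (isomorphic to) the first syzygy of `M`, the kernel of a projective cover of `M`. -/
def IsFirstSyzygy (M X : ModuleCat.{u} A) : Prop :=
  ∃ (P : ModuleCat.{u} A) (f : P →ₗ[A] M),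
    IsProjectiveCover f ∧ Nonempty (X ≃ₗ[A] LinearMap.ker f)

/-- `X` is (isomorphic to) the `n`-th syzygy of `M`. -/
def IsSyzygy : ℕ → ModuleCat.{u} A → ModuleCat.{u} A → Prop
  | 0, M, X => Nonempty (X ≃ₗ[A] M)
  | n + 1, M, X => ∃ Y : ModuleCat.{u} A, IsSyzygy n M Y ∧ IsFirstSyzygy Y X

/-- The submodules of `M` form a chain; the zero module is included. -/
def IsUniserialOrZero (M : ModuleCat.{u} A) : Prop :=
  ∀ U V : Submodule A M, U ≤ V ∨ V ≤ U

/-- A decomposition `Ω¹(M) = L_0 ⊕ ⋯ ⊕ L_k` with two distinct outer summands, `L_0` and `L_k`, each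
uniserial or zero, and projective inner summands `L_1, …, L_{k-1}`. -/
structure IsSyzygyDecomposition (M : ModuleCat.{u} A) (k : ℕ) (L : Fin (k + 1) → ModuleCat.{u} A) :
    Prop where
  one_le : 1 ≤ k
  syzygy : IsSyzygy 1 M (ModuleCat.of A ((i : Fin (k + 1)) → L i))
  inner : ∀ i : Fin (k + 1), i ≠ 0 → i ≠ Fin.last k → Module.Projective A (L i)
  first : IsUniserialOrZero (L 0)
  last : IsUniserialOrZero (L (Fin.last k))

end Syzygy

/-! ### Triangulations of marked surfaces and their algebras -/

/-- Oriented triangles glued along sides. The sides of a triangle `t` are `(t, 0), (t, 1), (t, 2)`,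
listed along the orientation; `glue` matches the sides in pairs, and its fixed points are the sides
that stay unglued (the boundary segments). The side `(t, k)` runs from the vertex `k` to the vertex
`k + 1` of `t`, and glued sides are identified with opposite directions.

Turning around the end point of a side `(t, k)` one crosses the next side `(t, k + 1)` of the
triangle and arrives at the side `glue (t, k + 1)`, which has the same end point; the condition
`vertex_on_boundary` says that in this way one always meets an unglued side, that is, that every
vertex of the glued surface lies on its boundary. -/
structure TriangleGluing : Type (u + 1) where
  Tri : Type u
  [finiteTri : Finite Tri]
  glue : Tri × Fin 3 → Tri × Fin 3
  glue_glue : ∀ x, glue (glue x) = x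
  vertex_on_boundary : ∀ x : Tri × Fin 3, ∃ (n : ℕ) (y : Tri × Fin 3),
    y = (fun z : Tri × Fin 3 => glue (z.1, z.2 + 1))^[n] x ∧
      glue (y.1, y.2 + 1) = (y.1, y.2 + 1)

attribute [instance] TriangleGluing.finiteTri

namespace TriangleGluing

variable (T : TriangleGluing.{u})

/-- The identification of the points of two glued sides, points of a triangle being given by their
barycentric coordinates: the point of `(t, k)` with coordinates `x k`, `x (k + 1)` at its start and
end is the point of `glue (t, k)` with these coordinates at its end and start. -/
def PointRel (p q : Σ _ : T.Tri, stdSimplex ℝ (Fin 3)) : Prop :=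
  ∃ (k j : Fin 3), T.glue (p.1, k) ≠ (p.1, k) ∧ T.glue (p.1, k) = (q.1, j) ∧
    p.2.1 (k + 2) = 0 ∧ q.2.1 (j + 2) = 0 ∧
    q.2.1 (j + 1) = p.2.1 k ∧ q.2.1 j = p.2.1 (k + 1)

/-- The surface obtained from the disjoint union of the triangles by gluing. -/
def Surface : Type u := Quot T.PointRel

instance : TopologicalSpace T.Surface := inferInstanceAs (TopologicalSpace (Quot T.PointRel))

/-- The images of the vertices of the triangles. -/
def vertexSet : Set T.Surface :=
  {P | ∃ (p : Σ _ : T.Tri, stdSimplex ℝ (Fin 3)) (k : Fin 3), p.2.1 k = 1 ∧ Quot.mk _ p = P}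

/-- The sides that are not boundary segments. -/
def InternalSide : Type u := {x : T.Tri × Fin 3 // T.glue x ≠ x}

/-- Two internal sides are the two sides of the same arc. -/
def arcSetoid : Setoid T.InternalSide where
  r x y := y.1 = x.1 ∨ y.1 = T.glue x.1
  iseqv :=
    { refl := fun _ => Or.inl rfl
      symm := by
        rintro x y (h | h)
        · exact Or.inl h.symm
        · exact Or.inr (by rw [h, T.glue_glue])
      trans := by
        rintro x y z (h | h) (h' | h')
        · exact Or.inl (h'.trans h)
        · exact Or.inr (by rw [h', h])
        · exact Or.inr (h'.trans h)
        · exact Or.inl (by rw [h', h, T.glue_glue]) }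

/-- The arcs of the triangulation. -/
def Arc : Type u := Quotient T.arcSetoid

/-- The angles `(t, k)` between the sides `(t, k)` and `(t, k + 1)` both of which are arcs. -/
def Angle : Type u :=
  {x : T.Tri × Fin 3 // T.glue x ≠ x ∧ T.glue (x.1, x.2 + 1) ≠ (x.1, x.2 + 1)}

instance : Finite T.InternalSide := inferInstanceAs (Finite {x : T.Tri × Fin 3 // T.glue x ≠ x})

instance : Finite T.Arc := inferInstanceAs (Finite (Quotient T.arcSetoid))

instance : Finite T.Angle := inferInstanceAs
  (Finite {x : T.Tri × Fin 3 // T.glue x ≠ x ∧ T.glue (x.1, x.2 + 1) ≠ (x.1, x.2 + 1)})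

/-- The quiver `Q(T)`: its vertices are the arcs of the triangulation, and every pair of arcs that
are consecutive sides of a triangle, in the orientation of the surface, gives an arrow. -/
noncomputable def quiver : FinQuiver.{u} where
  V := T.Arc
  E := T.Angle
  fintypeV := Fintype.ofFinite _
  fintypeE := Fintype.ofFinite _
  s x := Quotient.mk T.arcSetoid ⟨x.1, x.2.1⟩
  t x := Quotient.mk T.arcSetoid ⟨(x.1.1, x.1.2 + 1), x.2.2⟩

/-- The pairs of consecutive arrows `(b, c)` in the 3-cycles `abc` of the internal triangles. -/
def relationPairs : Set (T.quiver.E × T.quiver.E) :=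
  {p : T.Angle × T.Angle | p.2.1 = (p.1.1.1, p.1.1.2 + 1)}

/-- The Jacobian ideal of the natural potential, the sum of the 3-cycles `abc` of the internal
triangles: it is generated by the cyclic derivatives `∂_a(abc) = bc`. -/
noncomputable def ideal (K : Type u) [Field K] : TwoSidedIdeal (PathAlgebra K T.quiver) :=
  TwoSidedIdeal.span
    ((fun p : T.quiver.E × T.quiver.E => arrow K p.1 * arrow K p.2) '' T.relationPairs)

theorem ideal_quadratic (K : Type u) [Field K] : GeneratedByQuadraticPaths (T.ideal K) := by
  refine ⟨T.relationPairs, ?_, rfl⟩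
  rintro ⟨b, c⟩ h
  have h' : c.1 = (b.1.1, b.1.2 + 1) := h
  change Quotient.mk T.arcSetoid _ = Quotient.mk T.arcSetoid _
  congr 1
  exact Subtype.ext h'.symm

end TriangleGluing

/-- A triangulation of the surface `S` with marked points `P`, all on the boundary: an
identification of `S` with a surface glued from oriented triangles, under which the marked points
are the vertices of the triangles. -/
structure Triangulation (S : Type u) [TopologicalSpace S] (P : Set S) extends
    TriangleGluing.{u} where
  homeo : toTriangleGluing.Surface ≃ₜ S
  marked : homeo '' toTriangleGluing.vertexSet = P

end GentleExt

/-! Cut the string `v` at its inner sinks into mountains, pieces running down on both sides from a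
peak. The projective at a peak maps onto its piece, and the sum of these projectives over all
mountains is a projective cover of the string module. Its kernel is visible from the string. At an
inner sink the paths arriving from the two neighbouring peaks have the same image, and their
difference generates a copy of the projective at that vertex. At either end of the string, the arrow
that continues the outermost path out of the string, if there is one, generates a copy of its right
ideal `aΛ`. So the first syzygy is a sum of inner projectives and two outer modules `aΛ` or zero.
The presentation is built by induction on the number of mountains (`Present`, `Present.glue`,
`Present.ker_f`).

The input from the algebra is how arrows multiply. Whether `a w = 0` is decided by following the
unique nonzero continuation of `a` (`IsGentle.ar_mul_eq_zero_of_trace`). From this: different arrows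
generate independent right ideals; left multiplication by `a` is injective on `bΛ` if `ab ∉ I`; the
annihilator of `a` in the projective at `t(a)` is `bΛ` for the unique composable `b` with `ab ∈ I`,
or zero; and two different arrows with the same end have annihilators that meet in zero. The third
fact shows that the syzygy of `aΛ` is again `bΛ` or zero, and the last that the inner summands are
really projective.

The theorem speaks of every decomposition, not only of the constructed one. A uniserial direct
summand of a finite product of hollow Noetherian modules is zero or isomorphic to a factor
(`subsingleton_or_equiv_of_uniserial_summand`). If that factor is an inner projective, then two
arrows end at its vertex and at most one starts there, so one of the two arrows begins no relation
and its right ideal is isomorphic to the projective. Dimension shifting then gives all the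
statements about `Ext`.

For a triangulation the relations are the pairs of consecutive angles of one triangle, while nonzero
paths turn around one vertex of the surface; they have bounded length because every vertex lies on
the boundary. An arrow either begins no relation, and `aΛ` is projective, or it lies in an internal
triangle, where three syzygies lead from `aΛ` through the other two angles back to `aΛ`. This is the
period three. -/

namespace GentleExt

open CategoryTheory

/-! ### The path algebra and its 0-1 representations -/

section PathAlgebraLemmas

variable {K : Type u} [Field K] {Q : FinQuiver.{u}}

variable (K Q) in
/-- The projection from the free algebra on vertices and arrows to the path algebra. -/
noncomputable def pathMk : FreeAlgebra K (Q.V ⊕ Q.E) →ₐ[K] PathAlgebra K Q :=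
  RingQuot.mkAlgHom K (PathRel K Q)

theorem pathMk_rel {x y : FreeAlgebra K (Q.V ⊕ Q.E)} (h : PathRel K Q x y) :
    pathMk K Q x = pathMk K Q y :=
  RingQuot.mkAlgHom_rel K h

theorem pathMk_vert (v : Q.V) : pathMk K Q (FreeAlgebra.ι K (Sum.inl v)) = vert K v := rfl

theorem pathMk_arrow (a : Q.E) : pathMk K Q (FreeAlgebra.ι K (Sum.inr a)) = arrow K a := rfl

theorem vert_mul_self (v : Q.V) : vert K v * vert K v = vert K v := by
  simpa only [map_mul, pathMk_vert] using pathMk_rel (PathRel.idem (K := K) v)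

theorem vert_mul_vert_of_ne {v w : Q.V} (h : v ≠ w) : vert K v * vert K w = 0 := by
  simpa only [map_mul, pathMk_vert, map_zero] using pathMk_rel (PathRel.orth (K := K) v w h)

theorem sum_vert : ∑ v : Q.V, vert K v = 1 := by
  simpa only [map_sum, pathMk_vert, map_one] using pathMk_rel (PathRel.one (K := K) (Q := Q))

theorem vert_source_mul_arrow (a : Q.E) : vert K (Q.s a) * arrow K a = arrow K a := by
  simpa only [map_mul, pathMk_vert, pathMk_arrow] using pathMk_rel (PathRel.source (K := K) a)

theorem arrow_mul_vert_target (a : Q.E) : arrow K a * vert K (Q.t a) = arrow K a := by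
  simpa only [map_mul, pathMk_vert, pathMk_arrow] using pathMk_rel (PathRel.target (K := K) a)

theorem arrow_mul_arrow_of_ne {a b : Q.E} (h : Q.t a ≠ Q.s b) : arrow K a * arrow K b = 0 := by
  rw [← arrow_mul_vert_target a, ← vert_source_mul_arrow b, mul_assoc, ← mul_assoc (vert K _),
    vert_mul_vert_of_ne h, zero_mul, mul_zero]

theorem PathAlgebra.induction {p : PathAlgebra K Q → Prop}
    (hC : ∀ c : K, p (algebraMap K _ c)) (hv : ∀ v, p (vert K v)) (ha : ∀ a, p (arrow K a))
    (hadd : ∀ x y, p x → p y → p (x + y)) (hmul : ∀ x y, p x → p y → p (x * y))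
    (x : PathAlgebra K Q) : p x := by
  obtain ⟨x, rfl⟩ := RingQuot.mkAlgHom_surjective K (PathRel K Q) x
  refine FreeAlgebra.induction K (Q.V ⊕ Q.E)
    (motive := fun x => p (RingQuot.mkAlgHom K (PathRel K Q) x)) ?_ ?_ ?_ ?_ x
  · intro c
    rw [AlgHom.commutes]
    exact hC c
  · rintro (v | a)
    · exact hv v
    · exact ha a
  · intro x y hx hy
    rw [map_mul]
    exact hmul _ _ hx hy
  · intro x y hx hy
    rw [map_add]
    exact hadd _ _ hx hy

/-- A representation of the quiver, given as a homomorphism out of the path algebra. -/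
noncomputable def pathLift {A : Type*} [Ring A] [Algebra K A] (e : Q.V → A) (x : Q.E → A)
    (idem : ∀ v, e v * e v = e v) (orth : ∀ v w, v ≠ w → e v * e w = 0) (one : ∑ v, e v = 1)
    (source : ∀ a, e (Q.s a) * x a = x a) (target : ∀ a, x a * e (Q.t a) = x a) :
    PathAlgebra K Q →ₐ[K] A :=
  RingQuot.liftAlgHom K ⟨FreeAlgebra.lift K (Sum.elim e x), by
    intro y z h
    induction h with
    | idem v => simpa using idem v
    | orth v w h => simpa using orth v w h
    | one => simpa using one
    | source a => simpa using source a
    | target a => simpa using target a⟩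

section

variable {A : Type*} [Ring A] [Algebra K A] (e : Q.V → A) (x : Q.E → A)
    (idem : ∀ v, e v * e v = e v) (orth : ∀ v w, v ≠ w → e v * e w = 0) (one : ∑ v, e v = 1)
    (source : ∀ a, e (Q.s a) * x a = x a) (target : ∀ a, x a * e (Q.t a) = x a)

theorem pathLift_vert (v : Q.V) :
    pathLift (K := K) e x idem orth one source target (vert K v) = e v := by
  unfold pathLift vert
  erw [RingQuot.liftAlgHom_mkAlgHom_apply]
  simp

theorem pathLift_arrow (a : Q.E) :
    pathLift (K := K) e x idem orth one source target (arrow K a) = x a := by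
  unfold pathLift arrow
  erw [RingQuot.liftAlgHom_mkAlgHom_apply]
  simp

end

/-- The representation with basis `B` in which the arrow `a` acts by the 0-1 matrix of the relation
`S a`, where `p i` is the vertex of the basis element `i`. -/
noncomputable def graphRep {B : Type*} [Fintype B] [DecidableEq B] (p : B → Q.V)
    (S : Q.E → B → B → Prop) (hs : ∀ a i j, S a i j → p i = Q.s a)
    (ht : ∀ a i j, S a i j → p j = Q.t a) : PathAlgebra K Q →ₐ[K] Matrix B B K :=
  open Classical in
  pathLift (fun v => Matrix.diagonal fun i => if p i = v then 1 else 0)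
    (fun a => Matrix.of fun i j => if S a i j then 1 else 0)
    (fun v => by rw [Matrix.diagonal_mul_diagonal]; congr 1; funext i; split_ifs <;> simp)
    (fun v w h => by
      rw [Matrix.diagonal_mul_diagonal, ← Matrix.diagonal_zero]
      congr 1; funext i; split_ifs with h1 h2 <;> simp
      exact h (h1.symm.trans h2))
    (by
      ext i j
      rw [Matrix.sum_apply]
      by_cases hij : i = j
      · subst hij
        rw [Finset.sum_eq_single (p i) (fun v _ hv => by simp [hv.symm]) (by simp)]
        simp
      · simp [hij])
    (fun a => by
      ext i j
      rw [Matrix.diagonal_mul]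
      by_cases h : S a i j
      · simp [h, hs a i j h]
      · simp [h])
    (fun a => by
      ext i j
      rw [Matrix.mul_diagonal]
      by_cases h : S a i j
      · simp [h, ht a i j h]
      · simp [h])

section

variable {B : Type*} [Fintype B] [DecidableEq B] (p : B → Q.V)
    (S : Q.E → B → B → Prop) (hs : ∀ a i j, S a i j → p i = Q.s a)
    (ht : ∀ a i j, S a i j → p j = Q.t a)

open Classical in
theorem graphRep_vert (v : Q.V) : graphRep (K := K) p S hs ht (vert K v) =
    Matrix.diagonal fun i => if p i = v then 1 else 0 := by
  unfold graphRep; rw [pathLift_vert]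

open Classical in
theorem graphRep_arrow (a : Q.E) : graphRep (K := K) p S hs ht (arrow K a) =
    Matrix.of fun i j => if S a i j then 1 else 0 := by
  unfold graphRep; rw [pathLift_arrow]

theorem graphRep_arrow_mul_arrow_eq_zero {a b : Q.E} (h : ∀ i j l, S a i j → ¬ S b j l) :
    graphRep (K := K) p S hs ht (arrow K a * arrow K b) = 0 := by
  classical
  rw [map_mul, graphRep_arrow, graphRep_arrow]
  ext i l
  rw [Matrix.mul_apply, Matrix.zero_apply]
  refine Finset.sum_eq_zero fun j _ => ?_
  by_cases h1 : S a i j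
  · simp [h i j l h1]
  · simp [h1]

theorem vecMul_graphRep_arrow_of_forall_not {a : Q.E} {i : B} (h : ∀ j, ¬ S a i j) :
    Matrix.vecMul (Pi.single i 1) (graphRep (K := K) p S hs ht (arrow K a)) = 0 := by
  classical
  rw [graphRep_arrow, Matrix.single_one_vecMul]
  ext j
  simp [h j]

theorem vecMul_graphRep_arrow_of_iff {a : Q.E} {i k : B} (h : ∀ j, S a i j ↔ j = k) :
    Matrix.vecMul (Pi.single i 1) (graphRep (K := K) p S hs ht (arrow K a)) = Pi.single k 1 := by
  classical
  rw [graphRep_arrow, Matrix.single_one_vecMul]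
  ext j
  simp [h j, Pi.single_apply]

end

/-- Otherwise the representation with three basis vectors, sent from the first to the second by `a`
and from the second to the third by `b`, kills every generator but not `ab`. The positions keep the
two steps apart, so `a = b` is allowed. Hence the ideal contains no composable products of two
arrows besides its generators. -/
theorem mem_relations_of_arrow_mul_arrow_mem {ρ : Set (Q.E × Q.E)}
    {I : TwoSidedIdeal (PathAlgebra K Q)}
    (hI : I = TwoSidedIdeal.span ((fun p : Q.E × Q.E => arrow K p.1 * arrow K p.2) '' ρ))
    {a b : Q.E} (hab : Q.t a = Q.s b) (h : arrow K a * arrow K b ∈ I) : (a, b) ∈ ρ := by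
  classical
  by_contra hn
  let p : Fin 3 → Q.V := ![Q.s a, Q.t a, Q.t b]
  let S : Q.E → Fin 3 → Fin 3 → Prop := fun c i j =>
    (c = a ∧ i = 0 ∧ j = 1) ∨ (c = b ∧ i = 1 ∧ j = 2)
  have hs : ∀ c i j, S c i j → p i = Q.s c := by
    rintro c i j (⟨rfl, rfl, rfl⟩ | ⟨rfl, rfl, rfl⟩)
    · rfl
    · exact hab
  have ht : ∀ c i j, S c i j → p j = Q.t c := by
    rintro c i j (⟨rfl, rfl, rfl⟩ | ⟨rfl, rfl, rfl⟩) <;> rfl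
  have key : I ≤ TwoSidedIdeal.ker (graphRep (K := K) p S hs ht) := by
    rw [hI, TwoSidedIdeal.span_le]
    rintro _ ⟨⟨c, d⟩, hp, rfl⟩
    refine (TwoSidedIdeal.mem_ker _).2 (graphRep_arrow_mul_arrow_eq_zero _ _ _ _ ?_)
    rintro i j l (⟨rfl, rfl, rfl⟩ | ⟨rfl, rfl, rfl⟩) (⟨h1, h2, h3⟩ | ⟨h1, h2, h3⟩)
    · exact absurd h2 (by decide)
    · exact hn (h1 ▸ hp)
    · exact absurd h2 (by decide)
    · exact absurd h2 (by decide)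
  have h0 := (TwoSidedIdeal.mem_ker _).1 (key h)
  rw [map_mul, graphRep_arrow, graphRep_arrow] at h0
  have := congrFun (congrFun h0 0) 2
  simp [Matrix.mul_apply, S] at this

end PathAlgebraLemmas

/-! ### The bound algebra `KQ/I` -/

section BoundAlgebraLemmas

variable {K : Type u} [Field K] {Q : FinQuiver.{u}} {I : TwoSidedIdeal (PathAlgebra K Q)}

variable (I) in
/-- The trivial path `e_v` in `KQ/I`. -/
noncomputable def ev (v : Q.V) : BoundAlgebra I := I.ringCon.mk' (vert K v)

variable (I) in
/-- The class of an arrow in `KQ/I`. -/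
noncomputable def ar (a : Q.E) : BoundAlgebra I := I.ringCon.mk' (arrow K a)

theorem mk'_eq_zero_iff {x : PathAlgebra K Q} : I.ringCon.mk' x = 0 ↔ x ∈ I := by
  rw [← map_zero I.ringCon.mk', TwoSidedIdeal.mem_iff]
  exact RingCon.eq _

theorem ev_mul_self (v : Q.V) : ev I v * ev I v = ev I v := by
  unfold ev; rw [← map_mul, vert_mul_self]

theorem ev_mul_ev_of_ne {v w : Q.V} (h : v ≠ w) : ev I v * ev I w = 0 := by
  unfold ev; rw [← map_mul, vert_mul_vert_of_ne h, map_zero]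

theorem sum_ev : ∑ v : Q.V, ev I v = 1 := by
  unfold ev; rw [← map_sum, sum_vert, map_one]

theorem ev_source_mul_ar (a : Q.E) : ev I (Q.s a) * ar I a = ar I a := by
  unfold ev ar; rw [← map_mul, vert_source_mul_arrow]

theorem ar_mul_ev_target (a : Q.E) : ar I a * ev I (Q.t a) = ar I a := by
  unfold ev ar; rw [← map_mul, arrow_mul_vert_target]

theorem ev_mul_ar_of_ne {v : Q.V} {a : Q.E} (h : Q.s a ≠ v) : ev I v * ar I a = 0 := by
  rw [← ev_source_mul_ar, ← mul_assoc, ev_mul_ev_of_ne h.symm, zero_mul]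

theorem ar_mul_ev_of_ne {v : Q.V} {a : Q.E} (h : Q.t a ≠ v) : ar I a * ev I v = 0 := by
  rw [← ar_mul_ev_target, mul_assoc, ev_mul_ev_of_ne h, mul_zero]

theorem ar_mul_ar_eq_zero_iff {a b : Q.E} :
    ar I a * ar I b = 0 ↔ arrow K a * arrow K b ∈ I := by
  unfold ar; rw [← map_mul, mk'_eq_zero_iff]

theorem target_eq_source_of_mul_ne_zero {a b : Q.E} (h : ar I a * ar I b ≠ 0) :
    Q.t a = Q.s b := by
  by_contra hn
  apply h
  rw [ar_mul_ar_eq_zero_iff, arrow_mul_arrow_of_ne hn]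
  exact I.zero_mem

theorem BoundAlgebra.induction {p : BoundAlgebra I → Prop}
    (hC : ∀ c : K, p (algebraMap K _ c)) (hv : ∀ v, p (ev I v)) (ha : ∀ a, p (ar I a))
    (hadd : ∀ x y, p x → p y → p (x + y)) (hmul : ∀ x y, p x → p y → p (x * y))
    (x : BoundAlgebra I) : p x := by
  obtain ⟨x, rfl⟩ := RingCon.mk'_surjective (c := I.ringCon) x
  induction x using PathAlgebra.induction with
  | hC c => exact hC c
  | hv v => exact hv v
  | ha a => exact ha a
  | hadd x y hx hy => rw [map_add]; exact hadd _ _ hx hy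
  | hmul x y hx hy => rw [map_mul]; exact hmul _ _ hx hy

/-- Every element of `KQ/I` is a combination of trivial paths plus a sum of multiples of arrows. -/
theorem exists_expansion (u : BoundAlgebra I) : ∃ (c : Q.V → K) (w : Q.E → BoundAlgebra I),
    u = ∑ v, c v • ev I v + ∑ a, ar I a * w a := by
  classical
  have hadd : ∀ x y : BoundAlgebra I,
      (∃ (c : Q.V → K) (w : Q.E → BoundAlgebra I), x = ∑ v, c v • ev I v + ∑ a, ar I a * w a) →
      (∃ (c : Q.V → K) (w : Q.E → BoundAlgebra I), y = ∑ v, c v • ev I v + ∑ a, ar I a * w a) →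
      (∃ (c : Q.V → K) (w : Q.E → BoundAlgebra I),
        x + y = ∑ v, c v • ev I v + ∑ a, ar I a * w a) := by
    rintro _ _ ⟨c, w, rfl⟩ ⟨c', w', rfl⟩
    refine ⟨c + c', w + w', ?_⟩
    simp only [Pi.add_apply, add_smul, mul_add, Finset.sum_add_distrib]
    abel
  induction u using BoundAlgebra.induction with
  | hC c =>
    refine ⟨fun _ => c, 0, ?_⟩
    rw [← Finset.smul_sum, sum_ev, Algebra.algebraMap_eq_smul_one]
    simp
  | hv v =>
    refine ⟨Pi.single v 1, 0, ?_⟩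
    simp [Pi.single_apply, ite_smul]
  | ha a =>
    refine ⟨0, Pi.single a 1, ?_⟩
    simp [Pi.single_apply]
  | hadd x y hx hy => exact hadd x y hx hy
  | hmul x y hx hy =>
    obtain ⟨c, w, rfl⟩ := hx
    obtain ⟨c', w', rfl⟩ := hy
    set y := ∑ v, c' v • ev I v + ∑ a, ar I a * w' a with hy
    have h1 : ∀ v, ev I v * y = c' v • ev I v +
        ∑ a, ar I a * (if Q.s a = v then w' a else 0) := by
      intro v
      rw [hy, mul_add, Finset.mul_sum, Finset.mul_sum]
      congr 1
      · rw [Finset.sum_eq_single v]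
        · rw [mul_smul_comm, ev_mul_self]
        · intro v' _ hv'
          rw [mul_smul_comm, ev_mul_ev_of_ne hv'.symm, smul_zero]
        · simp
      · refine Finset.sum_congr rfl fun a _ => ?_
        split_ifs with h
        · rw [← mul_assoc, ← h, ev_source_mul_ar]
        · rw [← mul_assoc, ev_mul_ar_of_ne h, zero_mul, mul_zero]
    -- Trivial paths multiply pointwise; an arrow `a` of the second factor meets only the trivial
    -- path at its source, and an arrow of the first factor absorbs the whole second factor.
    refine ⟨fun v => c v * c' v, fun a => c (Q.s a) • w' a + w a * y, ?_⟩
    rw [add_mul, Finset.sum_mul, Finset.sum_mul]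
    simp only [smul_mul_assoc, h1, smul_add, smul_smul, mul_add, Finset.sum_add_distrib, mul_assoc,
      add_assoc]
    congr 2
    simp only [Finset.smul_sum]
    rw [Finset.sum_comm]
    refine Finset.sum_congr rfl fun a _ => ?_
    rw [Finset.sum_eq_single (Q.s a)]
    · simp
    · intro v _ hv
      simp [hv.symm]
    · simp

/-- The representation of `KQ/I` that a representation of `Q` annihilating `I` gives. -/
noncomputable def boundLift {A : Type*} [Ring A] [Algebra K A] (φ : PathAlgebra K Q →ₐ[K] A)
    (h : ∀ x ∈ I, φ x = 0) : BoundAlgebra I →ₐ[K] A :=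
  { I.ringCon.lift (φ : PathAlgebra K Q →+* A) (by
      intro x y hxy
      have h1 := h _ ((TwoSidedIdeal.rel_iff I x y).1 hxy)
      rw [map_sub, sub_eq_zero] at h1
      exact h1) with
    commutes' := fun c => φ.commutes c }

theorem boundLift_ev {A : Type*} [Ring A] [Algebra K A] (φ : PathAlgebra K Q →ₐ[K] A)
    (h : ∀ x ∈ I, φ x = 0) (v : Q.V) : boundLift φ h (ev I v) = φ (vert K v) := rfl

theorem boundLift_ar {A : Type*} [Ring A] [Algebra K A] (φ : PathAlgebra K Q →ₐ[K] A)
    (h : ∀ x ∈ I, φ x = 0) (a : Q.E) : boundLift φ h (ar I a) = φ (arrow K a) := rfl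

theorem GeneratedByQuadraticPaths.map_eq_zero (hI : GeneratedByQuadraticPaths I) {A : Type*}
    [Ring A] [Algebra K A] (φ : PathAlgebra K Q →ₐ[K] A)
    (h : ∀ a b, arrow K a * arrow K b ∈ I → φ (arrow K a * arrow K b) = 0) :
    ∀ x ∈ I, φ x = 0 := by
  have key : I ≤ TwoSidedIdeal.ker φ := by
    obtain ⟨ρ, -, hρ⟩ := hI
    conv_lhs => rw [hρ]
    rw [TwoSidedIdeal.span_le]
    rintro _ ⟨p, hp, rfl⟩
    refine (TwoSidedIdeal.mem_ker _).2 (h _ _ ?_)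
    rw [hρ]
    exact TwoSidedIdeal.subset_span ⟨p, hp, rfl⟩
  exact fun x hx => (TwoSidedIdeal.mem_ker _).1 (key hx)

end BoundAlgebraLemmas

/-! ### Augmentation, nilpotency and the trace of a path -/

section GentleLemmas

variable {K : Type u} [Field K] {Q : FinQuiver.{u}} {I : TwoSidedIdeal (PathAlgebra K Q)}

/-- The augmentation of `KQ/I`, with values in the semisimple quotient. -/
noncomputable def aug (hI : GeneratedByQuadraticPaths I) : BoundAlgebra I →ₐ[K] (Q.V → K) :=
  open Classical in
  boundLift (pathLift (fun v => Pi.single v 1) (fun _ => 0)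
    (fun v => by classical rw [← Pi.single_mul, mul_one])
    (fun v w h => by
      ext i
      by_cases hi : i = v
      · subst hi; simp [h]
      · simp [hi])
    (by
      ext i
      rw [Finset.sum_apply, Finset.sum_eq_single i (fun v _ hv => by simp [hv.symm]) (by simp)]
      simp)
    (by simp) (by simp))
    (hI.map_eq_zero _ fun a b _ => by rw [map_mul, pathLift_arrow, zero_mul])

open Classical in
theorem aug_ev (hI : GeneratedByQuadraticPaths I) (v : Q.V) :
    aug hI (ev I v) = Pi.single v 1 := by
  rw [aug, boundLift_ev, pathLift_vert]

theorem aug_ar (hI : GeneratedByQuadraticPaths I) (a : Q.E) : aug hI (ar I a) = 0 := by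
  rw [aug, boundLift_ar, pathLift_arrow]

theorem aug_ev_self (hI : GeneratedByQuadraticPaths I) (v : Q.V) : aug hI (ev I v) v = 1 := by
  classical
  rw [aug_ev, Pi.single_eq_same]

theorem aug_mul_apply (hI : GeneratedByQuadraticPaths I) (x y : BoundAlgebra I) (v : Q.V) :
    aug hI (x * y) v = aug hI x v * aug hI y v := by
  rw [map_mul, Pi.mul_apply]

theorem aug_ar_mul (hI : GeneratedByQuadraticPaths I) (a : Q.E) (x : BoundAlgebra I) :
    aug hI (ar I a * x) = 0 := by
  rw [map_mul, aug_ar, zero_mul]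

theorem exists_expansion_aug (hI : GeneratedByQuadraticPaths I) (u : BoundAlgebra I) :
    ∃ w : Q.E → BoundAlgebra I, u = ∑ v, aug hI u v • ev I v + ∑ a, ar I a * w a := by
  classical
  obtain ⟨c, w, h⟩ := exists_expansion u
  have hc : aug hI u = c := by
    rw [h]
    ext v
    simp only [map_add, map_sum, map_smul, aug_ev, aug_ar_mul, Pi.add_apply, Finset.sum_apply,
      Pi.smul_apply, Pi.zero_apply, Finset.sum_const_zero, add_zero, smul_eq_mul]
    rw [Finset.sum_eq_single v]
    · simp
    · intro v' _ hv'; simp [hv'.symm]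
    · simp
  exact ⟨w, by rw [hc]; exact h⟩

/-- The expansion of an element of `e_v Λ`. -/
theorem exists_expansion_of_ev_mul (hI : GeneratedByQuadraticPaths I) {u : BoundAlgebra I}
    {v : Q.V} (hu : ev I v * u = u) : ∃ w : Q.E → BoundAlgebra I, (∀ a, Q.s a ≠ v → w a = 0) ∧
      u = aug hI u v • ev I v + ∑ a, ar I a * w a := by
  classical
  obtain ⟨w, h⟩ := exists_expansion_aug hI u
  refine ⟨fun a => if Q.s a = v then w a else 0, fun a ha => if_neg ha, ?_⟩
  conv_lhs => rw [← hu, h]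
  rw [mul_add, Finset.mul_sum, Finset.mul_sum]
  congr 1
  · rw [Finset.sum_eq_single v]
    · rw [mul_smul_comm, ev_mul_self]
    · intro v' _ hv'
      rw [mul_smul_comm, ev_mul_ev_of_ne hv'.symm, smul_zero]
    · simp
  · refine Finset.sum_congr rfl fun a _ => ?_
    dsimp only
    split_ifs with h
    · rw [← mul_assoc, ← h, ev_source_mul_ar]
    · rw [← mul_assoc, ev_mul_ar_of_ne h, zero_mul, mul_zero]

theorem IsAdmissible.exists_prod_eq_zero (h : IsAdmissible I) :
    ∃ m : ℕ, ∀ l : List Q.E, l.length = m → (l.map (ar I)).prod = 0 := by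
  obtain ⟨⟨m, -, hm⟩, -⟩ := h
  refine ⟨m, fun l hl => ?_⟩
  have h1 : (l.map (arrow K)).prod ∈ I := hm (TwoSidedIdeal.subset_span ⟨l, hl, rfl⟩)
  rw [← mk'_eq_zero_iff, map_list_prod, List.map_map] at h1
  exact h1

variable (I) in
/-- The span of the arrows. -/
noncomputable def arrowSpan : Submodule K (BoundAlgebra I) := Submodule.span K (Set.range (ar I))

/-- Expand the left factor: a trivial path fixes or kills an arrow, and every other term already
begins with an arrow. So the right ideal generated by the arrows is two-sided. -/
theorem top_mul_arrowSpan_le : (⊤ : Submodule K (BoundAlgebra I)) * arrowSpan I ≤ arrowSpan I *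
    ⊤ := by
  rw [Submodule.mul_le]
  intro u _ x hx
  obtain ⟨c, w, rfl⟩ := exists_expansion u
  rw [add_mul]
  refine add_mem ?_ ?_
  · rw [Finset.sum_mul]
    refine sum_mem fun v _ => ?_
    rw [← mul_one (_ * x)]
    refine Submodule.mul_mem_mul ?_ trivial
    rw [smul_mul_assoc]
    refine Submodule.smul_mem _ _ ?_
    unfold arrowSpan at hx
    induction hx using Submodule.span_induction with
    | mem x h =>
      obtain ⟨a, rfl⟩ := h
      by_cases ha : Q.s a = v
      · rw [← ha, ev_source_mul_ar]; exact Submodule.subset_span ⟨a, rfl⟩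
      · rw [ev_mul_ar_of_ne ha]; exact zero_mem _
    | zero => rw [mul_zero]; exact zero_mem _
    | add x y _ _ hx hy => rw [mul_add]; exact add_mem hx hy
    | smul c x _ hx => rw [mul_smul_comm]; exact Submodule.smul_mem _ _ hx
  · rw [Finset.sum_mul]
    refine sum_mem fun a _ => ?_
    rw [mul_assoc]
    exact Submodule.mul_mem_mul (Submodule.subset_span ⟨a, rfl⟩) trivial

/-- Arrows can be collected on the left, past arbitrary elements. Thus the nilpotency of products of
arrows passes to the whole ideal they generate. -/
theorem arrowSpan_mul_top_pow_le (n : ℕ) :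
    (arrowSpan I * (⊤ : Submodule K (BoundAlgebra I))) ^ n ≤ arrowSpan I ^ n * ⊤ := by
  have htop : ∀ n : ℕ, (⊤ : Submodule K (BoundAlgebra I)) * arrowSpan I ^ n ≤ arrowSpan I ^ n *
      ⊤ := by
    intro n
    induction n with
    | zero => rw [pow_zero, mul_one, one_mul]
    | succ n ih =>
      rw [pow_succ, ← mul_assoc]
      calc _ ≤ arrowSpan I ^ n * ⊤ * arrowSpan I := mul_le_mul' ih le_rfl
        _ ≤ _ := by rw [mul_assoc, mul_assoc]; exact mul_le_mul' le_rfl top_mul_arrowSpan_le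
  induction n with
  | zero => rw [pow_zero, pow_zero, one_mul]; exact le_top
  | succ n ih =>
    rw [pow_succ', pow_succ']
    calc _ ≤ arrowSpan I * ⊤ * (arrowSpan I ^ n * ⊤) := mul_le_mul' le_rfl ih
      _ = arrowSpan I * (⊤ * arrowSpan I ^ n) * ⊤ := by simp only [mul_assoc]
      _ ≤ arrowSpan I * (arrowSpan I ^ n * ⊤) * ⊤ :=
        mul_le_mul' (mul_le_mul' le_rfl (htop n)) le_rfl
      _ ≤ _ := by
        simp only [mul_assoc]
        exact mul_le_mul' le_rfl (mul_le_mul' le_rfl le_top)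

theorem IsAdmissible.exists_arrowSpan_pow_eq_bot (h : IsAdmissible I) :
    ∃ m : ℕ, arrowSpan I ^ m = ⊥ := by
  obtain ⟨m, hm⟩ := h.exists_prod_eq_zero
  refine ⟨m, ?_⟩
  have key : ∀ n : ℕ, arrowSpan I ^ n ≤
      Submodule.span K {x | ∃ l : List Q.E, l.length = n ∧ (l.map (ar I)).prod = x} := by
    intro n
    induction n with
    | zero =>
      rw [pow_zero, Submodule.one_eq_span]
      exact Submodule.span_mono (by rintro _ rfl; exact ⟨[], rfl, rfl⟩)
    | succ n ih =>
      rw [pow_succ']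
      refine (mul_le_mul' le_rfl ih).trans ?_
      rw [arrowSpan, Submodule.span_mul_span]
      refine Submodule.span_mono ?_
      rintro _ ⟨_, ⟨a, rfl⟩, _, ⟨l, hl, rfl⟩, rfl⟩
      exact ⟨a :: l, by simp [hl], by simp⟩
  rw [eq_bot_iff]
  refine (key m).trans (Submodule.span_le.2 ?_)
  rintro _ ⟨l, hl, rfl⟩
  exact hm l hl

/-- The kernel of the augmentation. -/
noncomputable def augKer (hI : GeneratedByQuadraticPaths I) : Submodule K (BoundAlgebra I) :=
  LinearMap.ker (aug hI).toLinearMap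

theorem mem_augKer {hI : GeneratedByQuadraticPaths I} {x : BoundAlgebra I} :
    x ∈ augKer hI ↔ aug hI x = 0 := LinearMap.mem_ker

theorem augKer_le (hI : GeneratedByQuadraticPaths I) : augKer hI ≤ arrowSpan I * ⊤ := by
  intro x hx
  obtain ⟨w, h⟩ := exists_expansion_aug hI x
  rw [mem_augKer.1 hx] at h
  rw [h]
  simp only [Pi.zero_apply, zero_smul, Finset.sum_const_zero, zero_add]
  exact sum_mem fun a _ => Submodule.mul_mem_mul (Submodule.subset_span ⟨a, rfl⟩) trivial

theorem IsGentle.exists_augKer_pow_eq_bot (hI : IsGentle I) :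
    ∃ m : ℕ, augKer hI.quadratic ^ m = ⊥ := by
  obtain ⟨m, hm⟩ := hI.admissible.exists_arrowSpan_pow_eq_bot
  refine ⟨m, eq_bot_iff.2 ((pow_le_pow_left' (augKer_le _) _).trans
    ((arrowSpan_mul_top_pow_le m).trans ?_))⟩
  rw [hm, Submodule.bot_mul]

/-- Elements of augmentation zero are nilpotent, and a nonzero scalar plus a nilpotent element is a
unit. -/
theorem IsGentle.exists_mul_eq_one (hI : IsGentle I) {c : K} (hc : c ≠ 0) {ρ : BoundAlgebra I}
    (hρ : aug hI.quadratic ρ = 0) : ∃ y, (algebraMap K _ c + ρ) * y = 1 := by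
  obtain ⟨m, hm⟩ := hI.exists_augKer_pow_eq_bot
  have hn : IsNilpotent ρ := ⟨m, by
    have := Submodule.pow_mem_pow (augKer hI.quadratic) (mem_augKer.2 hρ) m
    rwa [hm] at this⟩
  have hu : IsUnit (algebraMap K (BoundAlgebra I) c + ρ) :=
    hn.isUnit_add_left_of_commute ((IsUnit.mk0 c hc).map _) (Algebra.commutes' c ρ).symm
  exact hu.exists_right_inv

theorem IsGentle.finite (hI : IsGentle I) : Module.Finite K (BoundAlgebra I) := by
  obtain ⟨m, hm⟩ := hI.admissible.exists_arrowSpan_pow_eq_bot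
  -- Up to products of `n` arrows the algebra is spanned by finitely many elements; for `n = m`
  -- nothing is left over.
  have key : ∀ n : ℕ, ∃ N : Submodule K (BoundAlgebra I), N.FG ∧ ⊤ ≤ N ⊔ arrowSpan I ^ n * ⊤ := by
    intro n
    induction n with
    | zero => exact ⟨⊥, Submodule.fg_bot, by simp⟩
    | succ n ih =>
      obtain ⟨N, hN, h⟩ := ih
      let E := Submodule.span K (Set.range (ev I))
      have hE : (⊤ : Submodule K (BoundAlgebra I)) ≤ E ⊔ arrowSpan I * ⊤ := by
        intro u _
        obtain ⟨c, w, rfl⟩ := exists_expansion u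
        refine add_mem (Submodule.mem_sup_left ?_) (Submodule.mem_sup_right ?_)
        · exact sum_mem fun v _ => Submodule.smul_mem _ _ (Submodule.subset_span ⟨v, rfl⟩)
        · exact sum_mem fun a _ => Submodule.mul_mem_mul (Submodule.subset_span ⟨a, rfl⟩) trivial
      have hA : (arrowSpan I).FG := Submodule.fg_span (Set.finite_range _)
      refine ⟨N ⊔ arrowSpan I ^ n * E,
        hN.sup ((hA.pow n).mul (Submodule.fg_span (Set.finite_range _))), h.trans ?_⟩
      rw [sup_assoc]
      refine sup_le_sup le_rfl ((mul_le_mul' le_rfl hE).trans ?_)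
      rw [Submodule.mul_sup, pow_succ, mul_assoc]
  obtain ⟨N, hN, h⟩ := key m
  rw [hm, Submodule.bot_mul, sup_bot_eq, top_le_iff] at h
  exact ⟨h ▸ hN⟩

/-- The representation with basis elements `inl a` and `inr a` for every arrow `a`, in which
`inl a` is sent to `inr a` by `a`, and `inr a` to `inr b` by `b` if `ab ∉ I`. -/
noncomputable def traceRep (hI : GeneratedByQuadraticPaths I) [DecidableEq Q.E] :
    BoundAlgebra I →ₐ[K] Matrix (Q.E ⊕ Q.E) (Q.E ⊕ Q.E) K :=
  boundLift (graphRep (Sum.elim Q.s Q.t)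
    (fun c i j => (i = Sum.inl c ∧ j = Sum.inr c) ∨
      ∃ b, ar I b * ar I c ≠ 0 ∧ i = Sum.inr b ∧ j = Sum.inr c)
    (by
      rintro c i j (⟨rfl, rfl⟩ | ⟨b, h, rfl, rfl⟩)
      · rfl
      · exact target_eq_source_of_mul_ne_zero h)
    (by
      rintro c i j (⟨rfl, rfl⟩ | ⟨b, h, rfl, rfl⟩) <;> rfl))
    (hI.map_eq_zero _ fun a b hab => by
      refine graphRep_arrow_mul_arrow_eq_zero _ _ _ _ ?_
      rw [← ar_mul_ar_eq_zero_iff] at hab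
      rintro i j l (⟨rfl, rfl⟩ | ⟨d, h, rfl, rfl⟩) (⟨h1, h2⟩ | ⟨d', h1, h2, h3⟩)
      · simp at h1
      · rw [Sum.inr.injEq] at h2; subst h2; exact h1 hab
      · simp at h1
      · rw [Sum.inr.injEq] at h2; subst h2; exact h1 hab)

open Classical in
/-- The orbit of the basis element `i` of the representation `traceRep`. -/
noncomputable def trace (hI : GeneratedByQuadraticPaths I) (i : Q.E ⊕ Q.E) (u : BoundAlgebra I) :
    Q.E ⊕ Q.E → K :=
  Matrix.vecMul (Pi.single i 1) (traceRep hI u)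

section

variable (hI : GeneratedByQuadraticPaths I)

theorem trace_add (i : Q.E ⊕ Q.E) (u w : BoundAlgebra I) :
    trace hI i (u + w) = trace hI i u + trace hI i w := by
  simp [trace, Matrix.vecMul_add]

theorem trace_zero (i : Q.E ⊕ Q.E) : trace hI i (0 : BoundAlgebra I) = 0 := by
  simp [trace]

theorem trace_sum {ι : Type*} (s : Finset ι) (i : Q.E ⊕ Q.E) (u : ι → BoundAlgebra I) :
    trace hI i (∑ j ∈ s, u j) = ∑ j ∈ s, trace hI i (u j) :=
  map_sum (⟨⟨trace hI i, trace_zero hI i⟩, trace_add hI i⟩ : BoundAlgebra I →+ (Q.E ⊕ Q.E → K)) u s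

theorem trace_one_ne_zero (i : Q.E ⊕ Q.E) : trace hI i (1 : BoundAlgebra I) ≠ 0 := by
  classical
  rw [trace, map_one, Matrix.vecMul_one]
  simp

theorem trace_mul_of_eq_zero {i : Q.E ⊕ Q.E} {u : BoundAlgebra I} (h : trace hI i u = 0)
    (w : BoundAlgebra I) : trace hI i (u * w) = 0 := by
  unfold trace at *
  rw [map_mul, ← Matrix.vecMul_vecMul, h, Matrix.zero_vecMul]

theorem trace_inl_ar_mul (a : Q.E) (w : BoundAlgebra I) :
    trace hI (Sum.inl a) (ar I a * w) = trace hI (Sum.inr a) w := by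
  classical
  unfold trace
  rw [map_mul, ← Matrix.vecMul_vecMul]
  congr 1
  rw [traceRep, boundLift_ar]
  refine vecMul_graphRep_arrow_of_iff _ _ _ _ ?_
  simp

theorem trace_inl_ar_mul_of_ne {a b : Q.E} (h : a ≠ b) (w : BoundAlgebra I) :
    trace hI (Sum.inl a) (ar I b * w) = 0 := by
  classical
  refine trace_mul_of_eq_zero hI ?_ w
  unfold trace
  rw [traceRep, boundLift_ar]
  refine vecMul_graphRep_arrow_of_forall_not _ _ _ _ ?_
  simp [h]

theorem trace_inr_ar_mul {a b : Q.E} (h : ar I a * ar I b ≠ 0) (w : BoundAlgebra I) :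
    trace hI (Sum.inr a) (ar I b * w) = trace hI (Sum.inr b) w := by
  classical
  unfold trace
  rw [map_mul, ← Matrix.vecMul_vecMul]
  congr 1
  rw [traceRep, boundLift_ar]
  refine vecMul_graphRep_arrow_of_iff _ _ _ _ ?_
  simp [h]

theorem trace_inr_ar_mul_of_eq_zero {a b : Q.E} (h : ar I a * ar I b = 0) (w : BoundAlgebra I) :
    trace hI (Sum.inr a) (ar I b * w) = 0 := by
  classical
  refine trace_mul_of_eq_zero hI ?_ w
  unfold trace
  rw [traceRep, boundLift_ar]
  refine vecMul_graphRep_arrow_of_forall_not _ _ _ _ ?_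
  simp [h]

theorem trace_inr_ev_mul (a : Q.E) (w : BoundAlgebra I) :
    trace hI (Sum.inr a) (ev I (Q.t a) * w) = trace hI (Sum.inr a) w := by
  classical
  unfold trace
  rw [map_mul, ← Matrix.vecMul_vecMul]
  congr 1
  rw [traceRep, boundLift_ev, graphRep_vert, Matrix.single_one_vecMul]
  ext j
  rw [Matrix.row, Matrix.diagonal_apply, Pi.single_apply]
  by_cases hj : j = Sum.inr a
  · subst hj; simp
  · simp [hj, Ne.symm hj]

theorem trace_eq_zero_of_ar_mul_eq_zero {a : Q.E} {w : BoundAlgebra I} (h : ar I a * w = 0) :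
    trace hI (Sum.inr a) w = 0 := by
  rw [← trace_inl_ar_mul, h, trace_zero]

end

/-! ### Cancellation, independence and annihilators of arrows -/

theorem IsGentle.next_unique (hI : IsGentle I) {a b b' : Q.E} (h : ar I a * ar I b ≠ 0)
    (h' : ar I a * ar I b' ≠ 0) : b = b' :=
  hI.right_notMem a b b' (fun hn => h (ar_mul_ar_eq_zero_iff.2 hn))
    (fun hn => h' (ar_mul_ar_eq_zero_iff.2 hn))

theorem IsGentle.prev_unique (hI : IsGentle I) {a c c' : Q.E} (h : ar I c * ar I a ≠ 0)
    (h' : ar I c' * ar I a ≠ 0) : c = c' :=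
  hI.left_notMem a c c' (fun hn => h (ar_mul_ar_eq_zero_iff.2 hn))
    (fun hn => h' (ar_mul_ar_eq_zero_iff.2 hn))

/-- The basis element `inr a` remembers that the last arrow was `a`. It sees the trivial path at
`t(a)` and the unique arrow `b` with `ab ≠ 0`, and nothing else; a vanishing trace therefore removes
the trivial path and passes on to `b`. -/
theorem IsGentle.exists_expansion_of_trace_eq_zero (hI : IsGentle I) {a : Q.E} {w : BoundAlgebra I}
    (hw : ev I (Q.t a) * w = w) (h : trace hI.quadratic (Sum.inr a) w = 0) :
    ∃ w' : Q.E → BoundAlgebra I, (∀ b, Q.s b ≠ Q.t a → w' b = 0) ∧ w = ∑ b, ar I b * w' b ∧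
      ∀ b, ar I a * ar I b ≠ 0 → trace hI.quadratic (Sum.inr b) (w' b) = 0 := by
  obtain ⟨w', hw', he⟩ := exists_expansion_of_ev_mul hI.quadratic hw
  have hc : aug hI.quadratic w (Q.t a) = 0 := by
    by_contra hc
    -- If the trivial path occurred, its coefficient plus the arrow terms would be a unit with the
    -- same trace as `w`, and then the trace of `1` would vanish.
    obtain ⟨y, hy⟩ := hI.exists_mul_eq_one hc (ρ := ∑ a, ar I a * w' a)
      (by rw [map_sum]; exact Finset.sum_eq_zero fun b _ => aug_ar_mul _ _ _)
    refine trace_one_ne_zero hI.quadratic (Sum.inr a) (hy ▸ trace_mul_of_eq_zero _ ?_ y)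
    rw [← trace_inr_ev_mul, mul_add, ← Algebra.commutes, ← Algebra.smul_def, trace_add,
      trace_inr_ev_mul, ← trace_add, ← he, h]
  rw [hc, zero_smul, zero_add] at he
  refine ⟨w', hw', he, fun b hb => ?_⟩
  rw [he, trace_sum, Finset.sum_eq_single b, trace_inr_ar_mul _ hb] at h
  · exact h
  · intro b' _ hb'
    by_cases h0 : ar I a * ar I b' = 0
    · exact trace_inr_ar_mul_of_eq_zero _ h0 _
    · exact absurd (hI.next_unique h0 hb) hb'
  · simp

/-- The trace is faithful on `aΛ`, since every path has at most one nonzero continuation. This takes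
the place of a basis of paths in all cancellation arguments. -/
theorem IsGentle.ar_mul_eq_zero_of_trace (hI : IsGentle I) {a : Q.E} {w : BoundAlgebra I}
    (h : trace hI.quadratic (Sum.inr a) w = 0) : ar I a * w = 0 := by
  obtain ⟨m, hm⟩ := hI.admissible.exists_prod_eq_zero
  -- `l` collects the arrows already passed and `j` is what is missing to the length `m`, at which
  -- every product of arrows vanishes.
  have key : ∀ j k : ℕ, j + k = m → ∀ (l : List Q.E), l.length = k → ∀ (a : Q.E)
      (w : BoundAlgebra I), trace hI.quadratic (Sum.inr a) w = 0 →
      (l.map (ar I)).prod * (ar I a * w) = 0 := by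
    intro j
    induction j with
    | zero =>
      intro k hk l hl a w _
      rw [hm l (by omega), zero_mul]
    | succ j ih =>
      intro k hk l hl a w h
      have hw : ar I a * w = ar I a * (ev I (Q.t a) * w) := by
        rw [← mul_assoc, ar_mul_ev_target]
      rw [hw]
      rw [← trace_inr_ev_mul] at h
      obtain ⟨w', -, he, hz⟩ := hI.exists_expansion_of_trace_eq_zero
        (by rw [← mul_assoc, ev_mul_self]) h
      rw [he, Finset.mul_sum, Finset.mul_sum]
      refine Finset.sum_eq_zero fun b _ => ?_
      by_cases hb : ar I a * ar I b = 0
      · rw [← mul_assoc (ar I a), hb, zero_mul, mul_zero]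
      · have := ih (k + 1) (by omega) (l ++ [a]) (by simp [hl]) b (w' b) (hz b hb)
        simpa [mul_assoc] using this
  simpa using key m 0 rfl [] rfl a w h

/-- Different arrows generate independent right ideals. -/
theorem IsGentle.ar_mul_eq_zero_of_sum (hI : IsGentle I) {w : Q.E → BoundAlgebra I}
    (h : ∑ b, ar I b * w b = 0) (a : Q.E) : ar I a * w a = 0 := by
  refine hI.ar_mul_eq_zero_of_trace ?_
  rw [← trace_inl_ar_mul, ← trace_zero hI.quadratic (Sum.inl a), ← h, trace_sum]
  rw [Finset.sum_eq_single a (fun b _ hb => trace_inl_ar_mul_of_ne _ hb.symm _) (by simp)]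

theorem IsGentle.ar_mul_eq_zero_of_ar_mul_eq (hI : IsGentle I) {a b : Q.E} (hab : a ≠ b)
    {w w' : BoundAlgebra I} (h : ar I a * w = ar I b * w') : ar I a * w = 0 := by
  refine hI.ar_mul_eq_zero_of_trace ?_
  rw [← trace_inl_ar_mul, h, trace_inl_ar_mul_of_ne _ hab]

theorem IsGentle.ar_ne_zero (hI : IsGentle I) (a : Q.E) : ar I a ≠ 0 := by
  intro h
  refine trace_one_ne_zero hI.quadratic (Sum.inr a) (trace_eq_zero_of_ar_mul_eq_zero _ ?_)
  rw [h, zero_mul]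

/-- Once `b` has been read after `a`, the trace continues exactly as if it had started with `b`. So
left multiplication by `a` is injective on `bΛ`. -/
theorem IsGentle.ar_mul_eq_zero_of_ar_mul_ar_mul (hI : IsGentle I) {a b : Q.E}
    (hab : ar I a * ar I b ≠ 0) {w : BoundAlgebra I} (h : ar I a * (ar I b * w) = 0) :
    ar I b * w = 0 := by
  refine hI.ar_mul_eq_zero_of_trace ?_
  rw [← trace_inr_ar_mul _ hab]
  exact trace_eq_zero_of_ar_mul_eq_zero _ h

/-- The right annihilator of an arrow `a` in `e_{t(a)}Λ`. -/
theorem IsGentle.exists_expansion_of_ar_mul_eq_zero (hI : IsGentle I) {a : Q.E}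
    {u : BoundAlgebra I} (hu : ev I (Q.t a) * u = u) (h : ar I a * u = 0) :
    ∃ w : Q.E → BoundAlgebra I, (∀ b, Q.s b ≠ Q.t a ∨ ar I a * ar I b ≠ 0 → w b = 0) ∧
      u = ∑ b, ar I b * w b := by
  classical
  obtain ⟨w, hw, he, hz⟩ := hI.exists_expansion_of_trace_eq_zero hu
    (trace_eq_zero_of_ar_mul_eq_zero _ h)
  refine ⟨fun b => if ar I a * ar I b = 0 then w b else 0, ?_, ?_⟩
  · rintro b (hb | hb)
    · simp [hw b hb]
    · simp [hb]
  · conv_lhs => rw [he]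
    refine Finset.sum_congr rfl fun b _ => ?_
    dsimp only
    split_ifs with hb
    · rfl
    · rw [hI.ar_mul_eq_zero_of_trace (hz b hb), mul_zero]

/-- The two annihilators are spanned by the right ideals of the arrows that form a relation with
`a`, respectively with `b`. No arrow does so with both, and different arrows are independent. This
is what makes the generator at an inner sink free. -/
theorem IsGentle.eq_zero_of_two_ar_mul_eq_zero (hI : IsGentle I) {a b : Q.E} (hab : a ≠ b)
    (ht : Q.t a = Q.t b) {u : BoundAlgebra I} (hu : ev I (Q.t a) * u = u) (ha : ar I a * u = 0)
    (hb : ar I b * u = 0) : u = 0 := by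
  obtain ⟨w, hw, he⟩ := hI.exists_expansion_of_ar_mul_eq_zero hu ha
  obtain ⟨w', hw', he'⟩ := hI.exists_expansion_of_ar_mul_eq_zero (by rw [← ht]; exact hu) hb
  have h0 : ∑ c, ar I c * (w c - w' c) = 0 := by
    simp only [mul_sub, Finset.sum_sub_distrib]
    rw [← he, ← he', sub_self]
  rw [he]
  refine Finset.sum_eq_zero fun c _ => ?_
  have h1 := hI.ar_mul_eq_zero_of_sum h0 c
  by_cases hc : w c = 0
  · rw [hc, mul_zero]
  · have hc1 := not_or.1 (mt (hw c) hc)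
    simp only [not_not] at hc1
    have hc2 : w' c = 0 := by
      by_contra hn
      have hc2 := not_or.1 (mt (hw' c) hn)
      simp only [not_not] at hc2
      exact hab (hI.left_mem c a b hc1.1.symm hc2.1.symm (ar_mul_ar_eq_zero_iff.1 hc1.2)
        (ar_mul_ar_eq_zero_iff.1 hc2.2))
    rwa [hc2, sub_zero] at h1

end GentleLemmas

/-! ### Uniqueness of projective covers and syzygies -/

section ProjectiveCovers

variable {A : Type u} [Ring A]

/-- A lift of the isomorphism is onto because the kernel of the second cover is superfluous. It
splits, and the splitting is onto because the kernel of the first cover is superfluous; so the lift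
is bijective. -/
theorem IsProjectiveCover.exists_equiv {P M P' M' : ModuleCat.{u} A} {f : P →ₗ[A] M}
    {f' : P' →ₗ[A] M'} (hf : IsProjectiveCover f) (hf' : IsProjectiveCover f') (e : M ≃ₗ[A] M') :
    ∃ φ : P ≃ₗ[A] P', ∀ p, f' (φ p) = e (f p) := by
  obtain ⟨hP, hs, hk⟩ := hf
  obtain ⟨hP', hs', hk'⟩ := hf'
  obtain ⟨φ, hφ⟩ := Module.projective_lifting_property f' (e.toLinearMap ∘ₗ f) hs'
  have hφ' : ∀ p, f' (φ p) = e (f p) := fun p => LinearMap.congr_fun hφ p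
  have h1 : Function.Surjective φ := by
    rw [← LinearMap.range_eq_top]
    refine hk' _ (eq_top_iff.2 fun p' _ => ?_)
    obtain ⟨p, hp⟩ := hs (e.symm (f' p'))
    rw [← add_sub_cancel (φ p) p']
    refine add_mem (Submodule.mem_sup_left ⟨p, rfl⟩) (Submodule.mem_sup_right ?_)
    rw [LinearMap.mem_ker, map_sub, hφ', hp, e.apply_symm_apply, sub_self]
  obtain ⟨σ, hσ⟩ := Module.projective_lifting_property φ LinearMap.id h1
  have hσ' : ∀ p, φ (σ p) = p := fun p => LinearMap.congr_fun hσ p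
  have h2 : Function.Surjective σ := by
    rw [← LinearMap.range_eq_top]
    refine hk _ (eq_top_iff.2 fun p _ => ?_)
    rw [← add_sub_cancel (σ (φ p)) p]
    refine add_mem (Submodule.mem_sup_left ⟨φ p, rfl⟩) (Submodule.mem_sup_right ?_)
    rw [LinearMap.mem_ker]
    apply e.injective
    rw [← hφ', map_sub, hσ', sub_self, map_zero, map_zero]
  refine ⟨LinearEquiv.ofBijective φ ⟨fun x y hxy => ?_, h1⟩, hφ'⟩
  obtain ⟨x, rfl⟩ := h2 x
  obtain ⟨y, rfl⟩ := h2 y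
  rw [hσ', hσ'] at hxy
  rw [hxy]

theorem IsFirstSyzygy.nonempty_equiv {M X M' X' : ModuleCat.{u} A} (h : IsFirstSyzygy M X)
    (h' : IsFirstSyzygy M' X') (e : M ≃ₗ[A] M') : Nonempty (X ≃ₗ[A] X') := by
  obtain ⟨P, f, hf, ⟨g⟩⟩ := h
  obtain ⟨P', f', hf', ⟨g'⟩⟩ := h'
  obtain ⟨φ, hφ⟩ := hf.exists_equiv hf' e
  refine ⟨g ≪≫ₗ φ.ofSubmodules _ _ ?_ ≪≫ₗ g'.symm⟩
  ext p'
  rw [LinearMap.mem_ker]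
  constructor
  · rintro ⟨p, hp, rfl⟩
    exact (hφ p).trans (by rw [LinearMap.mem_ker.1 hp, map_zero])
  · intro hp
    refine ⟨φ.symm p', ?_, φ.apply_symm_apply p'⟩
    apply e.injective
    rw [← hφ, φ.apply_symm_apply, hp, map_zero]

theorem IsFirstSyzygy.of_equiv {M X M' : ModuleCat.{u} A} (h : IsFirstSyzygy M X)
    (e : M ≃ₗ[A] M') : IsFirstSyzygy M' X := by
  obtain ⟨P, f, ⟨hP, hs, hk⟩, ⟨g⟩⟩ := h
  have hker : LinearMap.ker (e.toLinearMap ∘ₗ f) = LinearMap.ker f := by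
    rw [LinearMap.ker_comp, LinearEquiv.ker, Submodule.comap_bot]
  refine ⟨P, e.toLinearMap ∘ₗ f, ⟨hP, e.surjective.comp hs, ?_⟩, ?_⟩
  · rw [hker]; exact hk
  · rw [hker]; exact ⟨g⟩

theorem IsFirstSyzygy.of_equiv_right {M X X' : ModuleCat.{u} A} (h : IsFirstSyzygy M X)
    (e : X' ≃ₗ[A] X) : IsFirstSyzygy M X' := by
  obtain ⟨P, f, hf, ⟨g⟩⟩ := h
  exact ⟨P, f, hf, ⟨e ≪≫ₗ g⟩⟩

theorem isSyzygy_one {M X : ModuleCat.{u} A} : IsSyzygy 1 M X ↔ IsFirstSyzygy M X := by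
  constructor
  · rintro ⟨Y, ⟨e⟩, h⟩
    exact h.of_equiv e
  · intro h
    exact ⟨M, ⟨LinearEquiv.refl _ _⟩, h⟩

theorem isFirstSyzygy_of_subsingleton (M X : ModuleCat.{u} A) [Subsingleton M] [Subsingleton X] :
    IsFirstSyzygy M X := by
  refine ⟨ModuleCat.of A PUnit, 0, ⟨?_, fun m => ⟨0, Subsingleton.elim _ _⟩, fun U _ =>
      Subsingleton.elim _ _⟩,
    ⟨⟨0, 0, fun _ => Subsingleton.elim _ _, fun _ => ?_⟩⟩⟩
  · have : Module.Free A PUnit.{u + 1} := Module.Free.of_subsingleton A _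
    exact Module.Projective.of_free (R := A) (P := PUnit.{u + 1})
  · exact Subsingleton.elim (α := LinearMap.ker (0 : PUnit.{u+1} →ₗ[A] M)) _ _

end ProjectiveCovers

/-! ### Dimension shifting and `Ext` of finite products -/

section Ext

variable {K : Type u} [Field K] {A : Type u} [Ring A] [Algebra K A]

open Abelian

theorem ext_equiv_of_equiv {X Y : ModuleCat.{u} A} (e : X ≃ₗ[A] Y) (N : ModuleCat.{u} A) (n : ℕ) :
    Nonempty (Ext.{u} X N n ≃ₗ[K] Ext.{u} Y N n) := by
  let i : X ≅ Y := e.toModuleIso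
  refine ⟨LinearEquiv.ofLinearMap ((Ext.mk₀ i.inv).precompOfLinear K N (zero_add n))
    ((Ext.mk₀ i.hom).precompOfLinear K N (zero_add n)) ?_ ?_⟩
  · ext x
    simp
  · ext x
    simp

theorem subsingleton_ext_of_projective (X N : ModuleCat.{u} A) [Module.Projective A X] (n : ℕ) :
    Subsingleton (Ext.{u} X N (n + 1)) := by
  have : Projective X := (IsProjective.iff_projective X).1 inferInstance
  exact ⟨fun x y => (Ext.eq_zero_of_projective x).trans (Ext.eq_zero_of_projective y).symm⟩

theorem subsingleton_ext_of_subsingleton (X N : ModuleCat.{u} A) [Subsingleton X] (n : ℕ) :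
    Subsingleton (Ext.{u} X N (n + 1)) := by
  have : Module.Free A X := Module.Free.of_subsingleton A _
  have : Module.Projective A X := Module.Projective.of_free
  exact subsingleton_ext_of_projective X N n

/-- The connecting map is bijective because `Ext` of the projective middle term vanishes in both
neighbouring degrees. The shift stops at `Ext¹` of the syzygy: on `Hom`, maps that extend to the
projective would be lost. -/
theorem IsFirstSyzygy.ext_equiv {M X : ModuleCat.{u} A} (h : IsFirstSyzygy M X)
    (N : ModuleCat.{u} A) (n : ℕ) :
    Nonempty (Ext.{u} M N (n + 2) ≃ₗ[K] Ext.{u} X N (n + 1)) := by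
  obtain ⟨P, f, ⟨hP, hs, -⟩, ⟨g⟩⟩ := h
  have hS : f.shortComplexKer.ShortExact := LinearMap.shortExact_shortComplexKer hs
  have : Module.Projective A f.shortComplexKer.X₂ := hP
  have h1 := subsingleton_ext_of_projective f.shortComplexKer.X₂ N n
  have h2 := subsingleton_ext_of_projective f.shortComplexKer.X₂ N (n + 1)
  let δ := hS.extClass.precompOfLinear K N (a := n + 1) (b := n + 2) (by omega)
  have hδ : Function.Bijective δ := by
    constructor
    · rw [← LinearMap.ker_eq_bot, LinearMap.ker_eq_bot']
      intro x hx
      obtain ⟨y, rfl⟩ := Ext.contravariant_sequence_exact₁ hS N x (by omega) hx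
      rw [Subsingleton.elim y 0, Ext.comp_zero]
    · intro x
      exact Ext.contravariant_sequence_exact₃ hS N x (Subsingleton.elim _ _) (by omega)
  obtain ⟨e⟩ := ext_equiv_of_equiv (K := K) (Y := f.shortComplexKer.X₁) g N (n + 1)
  exact ⟨(e ≪≫ₗ LinearEquiv.ofBijective δ hδ).symm⟩

/-- `Ext` out of a finite product all of whose factors but two are projective. -/
theorem ext_pi_equiv {k : ℕ} (hk : 1 ≤ k) (L : Fin (k + 1) → ModuleCat.{u} A)
    (hL : ∀ i, i ≠ 0 → i ≠ Fin.last k → Module.Projective A (L i)) (N : ModuleCat.{u} A) (n : ℕ) :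
    Nonempty (Ext.{u} (ModuleCat.of A ((i : Fin (k + 1)) → L i)) N (n + 1) ≃ₗ[K]
      Ext.{u} (L 0) N (n + 1) × Ext.{u} (L (Fin.last k)) N (n + 1)) := by
  have h0 : (0 : Fin (k + 1)) ≠ Fin.last k := by
    intro h; have := congrArg Fin.val h; simp at this; omega
  let X := ModuleCat.of A ((i : Fin (k + 1)) → L i)
  let ι : ∀ i, L i ⟶ X := fun i => ModuleCat.ofHom (LinearMap.single A (fun i => L i) i)
  let π : ∀ i, X ⟶ L i := fun i => ModuleCat.ofHom (LinearMap.proj (φ := fun i => L i) i)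
  have h1 : ∀ i, ι i ≫ π i = 𝟙 (L i) := by
    intro i
    refine ModuleCat.hom_ext (LinearMap.ext fun x => ?_)
    exact Pi.single_eq_same (M := fun i => L i) i x
  have h2 : ∀ i j, i ≠ j → ι i ≫ π j = 0 := by
    intro i j hij
    refine ModuleCat.hom_ext (LinearMap.ext fun x => ?_)
    exact Pi.single_eq_of_ne (M := fun i => L i) hij.symm x
  have h3 : ∑ i, π i ≫ ι i = 𝟙 X := by
    refine ModuleCat.hom_ext (LinearMap.ext fun x => ?_)
    rw [ModuleCat.hom_sum, LinearMap.sum_apply]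
    change ∑ i, Pi.single i (x i) = x
    exact Finset.univ_sum_single x
  let a : ∀ i, Ext.{u} X N (n + 1) →ₗ[K] Ext.{u} (L i) N (n + 1) :=
    fun i => (Ext.mk₀ (ι i)).precompOfLinear K N (zero_add _)
  let b : ∀ i, Ext.{u} (L i) N (n + 1) →ₗ[K] Ext.{u} X N (n + 1) :=
    fun i => (Ext.mk₀ (π i)).precompOfLinear K N (zero_add _)
  have hab : ∀ i x, a i (b i x) = x := by
    intro i x
    simp only [a, b, Ext.precompOfLinear, Ext.bilinearCompOfLinear_apply_apply]
    rw [Ext.mk₀_comp_mk₀_assoc, h1, Ext.mk₀_id_comp]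
  have hab0 : ∀ i j x, i ≠ j → a i (b j x) = 0 := by
    intro i j x hij
    simp only [a, b, Ext.precompOfLinear, Ext.bilinearCompOfLinear_apply_apply]
    rw [Ext.mk₀_comp_mk₀_assoc, h2 i j hij, Ext.mk₀_zero, Ext.zero_comp]
  have hba : ∀ x, ∑ i, b i (a i x) = x := by
    intro x
    simp only [a, b, Ext.precompOfLinear, Ext.bilinearCompOfLinear_apply_apply,
      Ext.mk₀_comp_mk₀_assoc]
    rw [← Ext.sum_comp, ← Ext.mk₀_sum, h3, Ext.mk₀_id_comp]
  refine ⟨LinearEquiv.ofLinearMap ((a 0).prod (a (Fin.last k))) ((b 0).coprod (b (Fin.last k))) ?_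
      ?_⟩
  · refine LinearMap.ext fun x => Prod.ext ?_ ?_
    · simp [hab, hab0 _ _ _ h0]
    · simp [hab, hab0 _ _ _ h0.symm]
  · refine LinearMap.ext fun x => ?_
    conv_rhs => rw [LinearMap.id_apply, ← hba x]
    rw [← Finset.sum_subset (Finset.subset_univ {0, Fin.last k}), Finset.sum_pair h0]
    · rfl
    · intro i _ hi
      simp only [Finset.mem_insert, Finset.mem_singleton, not_or] at hi
      have := hL i hi.1 hi.2
      have := subsingleton_ext_of_projective (L i) N n
      rw [Subsingleton.elim (a i x) 0, map_zero]

end Ext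

/-! ### Uniserial summands of products of hollow modules -/

section Uniserial

variable {A : Type u} [Ring A]

/-- The sum of two proper submodules is proper. -/
def IsHollow (M : Type*) [AddCommGroup M] [Module A M] : Prop :=
  ∀ U V : Submodule A M, U ⊔ V = ⊤ → U = ⊤ ∨ V = ⊤

/-- A uniserial direct summand of a finite product of hollow Noetherian modules is zero or
isomorphic to a factor. -/
theorem subsingleton_or_equiv_of_uniserial_summand {ι : Type*} [Finite ι] {U : ι → Type*}
    [∀ i, AddCommGroup (U i)] [∀ i, Module A (U i)] (hU : ∀ i, IsHollow (A := A) (U i))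
    [∀ i, IsNoetherian A (U i)] {X : ModuleCat.{u} A} (hX : IsUniserialOrZero X)
    (s : X →ₗ[A] (∀ i, U i)) (r : (∀ i, U i) →ₗ[A] X) (hrs : r ∘ₗ s = LinearMap.id) :
    Subsingleton X ∨ ∃ i, Nonempty (X ≃ₗ[A] U i) := by
  classical
  have := Fintype.ofFinite ι
  rcases subsingleton_or_nontrivial X with h | h
  · exact Or.inl h
  right
  let α : ∀ i, X →ₗ[A] U i := fun i => LinearMap.proj i ∘ₗ s
  let β : ∀ i, U i →ₗ[A] X := fun i => r ∘ₗ LinearMap.single A U i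
  have hrs' : ∀ x, r (s x) = x := fun x => LinearMap.congr_fun hrs x
  have hsum : ∀ x, ∑ i, β i (α i x) = x := by
    intro x
    conv_rhs => rw [← hrs' x, ← Finset.univ_sum_single (s x), map_sum]
    rfl
  have hN : IsNoetherian A X :=
    isNoetherian_of_injective s (fun x y h => by rw [← hrs' x, h, hrs' y])
  -- The identity of `X` is the sum of the maps through the factors. In a nonzero uniserial module
  -- finitely many proper submodules lie in one proper submodule, so one of these maps is onto;
  -- Noetherianity makes it injective as well.
  obtain ⟨i, hi⟩ : ∃ i, Function.Surjective (β i ∘ₗ α i) := by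
    by_contra hn
    push Not at hn
    have key : ∀ t : Finset ι, ∃ W : Submodule A X, W ≠ ⊤ ∧
        ∀ i ∈ t, LinearMap.range (β i ∘ₗ α i) ≤ W := by
      intro t
      induction t using Finset.induction_on with
      | empty => exact ⟨⊥, bot_ne_top, by simp⟩
      | insert i t _ ih =>
        obtain ⟨W, hW, h⟩ := ih
        rcases hX W (LinearMap.range (β i ∘ₗ α i)) with h' | h'
        · refine ⟨_, fun ht => hn i (LinearMap.range_eq_top.1 ht), ?_⟩
          intro j hj
          rcases Finset.mem_insert.1 hj with rfl | hj
          · exact le_rfl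
          · exact (h j hj).trans h'
        · refine ⟨W, hW, ?_⟩
          intro j hj
          rcases Finset.mem_insert.1 hj with rfl | hj
          · exact h'
          · exact h j hj
    obtain ⟨W, hW, h⟩ := key Finset.univ
    refine hW (eq_top_iff.2 fun x _ => ?_)
    rw [← hsum x]
    exact sum_mem fun i _ => h i (Finset.mem_univ i) ⟨x, rfl⟩
  have hinj : Function.Injective (β i ∘ₗ α i) :=
    IsNoetherian.injective_of_surjective_endomorphism _ hi
  refine ⟨i, ⟨LinearEquiv.ofBijective (α i) ⟨fun x y hxy => hinj ?_, ?_⟩⟩⟩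
  · rw [LinearMap.comp_apply, hxy, ← LinearMap.comp_apply]
  · rw [← LinearMap.range_eq_top]
    -- As the composite is onto, the factor is the image of `α i` plus the kernel of `β i`.
    -- Hollowness makes one of them everything, and `β i` is not zero.
    have hsup : LinearMap.range (α i) ⊔ LinearMap.ker (β i) = ⊤ := by
      refine eq_top_iff.2 fun z _ => ?_
      obtain ⟨x, hx⟩ := hi (β i z)
      rw [← add_sub_cancel (α i x) z]
      refine add_mem (Submodule.mem_sup_left ⟨x, rfl⟩) (Submodule.mem_sup_right ?_)
      rw [LinearMap.mem_ker, map_sub, ← hx]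
      exact sub_self _
    rcases hU i _ _ hsup with h' | h'
    · exact h'
    · obtain ⟨x, hx⟩ := exists_ne (0 : X)
      obtain ⟨y, rfl⟩ := hi x
      rw [LinearMap.ker_eq_top] at h'
      simp [h'] at hx

end Uniserial

/-! ### Right ideals of vertices and arrows, Nakayama's lemma, syzygies of `aΛ` -/

section RightModules

variable {K : Type u} [Field K] {Q : FinQuiver.{u}} {I : TwoSidedIdeal (PathAlgebra K Q)}

/-- The homomorphism `u ↦ p u` from the regular right module that an element `p` gives. -/
noncomputable def orbitMap {P : Type*} [AddCommGroup P] [Module (BoundAlgebra I)ᵐᵒᵖ P] (p : P) :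
    BoundAlgebra I →ₗ[(BoundAlgebra I)ᵐᵒᵖ] P where
  toFun u := MulOpposite.op u • p
  map_add' u w := by rw [MulOpposite.op_add, add_smul]
  map_smul' r u := by
    rw [RingHom.id_apply, smul_smul]
    rfl

theorem orbitMap_apply {P : Type*} [AddCommGroup P] [Module (BoundAlgebra I)ᵐᵒᵖ P] (p : P)
    (u : BoundAlgebra I) : orbitMap p u = MulOpposite.op u • p := rfl

variable (I) in
/-- The right ideal `aΛ` of an arrow `a`. -/
noncomputable def arIdeal (a : Q.E) : Submodule (BoundAlgebra I)ᵐᵒᵖ (BoundAlgebra I) :=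
  Submodule.span _ {ar I a}

theorem mem_arIdeal {a : Q.E} {u : BoundAlgebra I} : u ∈ arIdeal I a ↔ ∃ w, ar I a * w = u := by
  rw [arIdeal, Submodule.mem_span_singleton]
  exact ⟨fun ⟨r, h⟩ => ⟨r.unop, h⟩, fun ⟨r, h⟩ => ⟨MulOpposite.op r, h⟩⟩

theorem ar_mul_mem_arIdeal (a : Q.E) (w : BoundAlgebra I) : ar I a * w ∈ arIdeal I a :=
  mem_arIdeal.2 ⟨w, rfl⟩

variable (I) in
/-- The right ideal `e_vΛ` of a vertex `v`. -/
noncomputable def evIdeal (v : Q.V) : Submodule (BoundAlgebra I)ᵐᵒᵖ (BoundAlgebra I) where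
  carrier := {u | ev I v * u = u}
  add_mem' {u w} hu hw := by
    change ev I v * (u + w) = u + w
    rw [mul_add, hu, hw]
  zero_mem' := mul_zero _
  smul_mem' r u hu := by
    change ev I v * (u * r.unop) = u * r.unop
    rw [← mul_assoc, hu]

theorem mem_evIdeal {v : Q.V} {u : BoundAlgebra I} : u ∈ evIdeal I v ↔ ev I v * u = u := Iff.rfl

theorem ev_mul_mem_evIdeal (v : Q.V) (u : BoundAlgebra I) : ev I v * u ∈ evIdeal I v := by
  rw [mem_evIdeal, ← mul_assoc, ev_mul_self]

theorem ev_mem_evIdeal (v : Q.V) : ev I v ∈ evIdeal I v := ev_mul_self v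

theorem ar_mem_evIdeal {v : Q.V} {a : Q.E} (h : Q.s a = v) : ar I a ∈ evIdeal I v := by
  rw [mem_evIdeal, ← h, ev_source_mul_ar]

theorem ar_mul_mem_evIdeal {v : Q.V} {a : Q.E} (h : Q.s a = v) (w : BoundAlgebra I) :
    ar I a * w ∈ evIdeal I v := by
  rw [mem_evIdeal, ← mul_assoc, mem_evIdeal.1 (ar_mem_evIdeal h)]

instance projective_evIdeal (v : Q.V) : Module.Projective (BoundAlgebra I)ᵐᵒᵖ (evIdeal I v) := by
  refine Module.Projective.of_split (M := (BoundAlgebra I)ᵐᵒᵖ)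
    { toFun := fun u => MulOpposite.op u.1
      map_add' := fun u w => rfl
      map_smul' := fun r u => rfl }
    { toFun := fun r => ⟨ev I v * r.unop, ev_mul_mem_evIdeal v _⟩
      map_add' := fun u w => Subtype.ext (mul_add _ _ _)
      map_smul' := fun r u => Subtype.ext (mul_assoc _ _ _).symm } ?_
  exact LinearMap.ext fun u => Subtype.ext u.2

/-- After cutting by `e_v` on the right, `u` is a nonzero multiple of `e_v` up to augmentation zero.
Replacing `e_v` by `1` in that multiple gives a unit, and multiplying its inverse by `e_v` gives the
required factor. -/
theorem IsGentle.exists_mul_eq_ev (hI : IsGentle I) {v : Q.V} {u : BoundAlgebra I}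
    (hu : ev I v * u = u) (hc : aug hI.quadratic u v ≠ 0) : ∃ y, u * y = ev I v := by
  have hv : aug hI.quadratic (u * ev I v) = aug hI.quadratic u v • aug hI.quadratic (ev I v) := by
    classical
    ext j
    rw [aug_mul_apply, aug_ev, Pi.smul_apply, smul_eq_mul]
    by_cases hj : j = v
    · subst hj; rfl
    · simp [hj]
  obtain ⟨y, hy⟩ := hI.exists_mul_eq_one hc
    (ρ := u * ev I v - aug hI.quadratic u v • ev I v)
    (by rw [map_sub, map_smul, hv, sub_self])
  refine ⟨ev I v * y, ?_⟩
  have h2 : ev I v * ((algebraMap K _ (aug hI.quadratic u v) +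
      (u * ev I v - aug hI.quadratic u v • ev I v)) * y) = u * (ev I v * y) := by
    rw [← mul_assoc, ← mul_assoc]
    congr 1
    rw [mul_add, mul_sub, mul_smul_comm, ev_mul_self, ← mul_assoc, hu,
      ← Algebra.commutes, ← Algebra.smul_def]
    abel
  rw [← h2, hy, mul_one]

/-- A submodule containing an element with nonzero coefficient at `e_v` is everything. If `e_v` is a
sum of two elements, their coefficients add up to `1`, so one of them is nonzero. -/
theorem IsGentle.isHollow_evIdeal (hI : IsGentle I) (v : Q.V) :
    IsHollow (A := (BoundAlgebra I)ᵐᵒᵖ) (evIdeal I v) := by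
  have key : ∀ (U : Submodule (BoundAlgebra I)ᵐᵒᵖ (evIdeal I v)) (u : evIdeal I v), u ∈ U →
      aug hI.quadratic u.1 v ≠ 0 → U = ⊤ := by
    intro U u hu hc
    obtain ⟨y, hy⟩ := hI.exists_mul_eq_ev u.2 hc
    refine eq_top_iff.2 fun w _ => ?_
    have h3 : w = MulOpposite.op (y * w.1) • u := by
      apply Subtype.ext
      change w.1 = u.1 * (y * w.1)
      rw [← mul_assoc, hy, mem_evIdeal.1 w.2]
    rw [h3]
    exact U.smul_mem _ hu
  intro U W h
  obtain ⟨x, hx, y, hy, hxy⟩ := Submodule.mem_sup.1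
    (show (⟨ev I v, ev_mem_evIdeal v⟩ : evIdeal I v) ∈ U ⊔ W by rw [h]; trivial)
  have hxy' : aug hI.quadratic x.1 v + aug hI.quadratic y.1 v = 1 := by
    have h1 : x.1 + y.1 = ev I v := congrArg Subtype.val hxy
    rw [← Pi.add_apply, ← map_add, h1, aug_ev_self]
  by_cases h0 : aug hI.quadratic x.1 v = 0
  · right
    refine key W y hy ?_
    rw [h0, zero_add] at hxy'
    rw [hxy']
    exact one_ne_zero
  · exact Or.inl (key U x hx h0)

theorem mem_of_eq_zero {A M : Type*} [Ring A] [AddCommGroup M] [Module A M] {N : Submodule A M}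
    {x : M} (h : x = 0) : x ∈ N := h ▸ N.zero_mem

theorem IsHollow.of_surjective {A : Type*} [Ring A] {M N : Type*} [AddCommGroup M] [Module A M]
    [AddCommGroup N] [Module A N] (h : IsHollow (A := A) M) (f : M →ₗ[A] N)
    (hf : Function.Surjective f) : IsHollow (A := A) N := by
  intro U V hUV
  have key : ∀ W : Submodule A N, W.comap f = ⊤ → W = ⊤ := by
    intro W hW
    refine eq_top_iff.2 fun x _ => ?_
    obtain ⟨y, rfl⟩ := hf x
    have : y ∈ W.comap f := hW ▸ trivial
    exact this
  refine (h (U.comap f) (V.comap f) (eq_top_iff.2 fun m _ => ?_)).imp (key U) (key V)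
  obtain ⟨x, hx, y, hy, hxy⟩ := Submodule.mem_sup.1
    (show f m ∈ U ⊔ V by rw [hUV]; trivial)
  obtain ⟨x, rfl⟩ := hf x
  rw [← add_sub_cancel x m]
  refine add_mem (Submodule.mem_sup_left hx) (Submodule.mem_sup_right ?_)
  rw [Submodule.mem_comap, map_sub, ← hxy, add_sub_cancel_left]
  exact hy

variable (I) in
/-- Left multiplication by an arrow `a`, from `e_{t(a)}Λ` onto `aΛ`. -/
noncomputable def arCover (a : Q.E) :
    evIdeal I (Q.t a) →ₗ[(BoundAlgebra I)ᵐᵒᵖ] arIdeal I a :=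
  (orbitMap (ar I a) ∘ₗ (evIdeal I (Q.t a)).subtype).codRestrict _
    fun u => ar_mul_mem_arIdeal a u.1

theorem arCover_apply (a : Q.E) (u : evIdeal I (Q.t a)) : (arCover I a u).1 = ar I a * u.1 := rfl

theorem arCover_surjective (a : Q.E) : Function.Surjective (arCover I a) := by
  rintro ⟨x, hx⟩
  obtain ⟨w, rfl⟩ := mem_arIdeal.1 hx
  refine ⟨⟨ev I (Q.t a) * w, ev_mul_mem_evIdeal _ _⟩, Subtype.ext ?_⟩
  rw [arCover_apply, ← mul_assoc, ar_mul_ev_target]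

theorem IsGentle.isHollow_arIdeal (hI : IsGentle I) (a : Q.E) :
    IsHollow (A := (BoundAlgebra I)ᵐᵒᵖ) (arIdeal I a) :=
  (hI.isHollow_evIdeal _).of_surjective _ (arCover_surjective a)

theorem IsGentle.isNoetherian (hI : IsGentle I) :
    IsNoetherian (BoundAlgebra I)ᵐᵒᵖ (BoundAlgebra I) := by
  have := hI.finite
  have : IsScalarTower K (BoundAlgebra I)ᵐᵒᵖ (BoundAlgebra I) :=
    ⟨fun c r u => by
      change u * (c • r.unop) = c • (u * r.unop)
      rw [mul_smul_comm]⟩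
  exact isNoetherian_of_tower K inferInstance

/-- The radical `PJ` of a right module. -/
noncomputable def radSub (hI : GeneratedByQuadraticPaths I) (P : Type*) [AddCommGroup P]
    [Module (BoundAlgebra I)ᵐᵒᵖ P] : Submodule (BoundAlgebra I)ᵐᵒᵖ P :=
  Submodule.span _ {x | ∃ (ρ : BoundAlgebra I) (p : P), aug hI ρ = 0 ∧ MulOpposite.op ρ • p = x}

theorem smul_mem_radSub (hI : GeneratedByQuadraticPaths I) {P : Type*} [AddCommGroup P]
    [Module (BoundAlgebra I)ᵐᵒᵖ P] {ρ : BoundAlgebra I} (h : aug hI ρ = 0) (p : P) :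
    MulOpposite.op ρ • p ∈ radSub hI P :=
  Submodule.subset_span ⟨ρ, p, h, rfl⟩

theorem map_radSub_le (hI : GeneratedByQuadraticPaths I) {P P' : Type*} [AddCommGroup P]
    [Module (BoundAlgebra I)ᵐᵒᵖ P] [AddCommGroup P'] [Module (BoundAlgebra I)ᵐᵒᵖ P']
    (f : P →ₗ[(BoundAlgebra I)ᵐᵒᵖ] P') : (radSub hI P).map f ≤ radSub hI P' := by
  rw [radSub, Submodule.map_span_le]
  rintro _ ⟨ρ, p, h, rfl⟩
  rw [map_smul]
  exact smul_mem_radSub hI h _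

theorem mem_radSub_evIdeal (hI : GeneratedByQuadraticPaths I) {v : Q.V} (u : evIdeal I v)
    (h : aug hI u.1 = 0) : u ∈ radSub hI (evIdeal I v) := by
  have : u = MulOpposite.op u.1 • (⟨ev I v, ev_mem_evIdeal v⟩ : evIdeal I v) :=
    Subtype.ext (mem_evIdeal.1 u.2).symm
  rw [this]
  exact smul_mem_radSub hI h _

/-- Nakayama's lemma. -/
theorem IsGentle.eq_top_of_sup_radSub (hI : IsGentle I) {P : Type*} [AddCommGroup P]
    [Module (BoundAlgebra I)ᵐᵒᵖ P] {U : Submodule (BoundAlgebra I)ᵐᵒᵖ P}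
    (h : U ⊔ radSub hI.quadratic P = ⊤) : U = ⊤ := by
  obtain ⟨m, hm⟩ := hI.exists_augKer_pow_eq_bot
  -- `R k` is `P` times the `k`-th power of the augmentation kernel. That kernel is nilpotent, so no
  -- finiteness of `P` is needed.
  let R : ℕ → Submodule (BoundAlgebra I)ᵐᵒᵖ P := fun k => Submodule.span _
    {x | ∃ ρ ∈ augKer hI.quadratic ^ k, ∃ p : P, MulOpposite.op ρ • p = x}
  have key : ∀ k, (⊤ : Submodule (BoundAlgebra I)ᵐᵒᵖ P) ≤ U ⊔ R k := by
    intro k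
    induction k with
    | zero =>
      refine le_sup_of_le_right fun p _ => Submodule.subset_span ⟨1, ?_, p, one_smul _ p⟩
      rw [pow_zero]
      exact Submodule.one_le.1 le_rfl
    | succ k ih =>
      rw [← h] at ih ⊢
      refine sup_le le_sup_left (Submodule.span_le.2 ?_)
      rintro _ ⟨ρ, p, hρ, rfl⟩
      obtain ⟨x, hx, y, hy, rfl⟩ := Submodule.mem_sup.1
          (ih (h ▸ trivial : p ∈ U ⊔ radSub hI.quadratic P))
      rw [smul_add]
      refine add_mem (Submodule.mem_sup_left (U.smul_mem _ hx)) (Submodule.mem_sup_right ?_)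
      induction hy using Submodule.span_induction generalizing ρ with
      | mem y hy =>
        obtain ⟨ρ', hρ', p, rfl⟩ := hy
        rw [smul_smul]
        refine Submodule.subset_span ⟨ρ' * ρ, ?_, p, rfl⟩
        rw [pow_succ]
        exact Submodule.mul_mem_mul hρ' (mem_augKer.2 hρ)
      | zero => rw [smul_zero]; exact zero_mem _
      | add y z _ _ hy hz => rw [smul_add]; exact add_mem (hy ρ hρ) (hz ρ hρ)
      | smul r y _ hy =>
        rw [smul_smul]
        exact hy (r.unop * ρ) (by rw [map_mul, hρ, mul_zero])
  refine eq_top_iff.2 ((key m).trans (sup_le le_rfl (Submodule.span_le.2 ?_)))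
  rintro _ ⟨ρ, hρ, p, rfl⟩
  rw [hm, Submodule.mem_bot] at hρ
  rw [hρ, MulOpposite.op_zero, zero_smul]
  exact zero_mem _

theorem IsGentle.isProjectiveCover (hI : IsGentle I) {P M : RightMod I}
    [Module.Projective (BoundAlgebra I)ᵐᵒᵖ P] {f : P →ₗ[(BoundAlgebra I)ᵐᵒᵖ] M}
    (hf : Function.Surjective f) (h : LinearMap.ker f ≤ radSub hI.quadratic P) :
    IsProjectiveCover f :=
  ⟨inferInstance, hf, fun _ hU => hI.eq_top_of_sup_radSub
    (eq_top_iff.2 (hU.ge.trans (sup_le_sup le_rfl h)))⟩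

theorem arCover_injective (hI : IsGentle I) {a : Q.E}
    (h : ∀ b, Q.t a = Q.s b → ar I a * ar I b ≠ 0) : Function.Injective (arCover I a) := by
  rw [← LinearMap.ker_eq_bot, LinearMap.ker_eq_bot']
  intro u hu
  obtain ⟨w, hw, he⟩ := hI.exists_expansion_of_ar_mul_eq_zero u.2 (congrArg Subtype.val hu)
  apply Subtype.ext
  rw [he]
  refine Finset.sum_eq_zero fun b _ => ?_
  rw [hw b, mul_zero]
  by_cases hb : Q.s b = Q.t a
  · exact Or.inr (h b hb.symm)
  · exact Or.inl hb

/-- `aΛ` is isomorphic to `e_{t(a)}Λ` if no relation starts with `a`. -/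
theorem IsGentle.evIdeal_equiv_arIdeal (hI : IsGentle I) {a : Q.E}
    (h : ∀ b, Q.t a = Q.s b → ar I a * ar I b ≠ 0) :
    Nonempty (evIdeal I (Q.t a) ≃ₗ[(BoundAlgebra I)ᵐᵒᵖ] arIdeal I a) :=
  ⟨LinearEquiv.ofBijective _ ⟨arCover_injective hI h, arCover_surjective a⟩⟩

theorem IsGentle.projective_arrowModule (hI : IsGentle I) {a : Q.E}
    (h : ∀ b, Q.t a = Q.s b → ar I a * ar I b ≠ 0) :
    Module.Projective (BoundAlgebra I)ᵐᵒᵖ (arrowModule I a) := by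
  obtain ⟨e⟩ := hI.evIdeal_equiv_arIdeal h
  exact Module.Projective.of_equiv (M := evIdeal I (Q.t a)) (N := arrowModule I a) e

theorem IsGentle.ker_arCover_le (hI : IsGentle I) (a : Q.E) :
    LinearMap.ker (arCover I a) ≤ radSub hI.quadratic (evIdeal I (Q.t a)) := by
  intro u hu
  refine mem_radSub_evIdeal _ _ ?_
  obtain ⟨w, -, he⟩ := hI.exists_expansion_of_ar_mul_eq_zero u.2
    (congrArg Subtype.val (LinearMap.mem_ker.1 hu))
  rw [he, map_sum]
  exact Finset.sum_eq_zero fun b _ => aug_ar_mul _ _ _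

theorem IsGentle.isFirstSyzygy_arrowModule_ker (hI : IsGentle I) (a : Q.E) :
    IsFirstSyzygy (arrowModule I a) (ModuleCat.of _ (LinearMap.ker (arCover I a))) := by
  have : Module.Projective (BoundAlgebra I)ᵐᵒᵖ
    (ModuleCat.of (BoundAlgebra I)ᵐᵒᵖ (evIdeal I (Q.t a))) := projective_evIdeal _
  exact ⟨ModuleCat.of _ (evIdeal I (Q.t a)), arCover I a,
    hI.isProjectiveCover (P := ModuleCat.of _ (evIdeal I (Q.t a)))
      (M := arrowModule I a) (arCover_surjective a) (hI.ker_arCover_le a),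
    ⟨LinearEquiv.refl _ _⟩⟩

/-- The kernel of the cover of `aΛ` is the annihilator of `a`, spanned by the right ideals of the
arrows that form a relation with `a`. Gentleness leaves only `b`. -/
theorem IsGentle.isFirstSyzygy_arrowModule (hI : IsGentle I) {a b : Q.E} (h : Q.t a = Q.s b)
    (hab : ar I a * ar I b = 0) : IsFirstSyzygy (arrowModule I a) (arrowModule I b) := by
  have h1 : ∀ u, u ∈ arIdeal I b → u ∈ evIdeal I (Q.t a) := by
    intro u hu
    obtain ⟨w, rfl⟩ := mem_arIdeal.1 hu
    exact ar_mul_mem_evIdeal h.symm w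
  have h2 : (arIdeal I b).comap (evIdeal I (Q.t a)).subtype = LinearMap.ker (arCover I a) := by
    ext u
    rw [Submodule.mem_comap, LinearMap.mem_ker]
    constructor
    · intro hu
      obtain ⟨w, hw⟩ := mem_arIdeal.1 hu
      apply Subtype.ext
      rw [arCover_apply, ← Submodule.subtype_apply, ← hw, ← mul_assoc, hab, zero_mul]
      rfl
    · intro hu
      obtain ⟨w, hw, he⟩ := hI.exists_expansion_of_ar_mul_eq_zero u.2 (congrArg Subtype.val hu)
      rw [Submodule.subtype_apply, he]
      refine sum_mem fun c _ => ?_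
      by_cases hc : w c = 0
      · rw [hc, mul_zero]; exact zero_mem _
      · have hc1 := not_or.1 (mt (hw c) hc)
        simp only [not_not] at hc1
        rw [hI.right_mem a c b hc1.1.symm h (ar_mul_ar_eq_zero_iff.1 hc1.2)
          (ar_mul_ar_eq_zero_iff.1 hab)]
        exact ar_mul_mem_arIdeal _ _
  refine (hI.isFirstSyzygy_arrowModule_ker a).of_equiv_right (X' := arrowModule I b) ?_
  exact (Submodule.comapSubtypeEquivOfLe (p := arIdeal I b) h1).symm ≪≫ₗ LinearEquiv.ofEq _ _ h2

variable (I) in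
/-- `X` is zero or isomorphic to `aΛ` for an arrow `a`. -/
def IsArrowModuleOrZero (X : RightMod I) : Prop :=
  Subsingleton X ∨ ∃ a : Q.E, Nonempty (X ≅ arrowModule I a)

theorem IsArrowModuleOrZero.of_equiv {X Y : RightMod I} (h : IsArrowModuleOrZero I X)
    (e : X ≃ₗ[(BoundAlgebra I)ᵐᵒᵖ] Y) : IsArrowModuleOrZero I Y := by
  rcases h with h | ⟨a, ⟨i⟩⟩
  · exact Or.inl e.symm.injective.subsingleton
  · exact Or.inr ⟨a, ⟨e.toModuleIso.symm ≪≫ i⟩⟩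

/-- Either no relation begins with `a`, and the cover of `aΛ` is an isomorphism, or the unique
relation `ab` makes the syzygy `bΛ`. So the family is closed under syzygies. -/
theorem IsArrowModuleOrZero.exists_syzygy (hI : IsGentle I) {X : RightMod I}
    (h : IsArrowModuleOrZero I X) : ∃ Y, IsFirstSyzygy X Y ∧ IsArrowModuleOrZero I Y := by
  rcases h with h | ⟨a, ⟨i⟩⟩
  · exact ⟨X, isFirstSyzygy_of_subsingleton X X, Or.inl h⟩
  · by_cases h : ∀ b, Q.t a = Q.s b → ar I a * ar I b ≠ 0
    · refine ⟨_, (hI.isFirstSyzygy_arrowModule_ker a).of_equiv i.symm.toLinearEquiv, Or.inl ?_⟩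
      rw [LinearMap.ker_eq_bot.2 (arCover_injective hI h)]
      exact inferInstanceAs (Subsingleton (⊥ : Submodule (BoundAlgebra I)ᵐᵒᵖ (evIdeal I (Q.t a))))
    · push Not at h
      obtain ⟨b, hb, hab⟩ := h
      exact ⟨_, (hI.isFirstSyzygy_arrowModule hb hab).of_equiv i.symm.toLinearEquiv,
        Or.inr ⟨b, ⟨Iso.refl _⟩⟩⟩

theorem IsArrowModuleOrZero.of_isFirstSyzygy (hI : IsGentle I) {X Y : RightMod I}
    (h : IsArrowModuleOrZero I X) (hY : IsFirstSyzygy X Y) : IsArrowModuleOrZero I Y := by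
  obtain ⟨Z, hZ, hZ'⟩ := h.exists_syzygy hI
  obtain ⟨e⟩ := hZ.nonempty_equiv hY (LinearEquiv.refl _ _)
  exact hZ'.of_equiv e

theorem IsArrowModuleOrZero.of_isSyzygy (hI : IsGentle I) {X : RightMod I}
    (h : IsArrowModuleOrZero I X) (n : ℕ) :
    ∀ Y : RightMod I, IsSyzygy n X Y → IsArrowModuleOrZero I Y := by
  induction n with
  | zero => rintro Y ⟨e⟩; exact h.of_equiv e.symm
  | succ n ih =>
    rintro Y ⟨Z, hZ, hY⟩
    exact (ih Z hZ).of_isFirstSyzygy hI hY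

theorem IsArrowModuleOrZero.exists_isSyzygy (hI : IsGentle I) {X : RightMod I}
    (h : IsArrowModuleOrZero I X) (n : ℕ) : ∃ Y : RightMod I, IsSyzygy n X Y := by
  induction n with
  | zero => exact ⟨X, ⟨LinearEquiv.refl _ _⟩⟩
  | succ n ih =>
    obtain ⟨Y, hY⟩ := ih
    obtain ⟨Z, hZ, -⟩ := (h.of_isSyzygy hI n Y hY).exists_syzygy hI
    exact ⟨Z, Y, hY, hZ⟩

theorem IsSyzygy.ext_equiv {A : Type u} [Ring A] [Algebra K A] (N : ModuleCat.{u} A) (n : ℕ) :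
    ∀ (j : ℕ) {X Y : ModuleCat.{u} A}, IsSyzygy n X Y →
    Nonempty (Abelian.Ext.{u} X N (n + j + 1) ≃ₗ[K] Abelian.Ext.{u} Y N (j + 1)) := by
  induction n with
  | zero =>
    rintro j X Y ⟨e⟩
    rw [zero_add]
    exact ext_equiv_of_equiv e.symm N (j + 1)
  | succ n ih =>
    rintro j X Y ⟨Z, hZ, hY⟩
    obtain ⟨e⟩ := ih (j + 1) hZ
    obtain ⟨e'⟩ := hY.ext_equiv (K := K) N j
    rw [show n + 1 + j + 1 = n + (j + 1) + 1 by omega]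
    exact ⟨e ≪≫ₗ e'⟩

/-- Let two submodules lie in the right ideal of a path. If one contains the path times an element
with nonzero coefficient at the trivial path, it is the whole ideal. If neither does, both lie in
the ideal of the path prolonged by its unique nonzero continuation, or are zero if there is none. -/
theorem IsGentle.isUniserialOrZero_arrowModule (hI : IsGentle I) (a : Q.E) :
    IsUniserialOrZero (arrowModule I a) := by
  obtain ⟨m, hm⟩ := hI.admissible.exists_prod_eq_zero
  -- The path is `l` followed by `a`; the induction ends when `l` has length `m` and its product
  -- vanishes.
  have key : ∀ j k : ℕ, j + k = m → ∀ (l : List Q.E), l.length = k → ∀ (a : Q.E)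
      (U W : Submodule (BoundAlgebra I)ᵐᵒᵖ (BoundAlgebra I)),
      (∀ u ∈ U, ∃ w, (l.map (ar I)).prod * ar I a * w = u) →
      (∀ u ∈ W, ∃ w, (l.map (ar I)).prod * ar I a * w = u) → U ≤ W ∨ W ≤ U := by
    intro j
    induction j with
    | zero =>
      intro k hk l hl a U W hU _
      refine Or.inl fun u hu => ?_
      obtain ⟨w, rfl⟩ := hU u hu
      rw [hm l (by omega), zero_mul, zero_mul]
      exact zero_mem _
    | succ j ih =>
      intro k hk l hl a U W hU hW
      have hev : ∀ w, (l.map (ar I)).prod * ar I a * w =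
          (l.map (ar I)).prod * ar I a * (ev I (Q.t a) * w) := by
        intro w
        rw [mul_assoc _ _ (ev I _ * w), ← mul_assoc (ar I a) (ev I _), ar_mul_ev_target, mul_assoc]
      have big : ∀ (U W : Submodule (BoundAlgebra I)ᵐᵒᵖ (BoundAlgebra I)),
          (∀ u ∈ W, ∃ w, (l.map (ar I)).prod * ar I a * w = u) →
          ∀ w, (l.map (ar I)).prod * ar I a * w ∈ U →
          aug hI.quadratic (ev I (Q.t a) * w) (Q.t a) ≠ 0 → W ≤ U := by
        intro U W hW w hw hc u hu
        obtain ⟨z, rfl⟩ := hW u hu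
        obtain ⟨y, hy⟩ := hI.exists_mul_eq_ev (ev_mul_mem_evIdeal (Q.t a) w) hc
        have : (l.map (ar I)).prod * ar I a * z =
            MulOpposite.op (y * z) • ((l.map (ar I)).prod * ar I a * w) := by
          change _ = (l.map (ar I)).prod * ar I a * w * (y * z)
          rw [hev w, ← mul_assoc, mul_assoc _ _ y, hy, hev z, mul_assoc _ _ z]
        rw [this]
        exact U.smul_mem _ hw
      by_cases h1 : ∃ w, (l.map (ar I)).prod * ar I a * w ∈ U ∧
          aug hI.quadratic (ev I (Q.t a) * w) (Q.t a) ≠ 0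
      · obtain ⟨w, hw, hc⟩ := h1
        exact Or.inr (big U W hW w hw hc)
      by_cases h2 : ∃ w, (l.map (ar I)).prod * ar I a * w ∈ W ∧
          aug hI.quadratic (ev I (Q.t a) * w) (Q.t a) ≠ 0
      · obtain ⟨w, hw, hc⟩ := h2
        exact Or.inl (big W U hU w hw hc)
      push Not at h1 h2
      by_cases hn : ∃ b, ar I a * ar I b ≠ 0
      · obtain ⟨b, hb⟩ := hn
        have small : ∀ U : Submodule (BoundAlgebra I)ᵐᵒᵖ (BoundAlgebra I),
            (∀ u ∈ U, ∃ w, (l.map (ar I)).prod * ar I a * w = u) →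
            (∀ w, (l.map (ar I)).prod * ar I a * w ∈ U →
              aug hI.quadratic (ev I (Q.t a) * w) (Q.t a) = 0) →
            ∀ u ∈ U, ∃ w, ((l ++ [a]).map (ar I)).prod * ar I b * w = u := by
          intro U hU h u hu
          obtain ⟨w, rfl⟩ := hU u hu
          obtain ⟨w', -, he⟩ := exists_expansion_of_ev_mul hI.quadratic
            (ev_mul_mem_evIdeal (Q.t a) w)
          refine ⟨w' b, ?_⟩
          rw [h w hu, zero_smul, zero_add] at he
          rw [hev, he, Finset.mul_sum, Finset.sum_eq_single b]
          · simp [mul_assoc]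
          · intro b' _ hb'
            by_cases h0 : ar I a * ar I b' = 0
            · rw [mul_assoc, ← mul_assoc (ar I a), h0, zero_mul, mul_zero]
            · exact absurd (hI.next_unique h0 hb) hb'
          · simp
        exact ih (k + 1) (by omega) (l ++ [a]) (by simp [hl]) b U W (small U hU h1) (small W hW h2)
      · push Not at hn
        refine Or.inl fun u hu => ?_
        obtain ⟨w, rfl⟩ := hU u hu
        obtain ⟨w', -, he⟩ := exists_expansion_of_ev_mul hI.quadratic
          (ev_mul_mem_evIdeal (Q.t a) w)
        rw [h1 w hu, zero_smul, zero_add] at he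
        rw [hev, he, Finset.mul_sum]
        refine sum_mem fun b _ => mem_of_eq_zero ?_
        rw [mul_assoc, ← mul_assoc (ar I a), hn b, zero_mul, mul_zero]
  intro U W
  have hle : ∀ U : Submodule (BoundAlgebra I)ᵐᵒᵖ (arIdeal I a),
      ∀ u ∈ U.map (arIdeal I a).subtype, ∃ w, (([] : List Q.E).map (ar I)).prod * ar I a * w =
          u := by
    rintro U _ ⟨u, -, rfl⟩
    obtain ⟨w, hw⟩ := mem_arIdeal.1 u.2
    exact ⟨w, by simpa using hw⟩
  have h := key m 0 rfl [] rfl a (Submodule.map (arIdeal I a).subtype U)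
    (Submodule.map (arIdeal I a).subtype W) (hle U) (hle W)
  exact h.imp (Submodule.map_le_map_iff_of_injective (arIdeal I a).injective_subtype _ _).1
    (Submodule.map_le_map_iff_of_injective (arIdeal I a).injective_subtype _ _).1

/-- The projective at the end point of two different arrows is the right ideal of an arrow if it is
uniserial. -/
theorem IsGentle.isArrowModuleOrZero_of_uniserial (hI : IsGentle I) {a b : Q.E} (hab : a ≠ b)
    (ht : Q.t a = Q.t b)
    (h : IsUniserialOrZero (ModuleCat.of (BoundAlgebra I)ᵐᵒᵖ (evIdeal I (Q.t a)))) :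
    IsArrowModuleOrZero I (ModuleCat.of (BoundAlgebra I)ᵐᵒᵖ (evIdeal I (Q.t a))) := by
  have key : ∀ c : Q.E, Q.t c = Q.t a → (∀ d, Q.t c = Q.s d → ar I c * ar I d ≠ 0) →
      IsArrowModuleOrZero I (ModuleCat.of (BoundAlgebra I)ᵐᵒᵖ (evIdeal I (Q.t a))) := by
    intro c hc hd
    obtain ⟨e⟩ := hI.evIdeal_equiv_arIdeal hd
    rw [← hc]
    exact Or.inr ⟨c, ⟨LinearEquiv.toModuleIso e⟩⟩
  have hle : ∀ d d' : Q.E, Q.s d = Q.t a →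
      (arIdeal I d).comap (evIdeal I (Q.t a)).subtype ≤
        (arIdeal I d').comap (evIdeal I (Q.t a)).subtype → d = d' := by
    intro d d' hd hdd
    by_contra hn
    obtain ⟨w, hw⟩ := mem_arIdeal.1 (hdd (x := ⟨ar I d, ar_mem_evIdeal hd⟩)
      (mem_arIdeal.2 ⟨1, mul_one _⟩))
    refine hI.ar_ne_zero d ?_
    have := hI.ar_mul_eq_zero_of_ar_mul_eq hn (w := 1) (w' := w) (by rw [mul_one, hw]; rfl)
    rwa [mul_one] at this
  -- Right ideals of different arrows are incomparable, so uniseriality lets at most one arrow start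
  -- at this vertex.
  have huniq : ∀ d d' : Q.E, Q.s d = Q.t a → Q.s d' = Q.t a → d = d' := by
    intro d d' hd hd'
    rcases h ((arIdeal I d).comap (evIdeal I (Q.t a)).subtype)
      ((arIdeal I d').comap (evIdeal I (Q.t a)).subtype) with h' | h'
    · exact hle d d' hd h'
    · exact (hle d' d hd' h').symm
  -- The only arrow `d` starting here cannot form a relation with both `a` and `b`. So one of the
  -- two begins no relation, and its right ideal is isomorphic to the projective.
  by_cases ha : ∀ d, Q.t a = Q.s d → ar I a * ar I d ≠ 0
  · exact key a rfl ha
  · push Not at ha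
    obtain ⟨d, hd, had⟩ := ha
    refine key b ht.symm fun d' hd' hbd => hab ?_
    rw [huniq d' d (by rw [← hd', ht]) hd.symm] at hbd
    exact hI.left_mem d a b hd (ht ▸ hd) (ar_mul_ar_eq_zero_iff.1 had)
      (ar_mul_ar_eq_zero_iff.1 hbd)

end RightModules

/-! ### Strings by position and the basis of a string module -/

section StringModules

variable {K : Type u} [Field K] {Q : FinQuiver.{u}} {I : TwoSidedIdeal (PathAlgebra K Q)}

/-- The letter at position `i` of a string. -/
def GString.ltr (v : GString I) (i : ℕ) : Option (Q.E × Bool) :=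
  if h : i < v.len then some (v.letter ⟨i, h⟩) else none

/-- The vertex at position `i` of a string. -/
def GString.vtx (v : GString I) (i : ℕ) : Q.V := v.vertex ⟨min i v.len, by omega⟩

theorem GString.ltr_eq_some {v : GString I} {i : ℕ} {x : Q.E × Bool} (h : v.ltr i = some x) :
    ∃ hi : i < v.len, v.letter ⟨i, hi⟩ = x := by
  unfold GString.ltr at h
  split_ifs at h with hi
  exact ⟨hi, Option.some.inj h⟩

theorem GString.lt_of_ltr {v : GString I} {i : ℕ} {x : Q.E × Bool} (h : v.ltr i = some x) :
    i < v.len := (GString.ltr_eq_some h).1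

theorem GString.exists_ltr (v : GString I) {i : ℕ} (h : i < v.len) : ∃ x, v.ltr i = some x :=
  ⟨_, dif_pos h⟩

theorem GString.vtx_source {v : GString I} {i : ℕ} {x : Q.E × Bool} (h : v.ltr i = some x) :
    letterSource x = v.vtx i := by
  obtain ⟨hi, rfl⟩ := GString.ltr_eq_some h
  rw [v.source_letter]
  unfold GString.vtx
  congr 1
  apply Fin.ext
  simp
  omega

theorem GString.vtx_target {v : GString I} {i : ℕ} {x : Q.E × Bool} (h : v.ltr i = some x) :
    letterTarget x = v.vtx (i + 1) := by
  obtain ⟨hi, rfl⟩ := GString.ltr_eq_some h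
  rw [v.target_letter]
  unfold GString.vtx
  congr 1
  apply Fin.ext
  simp
  omega

theorem GString.source_of_direct {v : GString I} {i : ℕ} {a : Q.E} (h : v.ltr i = some (a, true)) :
    Q.s a = v.vtx i := by rw [← GString.vtx_source h]; rfl

theorem GString.target_of_direct {v : GString I} {i : ℕ} {a : Q.E} (h : v.ltr i = some (a, true)) :
    Q.t a = v.vtx (i + 1) := by rw [← GString.vtx_target h]; rfl

theorem GString.target_of_inverse {v : GString I} {i : ℕ} {a : Q.E}
    (h : v.ltr i = some (a, false)) : Q.t a = v.vtx i := by rw [← GString.vtx_source h]; rfl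

theorem GString.source_of_inverse {v : GString I} {i : ℕ} {a : Q.E}
    (h : v.ltr i = some (a, false)) : Q.s a = v.vtx (i + 1) := by
  rw [← GString.vtx_target h]; rfl

theorem GString.ltr_reduced {v : GString I} {i : ℕ} {a b : Q.E} {s : Bool}
    (h : v.ltr i = some (a, s)) (h' : v.ltr (i + 1) = some (b, !s)) : a ≠ b := by
  obtain ⟨hi, h⟩ := GString.ltr_eq_some h
  obtain ⟨hi', h'⟩ := GString.ltr_eq_some h'
  rintro rfl
  exact v.reduced ⟨i, hi⟩ ⟨i + 1, hi'⟩ rfl (by rw [h, h'])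

theorem GString.ltr_direct {v : GString I} {i : ℕ} {a b : Q.E}
    (h : v.ltr i = some (a, true)) (h' : v.ltr (i + 1) = some (b, true)) :
    ar I a * ar I b ≠ 0 := by
  obtain ⟨hi, h⟩ := GString.ltr_eq_some h
  obtain ⟨hi', h'⟩ := GString.ltr_eq_some h'
  have := v.direct ⟨i, hi⟩ ⟨i + 1, hi'⟩ rfl (by rw [h]) (by rw [h'])
  rw [h, h'] at this
  rwa [Ne, ar_mul_ar_eq_zero_iff]

theorem GString.ltr_inverse {v : GString I} {i : ℕ} {a b : Q.E}
    (h : v.ltr i = some (a, false)) (h' : v.ltr (i + 1) = some (b, false)) :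
    ar I b * ar I a ≠ 0 := by
  obtain ⟨hi, h⟩ := GString.ltr_eq_some h
  obtain ⟨hi', h'⟩ := GString.ltr_eq_some h'
  have := v.inverse ⟨i, hi⟩ ⟨i + 1, hi'⟩ rfl (by rw [h]) (by rw [h'])
  rw [h, h'] at this
  rwa [Ne, ar_mul_ar_eq_zero_iff]

open Classical in
/-- The value prescribed for `g i · a` by the string `v`. -/
noncomputable def GString.move (v : GString I) {P : Type*} [AddCommGroup P] (g : ℕ → P) (a : Q.E)
    (i : ℕ) : P :=
  (if v.ltr i = some (a, true) then g (i + 1) else 0) +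
    (if 0 < i ∧ v.ltr (i - 1) = some (a, false) then g (i - 1) else 0)

/-- The standard basis of a string module. -/
noncomputable def GString.basisVec (hI : GeneratedByQuadraticPaths I) (v : GString I) (i : ℕ) :
    v.module hI :=
  (Pi.single (⟨min i v.len, by omega⟩ : Fin (v.len + 1)) (1 : K) : Fin (v.len + 1) → K)

open Classical in
theorem GString.basisVec_ev (hI : GeneratedByQuadraticPaths I) (v : GString I) (i : ℕ) (w : Q.V) :
    MulOpposite.op (ev I w) • v.basisVec hI i = if v.vtx i = w then v.basisVec hI i else 0 := by
  change Matrix.vecMul (Pi.single (⟨min i v.len, by omega⟩ : Fin (v.len + 1)) (1 : K))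
    (v.pathRep (vert K w)) = _
  rw [v.pathRep_vert, Matrix.single_one_vecMul]
  split_ifs with h
  · ext j
    change Matrix.diagonal _ _ j = (Pi.single _ (1 : K) : Fin (v.len + 1) → K) j
    rw [Matrix.diagonal_apply, Pi.single_apply]
    by_cases hj : (⟨min i v.len, by omega⟩ : Fin (v.len + 1)) = j
    · rw [if_pos hj, if_pos hj.symm]
      exact if_pos h
    · rw [if_neg hj, if_neg (Ne.symm hj)]
  · ext j
    change Matrix.diagonal _ _ j = (0 : K)
    rw [Matrix.diagonal_apply]
    by_cases hj : (⟨min i v.len, by omega⟩ : Fin (v.len + 1)) = j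
    · rw [if_pos hj]
      exact if_neg h
    · rw [if_neg hj]

theorem GString.basisVec_ar (hI : GeneratedByQuadraticPaths I) (v : GString I) {i : ℕ}
    (hi : i ≤ v.len) (a : Q.E) :
    MulOpposite.op (ar I a) • v.basisVec hI i = v.move (v.basisVec hI) a i := by
  classical
  -- The index of a basis vector is cut off at the length of the string; for `i ≤ v.len` this
  -- changes nothing.
  have hmin : (⟨min i v.len, by omega⟩ : Fin (v.len + 1)) = ⟨i, by omega⟩ := by
    apply Fin.ext; simp; omega
  have e1 : ∀ j : Fin (v.len + 1), v.Step a ⟨i, by omega⟩ j ↔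
      (v.ltr i = some (a, true) ∧ (j : ℕ) = i + 1) ∨
      (0 < i ∧ v.ltr (i - 1) = some (a, false) ∧ (j : ℕ) = i - 1) := by
    intro j
    constructor
    · rintro ⟨k, ⟨h, h1, h2⟩ | ⟨h, h1, h2⟩⟩
      · have : (k : ℕ) = i := (congrArg Fin.val h1).symm
        refine Or.inl ⟨?_, by rw [h2]; simp [this]⟩
        subst this
        unfold GString.ltr
        rw [dif_pos k.2, ← h]
      · have : i = (k : ℕ) + 1 := congrArg Fin.val h1
        refine Or.inr ⟨by omega, ?_, by rw [h2]; simp [this]⟩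
        subst this
        unfold GString.ltr
        rw [Nat.add_sub_cancel, dif_pos k.2, ← h]
    · rintro (⟨h, h1⟩ | ⟨h0, h, h1⟩)
      · obtain ⟨hi, h⟩ := GString.ltr_eq_some h
        exact ⟨⟨i, hi⟩, Or.inl ⟨h, rfl, Fin.ext h1⟩⟩
      · obtain ⟨hi, h⟩ := GString.ltr_eq_some h
        exact ⟨⟨i - 1, hi⟩, Or.inr ⟨h, Fin.ext (by simp; omega), Fin.ext h1⟩⟩
  -- At most one summand of `move` is nonzero: otherwise the string would contain an inverse letter
  -- followed by the same arrow.
  have hexcl : ¬ (v.ltr i = some (a, true) ∧ (0 < i ∧ v.ltr (i - 1) = some (a, false))) := by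
    rintro ⟨h1, h2, h3⟩
    obtain ⟨j, rfl⟩ : ∃ j, i = j + 1 := ⟨i - 1, by omega⟩
    exact GString.ltr_reduced h3 h1 rfl
  change Matrix.vecMul (Pi.single (⟨min i v.len, by omega⟩ : Fin (v.len + 1)) (1 : K))
    (v.pathRep (arrow K a)) = _
  rw [v.pathRep_arrow, Matrix.single_one_vecMul, hmin]
  unfold GString.move
  by_cases h1 : v.ltr i = some (a, true)
  · have h2 : ¬ (0 < i ∧ v.ltr (i - 1) = some (a, false)) := fun h2 => hexcl ⟨h1, h2⟩
    rw [if_pos h1, if_neg h2, add_zero]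
    have hlt := GString.lt_of_ltr h1
    ext j
    change (if v.Step a ⟨i, by omega⟩ j then (1 : K) else 0) =
        (Pi.single _ (1 : K) : Fin (v.len + 1) → K) j
    rw [Pi.single_apply]
    refine if_congr ?_ rfl rfl
    rw [e1, Fin.ext_iff]
    simp only [h1, true_and]
    constructor
    · rintro (h | ⟨h3, h4, -⟩)
      · omega
      · exact absurd ⟨h3, h4⟩ h2
    · intro h
      change (j : ℕ) = min (i + 1) v.len at h
      exact Or.inl (by omega)
  · by_cases h2 : 0 < i ∧ v.ltr (i - 1) = some (a, false)
    · rw [if_neg h1, if_pos h2, zero_add]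
      ext j
      change (if v.Step a ⟨i, by omega⟩ j then (1 : K) else 0) =
          (Pi.single _ (1 : K) : Fin (v.len + 1) → K) j
      rw [Pi.single_apply]
      refine if_congr ?_ rfl rfl
      rw [e1, Fin.ext_iff]
      simp only [h1, false_and, false_or, h2, true_and]
      omega
    · rw [if_neg h1, if_neg h2, zero_add]
      ext j
      change (if v.Step a ⟨i, by omega⟩ j then (1 : K) else 0) = 0
      rw [if_neg]
      rw [e1]
      rintro (⟨h, -⟩ | ⟨h3, h4, -⟩)
      · exact h1 h
      · exact h2 ⟨h3, h4⟩

theorem GString.sum_basisVec_apply (hI : GeneratedByQuadraticPaths I) (v : GString I) (c : ℕ → K) :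
    ∑ i ∈ Finset.range (v.len + 1),
      MulOpposite.op (algebraMap K (BoundAlgebra I) (c i)) • v.basisVec hI i =
    (fun j : Fin (v.len + 1) => c j : Fin (v.len + 1) → K) := by
  classical
  have h1 : ∀ i : Fin (v.len + 1), MulOpposite.op (algebraMap K (BoundAlgebra I) (c i)) • v.basisVec
      hI i
      = (Pi.single i (c i) : Fin (v.len + 1) → K) := by
    intro i
    have hmin : (⟨min i v.len, by omega⟩ : Fin (v.len + 1)) = i := by
      apply Fin.ext; simp; omega
    change Matrix.vecMul (Pi.single (⟨min i v.len, by omega⟩ : Fin (v.len + 1)) (1 : K))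
      (v.pathRep (algebraMap K _ (c i))) = _
    rw [AlgHom.commutes, Matrix.single_one_vecMul, hmin]
    ext j
    rw [Matrix.row, Matrix.algebraMap_matrix_apply, Pi.single_apply]
    by_cases hj : i = j
    · subst hj; simp
    · simp [hj, Ne.symm hj]
  rw [← Fin.sum_univ_eq_sum_range
    (fun i => MulOpposite.op (algebraMap K (BoundAlgebra I) (c i)) • v.basisVec hI i)]
  exact (Finset.sum_congr rfl fun i _ => h1 i).trans (Finset.univ_sum_single _)

end StringModules

/-! ### Arms: paths descending from a peak -/

section Arms

variable {K : Type u} [Field K] {Q : FinQuiver.{u}} (I : TwoSidedIdeal (PathAlgebra K Q))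

/-- The right ideal of an optional arrow. -/
noncomputable def optIdeal (o : Option Q.E) : Submodule (BoundAlgebra I)ᵐᵒᵖ (BoundAlgebra I) :=
  o.elim ⊥ (arIdeal I)

/-- The arrows `b 0, …, b (k - 1)` form a nonzero path that starts at the vertex `x`, and `o` is the
arrow that continues it, if there is one; if `k = 0`, then `o` is some arrow that starts at `x`. -/
structure IsArm (x : Q.V) (b : ℕ → Option Q.E) (k : ℕ) (o : Option Q.E) : Prop where
  exists_some : ∀ i, i < k → ∃ a, b i = some a
  start : ∀ a, 0 < k → b 0 = some a → Q.s a = x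
  chain : ∀ i a a', i + 1 < k → b i = some a → b (i + 1) = some a' → ar I a * ar I a' ≠ 0
  last : ∀ i a, i + 1 = k → b i = some a → ∀ a', o = some a' ↔ ar I a * ar I a' ≠ 0
  zero : k = 0 → ∀ a, o = some a → Q.s a = x

/-- The initial subpaths of an arm. -/
noncomputable def armPath (x : Q.V) (b : ℕ → Option Q.E) : ℕ → BoundAlgebra I
  | 0 => ev I x
  | i + 1 => armPath x b i * (b i).elim 0 (ar I)

/-- The first arrow of an arm and its continuation. -/
def armHead (b : ℕ → Option Q.E) (k : ℕ) (o : Option Q.E) : Option Q.E := if k = 0 then o else b 0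

variable {I} {x : Q.V} {b : ℕ → Option Q.E} {k : ℕ} {o : Option Q.E}

theorem armPath_succ {i : ℕ} {a : Q.E} (h : b i = some a) :
    armPath I x b (i + 1) = armPath I x b i * ar I a := by
  rw [armPath, h]; rfl

theorem armPath_mem_evIdeal (i : ℕ) : armPath I x b i ∈ evIdeal I x := by
  rw [mem_evIdeal]
  induction i with
  | zero => exact ev_mul_self x
  | succ i ih => rw [armPath, ← mul_assoc, ih]

theorem mem_optIdeal {o : Option Q.E} {u : BoundAlgebra I} :
    u ∈ optIdeal I o ↔ u = 0 ∨ ∃ a w, o = some a ∧ ar I a * w = u := by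
  cases o with
  | none => simp [optIdeal]
  | some a =>
    simp only [optIdeal, Option.elim, mem_arIdeal, Option.some.injEq]
    constructor
    · rintro ⟨w, rfl⟩; exact Or.inr ⟨a, w, rfl, rfl⟩
    · rintro (rfl | ⟨_, w, rfl, rfl⟩)
      · exact ⟨0, mul_zero _⟩
      · exact ⟨w, rfl⟩

theorem ar_mem_optIdeal {a : Q.E} (h : o = some a) : ar I a ∈ optIdeal I o :=
  mem_optIdeal.2 (Or.inr ⟨a, 1, h, mul_one _⟩)

namespace IsArm

/-- Strip the arrows of the path one by one from the left; consecutive arrows have nonzero product,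
so each can be cancelled. -/
theorem ar_mul_eq_zero (h : IsArm I x b k o) (hI : IsGentle I) {i : ℕ} {a : Q.E} (hi : i < k)
    (ha : b i = some a) {u : BoundAlgebra I} (hu : armPath I x b (i + 1) * u = 0) :
    ar I a * u = 0 := by
  induction i generalizing a u with
  | zero =>
    rw [armPath_succ ha] at hu
    rwa [armPath, ← h.start a hi ha, ev_source_mul_ar] at hu
  | succ i ih =>
    obtain ⟨a', ha'⟩ := h.exists_some i (by omega)
    rw [armPath_succ ha, mul_assoc] at hu
    exact hI.ar_mul_eq_zero_of_ar_mul_ar_mul (h.chain i a' a hi ha' ha) (ih (by omega) ha' hu)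

theorem _root_.GentleExt.armPath_mul_ar_eq_zero {i : ℕ} {a a' : Q.E}
    (ha : b i = some a) (h0 : ar I a * ar I a' = 0) : armPath I x b (i + 1) * ar I a' = 0 := by
  rw [armPath_succ ha, mul_assoc, h0, mul_zero]

theorem _root_.GentleExt.armHead_of_pos (hk : 0 < k) {a : Q.E} (ha : b 0 = some a) :
    armHead b k o = some a := by
  rw [armHead, if_neg (by omega), ha]

/-- A path of positive length stays in the right ideal of its first arrow. This is how the two arms
at a peak are kept apart. -/
theorem armPath_succ_mul_mem (h : IsArm I x b k o) {i : ℕ} (hi : i < k) (u : BoundAlgebra I) :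
    armPath I x b (i + 1) * u ∈ optIdeal I (armHead b k o) := by
  induction i generalizing u with
  | zero =>
    obtain ⟨a, ha⟩ := h.exists_some 0 hi
    rw [armPath_succ ha, armPath, ← h.start a hi ha, ev_source_mul_ar]
    exact mem_optIdeal.2 (Or.inr ⟨a, u, armHead_of_pos hi ha, rfl⟩)
  | succ i ih =>
    rw [armPath, mul_assoc]
    exact ih (by omega) _

theorem armPath_mul_mem (h : IsArm I x b k o) {u : BoundAlgebra I} (hu : u ∈ optIdeal I o) :
    armPath I x b k * u ∈ optIdeal I (armHead b k o) := by
  rcases Nat.eq_zero_or_pos k with hk | hk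
  · subst hk
    rw [armHead, if_pos rfl]
    rcases mem_optIdeal.1 hu with rfl | ⟨a, w, ha, rfl⟩
    · rw [mul_zero]; exact zero_mem _
    · rw [armPath, ← h.zero rfl a ha, ← mul_assoc, ev_source_mul_ar]
      exact hu
  · obtain ⟨i, rfl⟩ : ∃ i, k = i + 1 := ⟨k - 1, by omega⟩
    exact h.armPath_succ_mul_mem (by omega) u

/-- The arm followed by its continuation is again a nonzero path, or the arm is trivial; cancelling
the arm embeds the continuation in the projective at the peak. -/
theorem eq_zero_of_armPath_mul (h : IsArm I x b k o) (hI : IsGentle I) {u : BoundAlgebra I}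
    (hu : u ∈ optIdeal I o) (h0 : armPath I x b k * u = 0) : u = 0 := by
  rcases mem_optIdeal.1 hu with rfl | ⟨a, w, ha, rfl⟩
  · rfl
  rcases Nat.eq_zero_or_pos k with hk | hk
  · subst hk
    rwa [armPath, ← h.zero rfl a ha, ← mul_assoc, ev_source_mul_ar] at h0
  · obtain ⟨i, rfl⟩ : ∃ i, k = i + 1 := ⟨k - 1, by omega⟩
    obtain ⟨a', ha'⟩ := h.exists_some i (by omega)
    exact hI.ar_mul_eq_zero_of_ar_mul_ar_mul ((h.last i a' rfl ha' a).1 ha)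
      (h.ar_mul_eq_zero hI (by omega) ha' h0)

/-- The embedding of the continuation of an arm in the projective at its starting point. -/
noncomputable def embed (_ : IsArm I x b k o) :
    optIdeal I o →ₗ[(BoundAlgebra I)ᵐᵒᵖ] evIdeal I x :=
  (orbitMap (armPath I x b k) ∘ₗ (optIdeal I o).subtype).codRestrict _ fun u => by
    change armPath I x b k * u.1 ∈ _
    rw [mem_evIdeal, ← mul_assoc, mem_evIdeal.1 (armPath_mem_evIdeal k)]

theorem embed_apply (h : IsArm I x b k o) (u : optIdeal I o) :
    (h.embed u).1 = armPath I x b k * u.1 := rfl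

theorem embed_injective (h : IsArm I x b k o) (hI : IsGentle I) :
    Function.Injective h.embed := by
  rw [← LinearMap.ker_eq_bot, LinearMap.ker_eq_bot']
  intro u hu
  exact Subtype.ext (h.eq_zero_of_armPath_mul hI u.2 (congrArg Subtype.val hu))

/-- The initial subpaths of an arm, as elements of the projective at its starting point. -/
noncomputable def point (_ : IsArm I x b k o) (i : ℕ) : evIdeal I x :=
  ⟨armPath I x b i, armPath_mem_evIdeal i⟩

open Classical in
-- An arrow applied to a nontrivial initial subpath has three possible effects: it prolongs the path
-- along the arm, it gives zero, or, at the end of the arm, it is the continuation and lands in its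
-- embedded right ideal.
theorem point_ar (h : IsArm I x b k o) (hI : IsGentle I) {i : ℕ} (hi : i < k) (a : Q.E) :
    MulOpposite.op (ar I a) • h.point (i + 1) -
      (if i + 1 < k ∧ b (i + 1) = some a then h.point (i + 2) else 0) ∈ LinearMap.range
          h.embed := by
  obtain ⟨a', ha'⟩ := h.exists_some i hi
  by_cases hk : i + 1 = k
  · rw [if_neg (by omega), sub_zero]
    by_cases h0 : ar I a' * ar I a = 0
    · rw [show MulOpposite.op (ar I a) • h.point (i + 1) = 0 from
        Subtype.ext (armPath_mul_ar_eq_zero ha' h0)]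
      exact zero_mem _
    · refine ⟨⟨ar I a, ar_mem_optIdeal ((h.last i a' hk ha' a).2 h0)⟩, Subtype.ext ?_⟩
      subst hk
      rfl
  · obtain ⟨c, hc⟩ := h.exists_some (i + 1) (by omega)
    have hac := h.chain i a' c (by omega) ha' hc
    refine mem_of_eq_zero ?_
    by_cases hca : c = a
    · subst hca
      rw [if_pos ⟨by omega, hc⟩, sub_eq_zero]
      exact Subtype.ext (armPath_succ hc).symm
    · rw [if_neg (fun hn => hca (Option.some.inj (hc.symm.trans hn.2))), sub_zero]
      refine Subtype.ext (armPath_mul_ar_eq_zero ha' ?_)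
      by_contra hn
      exact hca (hI.next_unique hac hn)

open Classical in
theorem point_zero_ar (h : IsArm I x b k o) {a : Q.E} (ha : armHead b k o = some a) :
    MulOpposite.op (ar I a) • h.point 0 -
      (if 0 < k ∧ b 0 = some a then h.point 1 else 0) ∈ LinearMap.range h.embed := by
  rcases Nat.eq_zero_or_pos k with hk | hk
  · subst hk
    rw [armHead, if_pos rfl] at ha
    rw [if_neg (by omega), sub_zero]
    exact ⟨⟨ar I a, ar_mem_optIdeal ha⟩, Subtype.ext rfl⟩
  · rw [armHead, if_neg (by omega)] at ha
    rw [if_pos ⟨hk, ha⟩]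
    refine mem_of_eq_zero ?_
    rw [sub_eq_zero]
    exact Subtype.ext (armPath_succ ha).symm

theorem point_succ (h : IsArm I x b k o) {i : ℕ} {a : Q.E} (ha : b i = some a) :
    h.point (i + 1) = MulOpposite.op (ar I a) • h.point i :=
  Subtype.ext (armPath_succ ha)

theorem range_embed_le (h : IsArm I x b k o) : LinearMap.range h.embed ≤
    Submodule.span _ {y | ∃ a, o = some a ∧ MulOpposite.op (ar I a) • h.point k = y} := by
  rintro _ ⟨u, rfl⟩
  rcases mem_optIdeal.1 u.2 with h0 | ⟨a, w, ha, hu⟩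
  · rw [show u = 0 from Subtype.ext h0, map_zero]; exact zero_mem _
  · have : h.embed u = MulOpposite.op w • MulOpposite.op (ar I a) • h.point k := by
      apply Subtype.ext
      rw [embed_apply, ← hu, ← mul_assoc]
      rfl
    rw [this]
    exact Submodule.smul_mem _ _ (Submodule.subset_span ⟨a, ha, rfl⟩)

theorem range_embed_le_radSub (h : IsArm I x b k o) (hI : IsGentle I) :
    LinearMap.range h.embed ≤ radSub hI.quadratic (evIdeal I x) := by
  refine h.range_embed_le.trans (Submodule.span_le.2 ?_)
  rintro _ ⟨a, -, rfl⟩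
  exact smul_mem_radSub _ (aug_ar _ _) _

theorem embed_mem (h : IsArm I x b k o) (u : optIdeal I o) :
    (h.embed u).1 ∈ optIdeal I (armHead b k o) := h.armPath_mul_mem u.2

theorem point_smul_mem (h : IsArm I x b k o) (hk : 0 < k) (u : BoundAlgebra I) :
    (MulOpposite.op u • h.point k).1 ∈ optIdeal I (armHead b k o) := by
  obtain ⟨i, rfl⟩ : ∃ i, k = i + 1 := ⟨k - 1, by omega⟩
  exact h.armPath_succ_mul_mem (by omega) u

end IsArm

theorem IsGentle.eq_zero_of_mem_optIdeal (hI : IsGentle I) {o o' : Option Q.E}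
    (h : ∀ a, o = some a → o' ≠ some a) {u : BoundAlgebra I} (hu : u ∈ optIdeal I o)
    (hu' : u ∈ optIdeal I o') : u = 0 := by
  rcases mem_optIdeal.1 hu with rfl | ⟨a, w, rfl, rfl⟩
  · rfl
  rcases mem_optIdeal.1 hu' with h0 | ⟨a', w', rfl, h1⟩
  · exact h0
  · exact hI.ar_mul_eq_zero_of_ar_mul_eq (fun he => h a rfl (by rw [he])) h1.symm

theorem IsGentle.exists_next (hI : IsGentle I) (a : Q.E) :
    ∃ o : Option Q.E, ∀ a', o = some a' ↔ ar I a * ar I a' ≠ 0 := by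
  by_cases h : ∃ a', ar I a * ar I a' ≠ 0
  · obtain ⟨c, hc⟩ := h
    refine ⟨some c, fun a' => ⟨?_, fun h => ?_⟩⟩
    · rintro h; rwa [← Option.some.inj h]
    · rw [hI.next_unique hc h]
  · push Not at h
    exact ⟨none, fun a' => ⟨fun h => by simp at h, fun hn => absurd (h a') hn⟩⟩

/-- The at most two arrows that start at a vertex. -/
theorem IsGentle.exists_two (hI : IsGentle I) (x : Q.V) : ∃ o o' : Option Q.E,
    (∀ a, Q.s a = x ↔ (o = some a ∨ o' = some a)) ∧ ∀ a, o = some a → o' ≠ some a := by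
  have h := hI.start_le x
  set S := {a : Q.E | Q.s a = x} with hS
  have hmem : ∀ a, Q.s a = x ↔ a ∈ S := fun a => Iff.rfl
  have hcases : S.ncard = 0 ∨ S.ncard = 1 ∨ S.ncard = 2 := by omega
  rcases hcases with h | h | h
  · rw [Set.ncard_eq_zero] at h
    refine ⟨none, none, fun a => ?_, by simp⟩
    rw [hmem, h]; simp
  · obtain ⟨c, hc⟩ := Set.ncard_eq_one.1 h
    refine ⟨some c, none, fun a => ?_, by simp⟩
    rw [hmem, hc]; simp [eq_comm]
  · obtain ⟨c, d, hcd, hc⟩ := Set.ncard_eq_two.1 h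
    refine ⟨some c, some d, fun a => ?_, ?_⟩
    · rw [hmem, hc]; simp [eq_comm]
    · rintro a h h'
      exact hcd ((Option.some.inj h).trans (Option.some.inj h').symm)

theorem IsGentle.exists_other (hI : IsGentle I) {x : Q.V} {c : Q.E} (hc : Q.s c = x) :
    ∃ o : Option Q.E, (∀ a, Q.s a = x ↔ (c = a ∨ o = some a)) ∧ o ≠ some c := by
  obtain ⟨o, o', h, h'⟩ := hI.exists_two x
  rcases (h c).1 hc with ho | ho
  · refine ⟨o', fun a => ?_, h' c ho⟩
    rw [h, ho, Option.some.injEq]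
  · refine ⟨o, fun a => ?_, fun hn => h' c hn ho⟩
    rw [h, ho, Option.some.injEq, or_comm]

end Arms

/-! ### Mountains of a string and their projectives -/

section Mountains

variable {K : Type u} [Field K] {Q : FinQuiver.{u}} {I : TwoSidedIdeal (PathAlgebra K Q)}

/-- The arrow of an optional letter, provided that the letter has the direction `s`. -/
def arrowOf (x : Option (Q.E × Bool)) (s : Bool) : Option Q.E :=
  x.bind fun y => if y.2 = s then some y.1 else none

theorem arrowOf_eq_some {x : Option (Q.E × Bool)} {s : Bool} {a : Q.E} :
    arrowOf x s = some a ↔ x = some (a, s) := by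
  cases x with
  | none => simp [arrowOf]
  | some y =>
    obtain ⟨c, r⟩ := y
    simp only [arrowOf, Option.bind_some, Option.some.injEq, Prod.mk.injEq]
    constructor
    · intro h
      split_ifs at h with hr
      exact ⟨Option.some.inj h, hr⟩
    · rintro ⟨rfl, rfl⟩
      simp

/-- The string `v` runs down from the position `c` to both `d ≤ c` and `n ≥ c`, and cannot be
continued downwards inside `v`. -/
structure GString.IsMountain (v : GString I) (d c n : ℕ) : Prop where
  le_left : d ≤ c
  le_right : c ≤ n
  le_len : n ≤ v.len
  inverse : ∀ i, d ≤ i → i < c → ∃ a, v.ltr i = some (a, false)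
  direct : ∀ i, c ≤ i → i < n → ∃ a, v.ltr i = some (a, true)
  left : ∀ a, 0 < d → v.ltr (d - 1) ≠ some (a, false)
  right : ∀ a, v.ltr n ≠ some (a, true)

/-- The arrows to the right of the position `c`. -/
def GString.rightArrows (v : GString I) (c j : ℕ) : Option Q.E := arrowOf (v.ltr (c + j)) true

/-- The arrows to the left of the position `c`. -/
def GString.leftArrows (v : GString I) (c j : ℕ) : Option Q.E := arrowOf (v.ltr (c - 1 - j)) false

theorem IsGentle.exists_isArm (hI : IsGentle I) {x : Q.V} {b : ℕ → Option Q.E} {k : ℕ}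
    (hk : 0 < k) (h1 : ∀ i, i < k → ∃ a, b i = some a)
    (h2 : ∀ a, 0 < k → b 0 = some a → Q.s a = x)
    (h3 : ∀ i a a', i + 1 < k → b i = some a → b (i + 1) = some a' → ar I a * ar I a' ≠ 0) :
    ∃ o, IsArm I x b k o := by
  obtain ⟨c, hc⟩ := h1 (k - 1) (by omega)
  obtain ⟨o, ho⟩ := hI.exists_next c
  refine ⟨o, h1, h2, h3, ?_, by omega⟩
  intro i a hi ha
  obtain rfl : i = k - 1 := by omega
  rw [hc] at ha
  rw [← Option.some.inj ha]
  exact ho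

theorem isArm_zero {x : Q.V} {b : ℕ → Option Q.E} {o : Option Q.E}
    (h : ∀ a, o = some a → Q.s a = x) : IsArm I x b 0 o :=
  ⟨by omega, by omega, by omega, by omega, fun _ => h⟩

namespace GString.IsMountain

variable {v : GString I} {d c n : ℕ}

theorem leftArrows_zero (h : v.IsMountain d c n) (hd : d < c) :
    ∃ a, v.leftArrows c 0 = some a ∧ v.ltr (c - 1) = some (a, false) ∧ Q.s a = v.vtx c := by
  obtain ⟨a, ha⟩ := h.inverse (c - 1) (by omega) (by omega)
  refine ⟨a, arrowOf_eq_some.2 ha, ha, ?_⟩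
  rw [GString.source_of_inverse ha]
  congr 1
  omega

theorem rightArrows_zero (h : v.IsMountain d c n) (hd : c < n) :
    ∃ a, v.rightArrows c 0 = some a ∧ v.ltr c = some (a, true) ∧ Q.s a = v.vtx c := by
  obtain ⟨a, ha⟩ := h.direct c (by omega) (by omega)
  exact ⟨a, arrowOf_eq_some.2 ha, ha, GString.source_of_direct ha⟩

theorem exists_isArm_left (h : v.IsMountain d c n) (hI : IsGentle I) (hd : d < c) :
    ∃ o, IsArm I (v.vtx c) (v.leftArrows c) (c - d) o := by
  refine hI.exists_isArm (by omega) ?_ ?_ ?_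
  · intro i hi
    obtain ⟨a, ha⟩ := h.inverse (c - 1 - i) (by omega) (by omega)
    exact ⟨a, arrowOf_eq_some.2 ha⟩
  · intro a _ ha
    obtain ⟨a', ha', -, hs⟩ := h.leftArrows_zero hd
    rw [ha] at ha'
    rwa [Option.some.inj ha']
  · intro i a a' hi ha ha'
    have h1 := arrowOf_eq_some.1 ha
    have h2 := arrowOf_eq_some.1 ha'
    rw [show c - 1 - i = c - 1 - (i + 1) + 1 by omega] at h1
    exact GString.ltr_inverse h2 h1

theorem exists_isArm_right (h : v.IsMountain d c n) (hI : IsGentle I) (hd : c < n) :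
    ∃ o, IsArm I (v.vtx c) (v.rightArrows c) (n - c) o := by
  refine hI.exists_isArm (by omega) ?_ ?_ ?_
  · intro i hi
    obtain ⟨a, ha⟩ := h.direct (c + i) (by omega) (by omega)
    exact ⟨a, arrowOf_eq_some.2 ha⟩
  · intro a _ ha
    obtain ⟨a', ha', -, hs⟩ := h.rightArrows_zero hd
    rw [ha] at ha'
    rwa [Option.some.inj ha']
  · intro i a a' hi ha ha'
    exact GString.ltr_direct (arrowOf_eq_some.1 ha) (arrowOf_eq_some.1 ha')

/-- The two arms of a mountain start with all arrows that leave its peak. -/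
theorem exists_arms (h : v.IsMountain d c n) (hI : IsGentle I) : ∃ oL oR,
    IsArm I (v.vtx c) (v.leftArrows c) (c - d) oL ∧
    IsArm I (v.vtx c) (v.rightArrows c) (n - c) oR ∧
    (∀ a, Q.s a = v.vtx c → (armHead (v.leftArrows c) (c - d) oL = some a ∨
      armHead (v.rightArrows c) (n - c) oR = some a)) ∧
    ∀ a, armHead (v.leftArrows c) (c - d) oL = some a →
      armHead (v.rightArrows c) (n - c) oR ≠ some a := by
  have hdc := h.le_left
  have hcn := h.le_right
  -- Four cases, according to which arms are trivial. A trivial arm takes as its continuation an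
  -- arrow leaving the peak that the other arm does not use, if there is one. Two nontrivial arms
  -- begin with different arrows since the string is reduced, and these are all that leave the peak.
  rcases Nat.lt_or_ge d c with hd | hd <;> rcases Nat.lt_or_ge c n with hn | hn
  · obtain ⟨oL, hL⟩ := h.exists_isArm_left hI hd
    obtain ⟨oR, hR⟩ := h.exists_isArm_right hI hn
    refine ⟨oL, oR, hL, hR, ?_⟩
    obtain ⟨a, ha, hla, hsa⟩ := h.leftArrows_zero hd
    obtain ⟨a', ha', hla', hsa'⟩ := h.rightArrows_zero hn
    rw [armHead_of_pos (by omega) ha, armHead_of_pos (by omega) ha']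
    rw [show c = c - 1 + 1 by omega] at hla'
    have hne : a ≠ a' := GString.ltr_reduced hla hla'
    obtain ⟨o, ho, hoa⟩ := hI.exists_other hsa
    have hoa' : o = some a' := ((ho a').1 hsa').resolve_left hne
    simp only [Option.some.injEq]
    constructor
    · intro e he
      rw [← Option.some.injEq a', ← hoa']
      exact (ho e).1 he
    · rintro e rfl hn
      exact hne (Option.some.inj hn).symm
  · obtain ⟨oL, hL⟩ := h.exists_isArm_left hI hd
    obtain ⟨a, ha, hla, hsa⟩ := h.leftArrows_zero hd
    obtain ⟨o, ho, hoa⟩ := hI.exists_other hsa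
    obtain rfl : c = n := by omega
    refine ⟨oL, o, hL, ?_, ?_⟩
    · rw [Nat.sub_self]
      exact isArm_zero fun e he => (ho e).2 (Or.inr he)
    · rw [armHead_of_pos (by omega) ha, armHead, if_pos (by omega)]
      simp only [Option.some.injEq]
      refine ⟨fun e he => (ho e).1 he, ?_⟩
      rintro e rfl
      exact hoa
  · obtain ⟨oR, hR⟩ := h.exists_isArm_right hI hn
    obtain ⟨a, ha, hla, hsa⟩ := h.rightArrows_zero hn
    obtain ⟨o, ho, hoa⟩ := hI.exists_other hsa
    obtain rfl : d = c := by omega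
    refine ⟨o, oR, ?_, hR, ?_⟩
    · rw [Nat.sub_self]
      exact isArm_zero fun e he => (ho e).2 (Or.inr he)
    · rw [armHead_of_pos (by omega) ha, armHead, if_pos (by omega)]
      simp only [Option.some.injEq]
      refine ⟨fun e he => ((ho e).1 he).symm, ?_⟩
      rintro e he hae
      exact hoa (he.trans hae.symm)
  · obtain ⟨o, o', ho, hoo⟩ := hI.exists_two (v.vtx c)
    refine ⟨o, o', ?_, ?_, ?_⟩
    · rw [show c - d = 0 by omega]
      exact isArm_zero fun e he => (ho e).2 (Or.inl he)
    · rw [show n - c = 0 by omega]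
      exact isArm_zero fun e he => (ho e).2 (Or.inr he)
    · rw [armHead, if_pos (by omega), armHead, if_pos (by omega)]
      exact ⟨fun e he => (ho e).1 he, hoo⟩

end GString.IsMountain

/-- A mountain of a string together with the arms at its peak. -/
structure GString.Mountain (v : GString I) (d c n : ℕ) (oL oR : Option Q.E) : Prop
    extends v.IsMountain d c n where
  armL : IsArm I (v.vtx c) (v.leftArrows c) (c - d) oL
  armR : IsArm I (v.vtx c) (v.rightArrows c) (n - c) oR
  cover : ∀ a, Q.s a = v.vtx c → (armHead (v.leftArrows c) (c - d) oL = some a ∨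
      armHead (v.rightArrows c) (n - c) oR = some a)
  ne : ∀ a, armHead (v.leftArrows c) (c - d) oL = some a →
      armHead (v.rightArrows c) (n - c) oR ≠ some a

namespace GString.Mountain

variable {v : GString I} {d c n : ℕ} {oL oR : Option Q.E}

/-- The path from the peak of a mountain to the position `i`. -/
noncomputable def pt (h : v.Mountain d c n oL oR) (i : ℕ) : evIdeal I (v.vtx c) :=
  if c ≤ i then h.armR.point (i - c) else h.armL.point (c - i)

theorem pt_of_ge (h : v.Mountain d c n oL oR) {i : ℕ} (hi : c ≤ i) :
    h.pt i = h.armR.point (i - c) := if_pos hi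

theorem pt_of_le (h : v.Mountain d c n oL oR) {i : ℕ} (hi : i ≤ c) :
    h.pt i = h.armL.point (c - i) := by
  unfold pt
  split_ifs with hc
  · obtain rfl : c = i := by omega
    simp only [Nat.sub_self]
    rfl
  · rfl

theorem pt_peak (h : v.Mountain d c n oL oR) : (h.pt c).1 = ev I (v.vtx c) := by
  rw [h.pt_of_ge le_rfl, Nat.sub_self]
  rfl

theorem pt_right (h : v.Mountain d c n oL oR) {i : ℕ} {a : Q.E} (hi : c ≤ i)
    (ha : v.ltr i = some (a, true)) : h.pt (i + 1) = MulOpposite.op (ar I a) • h.pt i := by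
  rw [h.pt_of_ge (by omega), h.pt_of_ge hi, show i + 1 - c = i - c + 1 by omega]
  refine h.armR.point_succ (arrowOf_eq_some.2 ?_)
  rw [show c + (i - c) = i by omega, ha]

theorem pt_left (h : v.Mountain d c n oL oR) {i : ℕ} {a : Q.E} (hi : i < c)
    (ha : v.ltr i = some (a, false)) : h.pt i = MulOpposite.op (ar I a) • h.pt (i + 1) := by
  rw [h.pt_of_le (by omega), h.pt_of_le (by omega), show c - i = c - (i + 1) + 1 by omega]
  refine h.armL.point_succ (arrowOf_eq_some.2 ?_)
  rw [show c - 1 - (c - (i + 1)) = i by omega, ha]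

open Classical in
theorem pt_ev (h : v.Mountain d c n oL oR) {i : ℕ} (hd : d ≤ i) (hn : i ≤ n) (w : Q.V) :
    MulOpposite.op (ev I w) • h.pt i = if v.vtx i = w then h.pt i else 0 := by
  rcases Nat.lt_trichotomy i c with hi | rfl | hi
  · obtain ⟨a, ha⟩ := h.inverse i hd hi
    rw [h.pt_left hi ha, ← mul_smul, ← MulOpposite.op_mul, ← GString.target_of_inverse ha]
    split_ifs with hw
    · rw [← hw, ar_mul_ev_target]
    · rw [ar_mul_ev_of_ne hw, MulOpposite.op_zero, zero_smul]
  · apply Subtype.ext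
    change (h.pt i).1 * ev I w = _
    split_ifs with hw
    · rw [h.pt_peak, hw, ev_mul_self]
    · rw [h.pt_peak, ev_mul_ev_of_ne hw]
      rfl
  · obtain ⟨j, rfl⟩ : ∃ j, i = j + 1 := ⟨i - 1, by omega⟩
    obtain ⟨a, ha⟩ := h.direct j (by omega) (by omega)
    rw [h.pt_right (by omega) ha, ← mul_smul, ← MulOpposite.op_mul, ← GString.target_of_direct ha]
    split_ifs with hw
    · rw [← hw, ar_mul_ev_target]
    · rw [ar_mul_ev_of_ne hw, MulOpposite.op_zero, zero_smul]

/-- Off the peak, an arrow moves along one arm as the string prescribes, up to the continuation of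
that arm. At the peak every arrow that starts there begins exactly one of the two arms, by `cover`
and `ne`. -/
theorem pt_ar (h : v.Mountain d c n oL oR) (hI : IsGentle I) {i : ℕ} (hd : d ≤ i) (hn : i ≤ n)
    (a : Q.E) : MulOpposite.op (ar I a) • h.pt i - v.move h.pt a i ∈
      LinearMap.range h.armL.embed ⊔ LinearMap.range h.armR.embed := by
  classical
  unfold GString.move
  rcases Nat.lt_trichotomy i c with hi | rfl | hi
  · refine Submodule.mem_sup_left ?_
    obtain ⟨e, he⟩ := h.inverse i hd hi
    have h1 := h.armL.point_ar hI (i := c - i - 1) (by omega) a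
    rw [if_neg (by rw [he]; simp), zero_add, h.pt_of_le hi.le]
    rw [show c - i - 1 + 1 = c - i by omega] at h1
    convert h1 using 2
    -- The string may go on to the left of `d`, but by `left` not downwards; hence a step prescribed
    -- by the string stays within the arm.
    have hiff : (0 < i ∧ v.ltr (i - 1) = some (a, false)) ↔
        (c - i < c - d ∧ v.leftArrows c (c - i) = some a) := by
      unfold GString.leftArrows
      rw [arrowOf_eq_some]
      constructor
      · rintro ⟨h2, h3⟩
        have h4 : d ≠ i := fun h4 => h.left a (by omega) (h4 ▸ h3)
        exact ⟨by omega, by rw [show c - 1 - (c - i) = i - 1 by omega, h3]⟩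
      · rintro ⟨h2, h3⟩
        exact ⟨by omega, by rw [← h3, show c - 1 - (c - i) = i - 1 by omega]⟩
    refine ite_congr (propext hiff) (fun h2 => ?_) (fun _ => rfl)
    rw [h.pt_of_le (by omega)]
    congr 1
    omega
  · by_cases hs : Q.s a = v.vtx i
    · rcases h.cover a hs with ha | ha
      · refine Submodule.mem_sup_left ?_
        have h1 := h.armL.point_zero_ar ha
        have h0 : ¬ v.ltr i = some (a, true) := by
          intro h0
          have hin : i < n := by
            rcases Nat.lt_or_ge i n with hin | hin
            · exact hin
            · obtain rfl : i = n := by omega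
              exact absurd h0 (h.right a)
          exact h.ne a ha (armHead_of_pos (by omega) (arrowOf_eq_some.2 h0))
        rw [if_neg h0, zero_add, h.pt_of_le le_rfl, Nat.sub_self]
        convert h1 using 2
        have hiff : (0 < i ∧ v.ltr (i - 1) = some (a, false)) ↔
            (0 < i - d ∧ v.leftArrows i 0 = some a) := by
          unfold GString.leftArrows
          rw [arrowOf_eq_some, Nat.sub_zero]
          constructor
          · rintro ⟨h2, h3⟩
            have h4 : d ≠ i := fun h4 => h.left a (by omega) (h4 ▸ h3)
            exact ⟨by omega, h3⟩
          · rintro ⟨h2, h3⟩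
            exact ⟨by omega, h3⟩
        refine ite_congr (propext hiff) (fun h2 => ?_) (fun _ => rfl)
        rw [h.pt_of_le (by omega)]
        congr 1
        omega
      · refine Submodule.mem_sup_right ?_
        have h1 := h.armR.point_zero_ar ha
        have h0 : ¬ (0 < i ∧ v.ltr (i - 1) = some (a, false)) := by
          rintro ⟨h2, h3⟩
          have h4 : d ≠ i := fun h4 => h.left a (by omega) (h4 ▸ h3)
          exact h.ne a (armHead_of_pos (by omega) (arrowOf_eq_some.2 (by rw [Nat.sub_zero, h3]))) ha
        rw [if_neg h0, add_zero, h.pt_of_ge le_rfl, Nat.sub_self]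
        convert h1 using 2
        have hiff : (v.ltr i = some (a, true)) ↔
            (0 < n - i ∧ v.rightArrows i 0 = some a) := by
          unfold GString.rightArrows
          rw [arrowOf_eq_some, add_zero]
          constructor
          · intro h3
            have h4 : i ≠ n := fun h4 => h.right a (h4 ▸ h3)
            exact ⟨by omega, h3⟩
          · rintro ⟨h2, h3⟩
            exact h3
        refine ite_congr (propext hiff) (fun h2 => ?_) (fun _ => rfl)
        rw [h.pt_of_ge (by omega)]
        congr 1
        omega
    · refine mem_of_eq_zero ?_
      have h1 : ¬ v.ltr i = some (a, true) := fun h1 => hs (GString.source_of_direct h1)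
      have h2 : ¬ (0 < i ∧ v.ltr (i - 1) = some (a, false)) := by
        rintro ⟨h2, h3⟩
        refine hs ((GString.source_of_inverse h3).trans ?_)
        congr 1
        omega
      rw [if_neg h1, if_neg h2, add_zero, sub_zero]
      apply Subtype.ext
      change (h.pt i).1 * ar I a = 0
      rw [h.pt_peak, ev_mul_ar_of_ne hs]
  · refine Submodule.mem_sup_right ?_
    have h1 := h.armR.point_ar hI (i := i - c - 1) (by omega) a
    obtain ⟨e, he⟩ := h.direct (i - 1) (by omega) (by omega)
    rw [if_neg (c := 0 < i ∧ _) (by rw [he]; simp), add_zero, h.pt_of_ge hi.le]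
    rw [show i - c - 1 + 1 = i - c by omega] at h1
    convert h1 using 2
    have hiff : (v.ltr i = some (a, true)) ↔
        (i - c < n - c ∧ v.rightArrows c (i - c) = some a) := by
      unfold GString.rightArrows
      rw [arrowOf_eq_some, show c + (i - c) = i by omega]
      constructor
      · intro h3
        have h4 : i ≠ n := fun h4 => h.right a (h4 ▸ h3)
        exact ⟨by omega, h3⟩
      · rintro ⟨h2, h3⟩
        exact h3
    refine ite_congr (propext hiff) (fun h2 => ?_) (fun _ => rfl)
    rw [h.pt_of_ge (by omega)]
    congr 1
    omega

/-- The homomorphism from the projective at the peak of a mountain to the string module. -/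
noncomputable def toModule (_ : v.Mountain d c n oL oR) (hI : GeneratedByQuadraticPaths I) :
    evIdeal I (v.vtx c) →ₗ[(BoundAlgebra I)ᵐᵒᵖ] v.module hI :=
  orbitMap (v.basisVec hI c) ∘ₗ (evIdeal I (v.vtx c)).subtype

theorem toModule_pt_right (h : v.Mountain d c n oL oR) (hI : GeneratedByQuadraticPaths I) (j : ℕ)
    (hj : c + j ≤ n) : h.toModule hI (h.pt (c + j)) = v.basisVec hI (c + j) := by
  classical
  induction j with
  | zero =>
    change MulOpposite.op (h.pt c).1 • v.basisVec hI c = _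
    rw [h.pt_peak, v.basisVec_ev, if_pos rfl, add_zero]
  | succ j ih =>
    have hlen := h.le_len
    obtain ⟨a, ha⟩ := h.direct (c + j) (by omega) (by omega)
    rw [← add_assoc, h.pt_right (by omega) ha, map_smul, ih (by omega),
      v.basisVec_ar hI (by omega), GString.move, if_pos ha, if_neg, add_zero]
    rintro ⟨h0, h1⟩
    obtain ⟨e, he⟩ : ∃ e, c + j = e + 1 := ⟨c + j - 1, by omega⟩
    rw [he] at ha h1
    exact GString.ltr_reduced h1 ha rfl

theorem toModule_pt_left (h : v.Mountain d c n oL oR) (hI : GeneratedByQuadraticPaths I) (j : ℕ)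
    (hj : d + j ≤ c) : h.toModule hI (h.pt (c - j)) = v.basisVec hI (c - j) := by
  classical
  induction j with
  | zero => exact h.toModule_pt_right hI 0 h.le_right
  | succ j ih =>
    have hlen := h.le_len
    have hcn := h.le_right
    obtain ⟨a, ha⟩ := h.inverse (c - (j + 1)) (by omega) (by omega)
    rw [h.pt_left (by omega) ha, map_smul, show c - (j + 1) + 1 = c - j by omega, ih (by omega),
      v.basisVec_ar hI (by omega), GString.move, if_neg, zero_add, if_pos]
    · congr 1
    · exact ⟨by omega, ha⟩
    · intro h1
      rw [show c - j = c - (j + 1) + 1 by omega] at h1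
      exact GString.ltr_reduced ha h1 rfl

theorem toModule_pt (h : v.Mountain d c n oL oR) (hI : GeneratedByQuadraticPaths I) {i : ℕ}
    (hd : d ≤ i) (hn : i ≤ n) : h.toModule hI (h.pt i) = v.basisVec hI i := by
  have hdc := h.le_left
  rcases Nat.lt_or_ge i c with hi | hi
  · have := h.toModule_pt_left hI (c - i) (by omega)
    rwa [show c - (c - i) = i by omega] at this
  · have := h.toModule_pt_right hI (i - c) (by omega)
    rwa [show c + (i - c) = i by omega] at this

/-- The continuation is applied at the left end `d`, where it moves the basis vector nowhere: not to
the left, because the mountain ends there, and not to the right. If the arm is trivial, a move to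
the right would make the continuation the first arrow of the other arm. -/
theorem toModule_embed_left (h : v.Mountain d c n oL oR) (hI : GeneratedByQuadraticPaths I)
    (u : optIdeal I oL) : h.toModule hI (h.armL.embed u) = 0 := by
  have hdc := h.le_left
  have hcn := h.le_right
  have hlen := h.le_len
  have key : LinearMap.range h.armL.embed ≤ LinearMap.ker (h.toModule hI) := by
    refine h.armL.range_embed_le.trans (Submodule.span_le.2 ?_)
    rintro _ ⟨a, ha, rfl⟩
    have h0 : h.armL.point (c - d) = h.pt d := (h.pt_of_le hdc).symm
    rw [SetLike.mem_coe, LinearMap.mem_ker, h0, map_smul, h.toModule_pt hI le_rfl (by omega),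
      v.basisVec_ar hI (by omega), GString.move, if_neg, if_neg, add_zero]
    · rintro ⟨h1, h2⟩
      exact h.left a h1 h2
    · intro h1
      rcases Nat.lt_or_ge d c with hd | hd
      · obtain ⟨e, he⟩ := h.inverse d le_rfl hd
        rw [he] at h1
        simp at h1
      · obtain rfl : d = c := by omega
        have hin : d < n := by
          rcases Nat.lt_or_ge d n with hin | hin
          · exact hin
          · obtain rfl : d = n := by omega
            exact absurd h1 (h.right a)
        refine h.ne a ?_ (armHead_of_pos (by omega) (arrowOf_eq_some.2 h1))
        rw [armHead, if_pos (by omega), ha]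
  exact key ⟨u, rfl⟩

theorem toModule_embed_right (h : v.Mountain d c n oL oR) (hI : GeneratedByQuadraticPaths I)
    (u : optIdeal I oR) : h.toModule hI (h.armR.embed u) = 0 := by
  have hdc := h.le_left
  have hcn := h.le_right
  have hlen := h.le_len
  have key : LinearMap.range h.armR.embed ≤ LinearMap.ker (h.toModule hI) := by
    refine h.armR.range_embed_le.trans (Submodule.span_le.2 ?_)
    rintro _ ⟨a, ha, rfl⟩
    have h0 : h.armR.point (n - c) = h.pt n := (h.pt_of_ge hcn).symm
    rw [SetLike.mem_coe, LinearMap.mem_ker, h0, map_smul, h.toModule_pt hI (by omega) le_rfl,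
      v.basisVec_ar hI (by omega), GString.move, if_neg (h.right a), if_neg, add_zero]
    rintro ⟨h1, h2⟩
    rcases Nat.lt_or_ge c n with hd | hd
    · obtain ⟨e, he⟩ := h.direct (n - 1) (by omega) (by omega)
      rw [he] at h2
      simp at h2
    · obtain rfl : c = n := by omega
      have hin : d < c := by
        rcases Nat.lt_or_ge d c with hin | hin
        · exact hin
        · obtain rfl : d = c := by omega
          exact absurd h2 (h.left a h1)
      refine h.ne a (armHead_of_pos (by omega) (arrowOf_eq_some.2 h2)) ?_
      rw [armHead, if_pos (by omega), ha]
  exact key ⟨u, rfl⟩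

/-- The two sides lie in the right ideals of the first arrows of the two arms, and these meet in
zero. -/
theorem eq_zero_of_pt_eq_embed (h : v.Mountain d c n oL oR) (hI : IsGentle I) (hd : d < c)
    {u : BoundAlgebra I} {r : optIdeal I oR} (hr : MulOpposite.op u • h.pt d = h.armR.embed r) :
    MulOpposite.op u • h.pt d = 0 ∧ r = 0 := by
  have h0 : MulOpposite.op u • h.pt d = 0 := by
    apply Subtype.ext
    refine hI.eq_zero_of_mem_optIdeal h.ne ?_ (by rw [hr]; exact h.armR.embed_mem r)
    rw [h.pt_of_le h.le_left]
    exact h.armL.point_smul_mem (by omega) u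
  refine ⟨h0, h.armR.embed_injective hI ?_⟩
  rw [← hr, h0, map_zero]

theorem embed_coprod_injective (h : v.Mountain d c n oL oR) (hI : IsGentle I) :
    Function.Injective (h.armL.embed.coprod h.armR.embed) := by
  rw [← LinearMap.ker_eq_bot, LinearMap.ker_eq_bot']
  rintro ⟨l, r⟩ hlr
  rw [LinearMap.coprod_apply, add_eq_zero_iff_eq_neg, ← map_neg] at hlr
  have h0 : h.armL.embed l = 0 := by
    apply Subtype.ext
    exact hI.eq_zero_of_mem_optIdeal h.ne (h.armL.embed_mem l)
        (by rw [hlr]; exact h.armR.embed_mem _)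
  have h1 : l = 0 := h.armL.embed_injective hI (by rw [h0, map_zero])
  have h2 : -r = 0 := h.armR.embed_injective hI (by rw [← hlr, h0, map_zero])
  rw [h1, neg_eq_zero.1 h2]
  rfl

end GString.Mountain

end Mountains

/-! ### Projective presentations of initial pieces of a string -/

section Presentations

variable {K : Type u} [Field K] {Q : FinQuiver.{u}} {I : TwoSidedIdeal (PathAlgebra K Q)}

/-- Going left from `n`, climb along the longest run of direct letters to `c`, then descend along
the longest run of inverse letters to `d`. Maximality of the runs gives the conditions at `d` and
`c`. -/
theorem exists_isMountain (v : GString I) {n : ℕ} (hn : n ≤ v.len)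
    (hr : ∀ a, v.ltr n ≠ some (a, true)) :
    ∃ d c, v.IsMountain d c n ∧ ∀ a, 0 < c → v.ltr (c - 1) ≠ some (a, true) := by
  classical
  have hC : ∃ c, c ≤ n ∧ ∀ i, c ≤ i → i < n → ∃ a, v.ltr i = some (a, true) := ⟨n, le_rfl, by omega⟩
  obtain ⟨hcn, hdir⟩ := Nat.find_spec hC
  set c := Nat.find hC with hc
  have hD : ∃ d, d ≤ c ∧ ∀ i, d ≤ i → i < c → ∃ a, v.ltr i = some (a, false) :=
      ⟨c, le_rfl, by omega⟩
  obtain ⟨hdc, hinv⟩ := Nat.find_spec hD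
  set d := Nat.find hD with hd
  refine ⟨d, c, ⟨hdc, hcn, hn, hinv, hdir, fun a h0 ha => ?_, hr⟩, fun a h0 ha => ?_⟩
  · refine Nat.find_min hD (m := d - 1) (by omega) ⟨by omega, fun i hi hi' => ?_⟩
    rcases Nat.lt_or_ge i d with h | h
    · obtain rfl : i = d - 1 := by omega
      exact ⟨a, ha⟩
    · exact hinv i h hi'
  · refine Nat.find_min hC (m := c - 1) (by omega) ⟨by omega, fun i hi hi' => ?_⟩
    rcases Nat.lt_or_ge i c with h | h
    · obtain rfl : i = c - 1 := by omega
      exact ⟨a, ha⟩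
    · exact hdir i h hi'

/-- If the left end of a mountain is inside the string, it is a sink of the string. -/
theorem GString.IsMountain.exists_sink {v : GString I} {d c n : ℕ} (h : v.IsMountain d c n)
    (hd : 0 < d) (hmin : d < c ∨ ∀ a, v.ltr (d - 1) ≠ some (a, true)) :
    d < c ∧ ∃ a b, v.ltr (d - 1) = some (a, true) ∧ v.ltr d = some (b, false) := by
  have h1 := h.le_left
  have h2 := h.le_right
  have h3 := h.le_len
  obtain ⟨⟨a, s⟩, ha⟩ := v.exists_ltr (i := d - 1) (by omega)
  cases s with
  | false => exact absurd ha (h.left a hd)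
  | true =>
    have hdc : d < c := hmin.resolve_right fun hn => hn a ha
    obtain ⟨b, hb⟩ := h.inverse d le_rfl hdc
    exact ⟨hdc, a, b, ha, hb⟩

/-- A projective presentation of the part of the string module of `v` up to the position `n`. -/
structure Present (hI : IsGentle I) (v : GString I) (n : ℕ) where
  P : Type u
  [grp : AddCommGroup P]
  [mod : Module (BoundAlgebra I)ᵐᵒᵖ P]
  [proj : Module.Projective (BoundAlgebra I)ᵐᵒᵖ P]
  /-- lifts of the basis vectors -/
  g : ℕ → P
  f : P →ₗ[(BoundAlgebra I)ᵐᵒᵖ] v.module hI.quadratic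
  ι : Type
  [fin : Finite ι]
  y : ι → Q.V
  two_arrows : ∀ i, ∃ a b, a ≠ b ∧ Q.t a = y i ∧ Q.t b = y i
  oL : Option Q.E
  oR : Option Q.E
  -- The right summand of the kernel is kept separate in `ψ₂`, since gluing a further mountain
  -- absorbs it and replaces it by a new one.
  ψ₁ : (optIdeal I oL × ∀ i, evIdeal I (y i)) →ₗ[(BoundAlgebra I)ᵐᵒᵖ] P
  ψ₂ : optIdeal I oR →ₗ[(BoundAlgebra I)ᵐᵒᵖ] P
  inj : Function.Injective (ψ₁.coprod ψ₂)
  f_ψ₁ : ∀ u, f (ψ₁ u) = 0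
  f_ψ₂ : ∀ u, f (ψ₂ u) = 0
  rad_ψ₁ : LinearMap.range ψ₁ ≤ radSub hI.quadratic P
  rad_ψ₂ : LinearMap.range ψ₂ ≤ radSub hI.quadratic P
  gen : ⊤ ≤ Submodule.span (BoundAlgebra I)ᵐᵒᵖ (g '' Set.Iic n)
  f_g : ∀ i, i ≤ n → f (g i) = v.basisVec hI.quadratic i
  g_ev : ∀ i, i ≤ n → ∀ w, open Classical in
    MulOpposite.op (ev I w) • g i = if v.vtx i = w then g i else 0
  g_ar : ∀ i, i ≤ n → ∀ a, MulOpposite.op (ar I a) • g i - v.move g a i ∈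
    LinearMap.range ψ₁ ⊔ LinearMap.range ψ₂
  -- The remaining fields describe the right end and serve only for gluing. Three of them assume
  -- that the string arrives at `n` by a direct letter, as it does when `n` is a sink.
  end_mem : ∀ α, 0 < n → v.ltr (n - 1) = some (α, true) →
    ∀ b, MulOpposite.op (ar I b) • g n ∈ LinearMap.range ψ₂
  end_zero : ∀ α, 0 < n → v.ltr (n - 1) = some (α, true) →
    ∀ b, ar I α * ar I b = 0 → MulOpposite.op (ar I b) • g n = 0
  end_inj : ∀ α, 0 < n → v.ltr (n - 1) = some (α, true) →
    ∀ u, MulOpposite.op u • g n = 0 → ar I α * u = 0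
  end_le : LinearMap.range ψ₂ ≤
    Submodule.span _ (Set.range fun b => MulOpposite.op (ar I b) • g n)

attribute [instance] Present.grp Present.mod Present.proj Present.fin

namespace GString.Mountain

variable {v : GString I} {d c n : ℕ} {oL oR : Option Q.E}

section RightEnd

variable (h : v.Mountain d c n oL oR) (hI : IsGentle I) {α : Q.E} (hn : 0 < n)
  (hα : v.ltr (n - 1) = some (α, true))

theorem lt_of_direct (h : v.Mountain d c n oL oR) (hd : d < c ∨ d = 0) (hn : 0 < n)
    (hα : v.ltr (n - 1) = some (α, true)) : c < n := by
  have h1 := h.le_left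
  have h2 := h.le_right
  by_contra hcn
  obtain rfl : c = n := by omega
  obtain ⟨e, he⟩ := h.inverse (c - 1) (by omega) (by omega)
  rw [he] at hα
  simp at hα

theorem rightArrows_last (hcn : c < n) (hα : v.ltr (n - 1) = some (α, true)) :
    v.rightArrows c (n - c - 1) = some α := by
  refine arrowOf_eq_some.2 ?_
  rw [show c + (n - c - 1) = n - 1 by omega, hα]

theorem leftArrows_last {β : Q.E} (hdc : d < c) (hβ : v.ltr d = some (β, false)) :
    v.leftArrows c (c - d - 1) = some β := by
  refine arrowOf_eq_some.2 ?_
  rw [show c - 1 - (c - d - 1) = d by omega, hβ]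

theorem right_mem (h : v.Mountain d c n oL oR) (hI : IsGentle I) (hcn : c < n) (b : Q.E) :
    MulOpposite.op (ar I b) • h.pt n ∈ LinearMap.range h.armR.embed := by
  have h1 := h.armR.point_ar hI (i := n - c - 1) (by omega) b
  rwa [if_neg (by omega), sub_zero, show n - c - 1 + 1 = n - c by omega,
    ← h.pt_of_ge hcn.le] at h1

theorem right_zero (h : v.Mountain d c n oL oR) (hcn : c < n)
    (hα : v.ltr (n - 1) = some (α, true)) {b : Q.E} (hb : ar I α * ar I b = 0) :
    MulOpposite.op (ar I b) • h.pt n = 0 := by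
  have h1 := armPath_mul_ar_eq_zero (x := v.vtx c) (rightArrows_last hcn hα) hb
  rw [show n - c - 1 + 1 = n - c by omega] at h1
  rw [h.pt_of_ge hcn.le]
  exact Subtype.ext h1

theorem right_inj (h : v.Mountain d c n oL oR) (hI : IsGentle I) (hcn : c < n)
    (hα : v.ltr (n - 1) = some (α, true)) {u : BoundAlgebra I}
    (hu : MulOpposite.op u • h.pt n = 0) : ar I α * u = 0 := by
  refine h.armR.ar_mul_eq_zero hI (i := n - c - 1) (by omega) (rightArrows_last hcn hα) ?_
  rw [show n - c - 1 + 1 = n - c by omega]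
  rw [h.pt_of_ge hcn.le] at hu
  exact congrArg Subtype.val hu

theorem right_le (h : v.Mountain d c n oL oR) : LinearMap.range h.armR.embed ≤
    Submodule.span _ (Set.range fun b => MulOpposite.op (ar I b) • h.pt n) := by
  refine h.armR.range_embed_le.trans (Submodule.span_mono ?_)
  rintro _ ⟨a, -, rfl⟩
  exact ⟨a, by rw [h.pt_of_ge h.le_right]⟩

theorem left_zero {β : Q.E} (h : v.Mountain d c n oL oR) (hdc : d < c)
    (hβ : v.ltr d = some (β, false)) {b : Q.E} (hb : ar I β * ar I b = 0) :
    MulOpposite.op (ar I b) • h.pt d = 0 := by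
  have h1 := armPath_mul_ar_eq_zero (x := v.vtx c) (leftArrows_last hdc hβ) hb
  rw [show c - d - 1 + 1 = c - d by omega] at h1
  rw [h.pt_of_le hdc.le]
  exact Subtype.ext h1

theorem left_inj {β : Q.E} (h : v.Mountain d c n oL oR) (hI : IsGentle I) (hdc : d < c)
    (hβ : v.ltr d = some (β, false)) {u : BoundAlgebra I}
    (hu : MulOpposite.op u • h.pt d = 0) : ar I β * u = 0 := by
  refine h.armL.ar_mul_eq_zero hI (i := c - d - 1) (by omega) (leftArrows_last hdc hβ) ?_
  rw [show c - d - 1 + 1 = c - d by omega]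
  rw [h.pt_of_le hdc.le] at hu
  exact congrArg Subtype.val hu

theorem left_le (h : v.Mountain d c n oL oR) : LinearMap.range h.armL.embed ≤
    Submodule.span _ (Set.range fun b => MulOpposite.op (ar I b) • h.pt d) := by
  refine h.armL.range_embed_le.trans (Submodule.span_mono ?_)
  rintro _ ⟨a, -, rfl⟩
  exact ⟨a, by rw [h.pt_of_le h.le_left]⟩

end RightEnd

/-- The presentation that a mountain at the left end of a string gives. -/
noncomputable def present (h : v.Mountain 0 c n oL oR) (hI : IsGentle I) : Present hI v n where
  P := evIdeal I (v.vtx c)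
  g := h.pt
  f := h.toModule hI.quadratic
  ι := Empty
  y := Empty.elim
  two_arrows := fun i => i.elim
  oL := oL
  oR := oR
  ψ₁ := h.armL.embed ∘ₗ LinearMap.fst _ _ _
  ψ₂ := h.armR.embed
  inj := by
    rintro ⟨⟨l, e⟩, r⟩ ⟨⟨l', e'⟩, r'⟩ hlr
    have := h.embed_coprod_injective hI (a₁ := (l, r)) (a₂ := (l', r')) hlr
    rw [Prod.mk.injEq] at this
    rw [this.1, this.2, Subsingleton.elim e e']
  f_ψ₁ := fun u => h.toModule_embed_left _ _
  f_ψ₂ := h.toModule_embed_right _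
  rad_ψ₁ := (LinearMap.range_comp_le_range _ _).trans (h.armL.range_embed_le_radSub hI)
  rad_ψ₂ := h.armR.range_embed_le_radSub hI
  gen := by
    intro u _
    have : u = MulOpposite.op u.1 • h.pt c := by
      apply Subtype.ext
      change u.1 = (h.pt c).1 * u.1
      rw [h.pt_peak, mem_evIdeal.1 u.2]
    rw [this]
    exact Submodule.smul_mem _ _ (Submodule.subset_span ⟨c, h.le_right, rfl⟩)
  f_g := fun i hi => h.toModule_pt _ (Nat.zero_le _) hi
  g_ev := fun i hi w => h.pt_ev (Nat.zero_le _) hi w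
  g_ar := fun i hi a => by
    have := h.pt_ar hI (Nat.zero_le _) hi a
    rwa [LinearMap.range_comp_of_range_eq_top _ (LinearMap.range_eq_top.2 Prod.fst_surjective)]
  end_mem := fun α hn hα => h.right_mem hI (h.lt_of_direct (Or.inr rfl) hn hα)
  end_zero := fun α hn hα _ hb => h.right_zero (h.lt_of_direct (Or.inr rfl) hn hα) hα hb
  end_inj := fun α hn hα _ hu => h.right_inj hI (h.lt_of_direct (Or.inr rfl) hn hα) hα hu
  end_le := h.right_le

end GString.Mountain

end Presentations

/-! ### Gluing a further mountain at a sink -/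

section Gluing

variable {K : Type u} [Field K] {Q : FinQuiver.{u}} {I : TwoSidedIdeal (PathAlgebra K Q)}
  {hI : IsGentle I} {v : GString I} {d c n : ℕ} {oL oR : Option Q.E}

namespace Present

variable (p : Present hI v d) (h : v.Mountain d c n oL oR)

/-- The vertices of the inner projective summands after gluing at the position `d`. -/
def glueY : Option p.ι → Q.V := fun o => o.elim (v.vtx d) p.y

/-- The lifts of the basis vectors after gluing. -/
noncomputable def glueG (i : ℕ) : p.P × evIdeal I (v.vtx c) :=
  if i ≤ d then (p.g i, 0) else (0, h.pt i)

/-- The inner projective summand that arises from gluing at the position `d`. -/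
noncomputable def glueκ : evIdeal I (v.vtx d) →ₗ[(BoundAlgebra I)ᵐᵒᵖ] p.P × evIdeal I (v.vtx c) :=
  orbitMap (p.g d, -h.pt d) ∘ₗ (evIdeal I (v.vtx d)).subtype

theorem glueκ_apply (u : evIdeal I (v.vtx d)) : p.glueκ h u =
    (MulOpposite.op u.1 • p.g d, -(MulOpposite.op u.1 • h.pt d)) :=
  Prod.ext rfl (smul_neg _ _)

/-- The embedding of the left and inner summands after gluing. -/
noncomputable def glueψ₁ : (optIdeal I p.oL × ∀ i, evIdeal I (p.glueY i)) →ₗ[(BoundAlgebra I)ᵐᵒᵖ]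
    p.P × evIdeal I (v.vtx c) :=
  LinearMap.inl _ _ _ ∘ₗ p.ψ₁ ∘ₗ LinearMap.prodMap LinearMap.id
      (LinearMap.pi fun i => LinearMap.proj (φ := fun i => evIdeal I (p.glueY i)) (some i)) +
    p.glueκ h ∘ₗ LinearMap.proj (φ := fun i => evIdeal I (p.glueY i)) none ∘ₗ LinearMap.snd _ _ _

theorem glueψ₁_apply (u : optIdeal I p.oL) (w : ∀ i, evIdeal I (p.glueY i)) :
    p.glueψ₁ h (u, w) = (p.ψ₁ (u, fun i => w (some i)), 0) + p.glueκ h (w none) := rfl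

/-- The embedding of the right summand after gluing. -/
noncomputable def glueψ₂ : optIdeal I oR →ₗ[(BoundAlgebra I)ᵐᵒᵖ] p.P × evIdeal I (v.vtx c) :=
  LinearMap.inr _ _ _ ∘ₗ h.armR.embed

theorem glueψ₂_apply (u : optIdeal I oR) : p.glueψ₂ h u = (0, h.armR.embed u) := rfl

/-- The relations after gluing. -/
noncomputable def glueN : Submodule (BoundAlgebra I)ᵐᵒᵖ (p.P × evIdeal I (v.vtx c)) :=
  LinearMap.range (p.glueψ₁ h) ⊔ LinearMap.range (p.glueψ₂ h)

theorem glueκ_mem (u : evIdeal I (v.vtx d)) : p.glueκ h u ∈ p.glueN h := by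
  classical
  refine Submodule.mem_sup_left ⟨(0, fun i => match i with | none => u | some i => 0), ?_⟩
  rw [glueψ₁_apply]
  change (p.ψ₁ (0, 0), 0) + _ = _
  rw [show ((0, 0) : optIdeal I p.oL × ∀ i, evIdeal I (p.y i)) = 0 from rfl, map_zero]
  exact zero_add _

theorem ψ₁_mem_glueN (u) : (p.ψ₁ u, 0) ∈ p.glueN h := by
  refine Submodule.mem_sup_left ⟨(u.1, fun i => match i with | none => 0 | some i => u.2 i), ?_⟩
  rw [glueψ₁_apply]
  change _ + p.glueκ h 0 = _
  rw [map_zero, add_zero]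

theorem g_ar_eq_zero {b : Q.E} (hb : Q.s b ≠ v.vtx d) : MulOpposite.op (ar I b) • p.g d = 0 := by
  classical
  have h1 := p.g_ev d le_rfl (v.vtx d)
  rw [if_pos rfl] at h1
  rw [← h1, ← mul_smul, ← MulOpposite.op_mul, ev_mul_ar_of_ne hb, MulOpposite.op_zero, zero_smul]

theorem pt_ar_eq_zero (hdc : d ≤ c) {b : Q.E} (hb : Q.s b ≠ v.vtx d) :
    MulOpposite.op (ar I b) • h.pt d = 0 := by
  classical
  have h1 := h.pt_ev le_rfl (hdc.trans h.le_right) (v.vtx d)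
  rw [if_pos rfl] at h1
  rw [← h1, ← mul_smul, ← MulOpposite.op_mul, ev_mul_ar_of_ne hb, MulOpposite.op_zero, zero_smul]

/-- The hypotheses on the position at which a presentation is glued to a mountain. -/
structure IsSink (v : GString I) (d c : ℕ) (α β : Q.E) : Prop where
  pos : 0 < d
  lt : d < c
  left : v.ltr (d - 1) = some (α, true)
  right : v.ltr d = some (β, false)

variable {α β : Q.E} (hs : IsSink v d c α β)

theorem IsSink.ne (hs : IsSink v d c α β) : α ≠ β := by
  have h0 := hs.pos
  have h1 := hs.right
  rw [show d = d - 1 + 1 by omega] at h1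
  exact GString.ltr_reduced hs.left h1

theorem IsSink.target_left (hs : IsSink v d c α β) : Q.t α = v.vtx d := by
  have h0 := hs.pos
  rw [GString.target_of_direct hs.left]
  congr 1
  omega

theorem IsSink.target_right (hs : IsSink v d c α β) : Q.t β = v.vtx d :=
  GString.target_of_inverse hs.right

/-- At most one of `αb` and `βb` is nonzero, so `b` annihilates one of the two paths that meet at
the sink. -/
theorem g_ar_or_pt_ar (hs : IsSink v d c α β) (b : Q.E) :
    MulOpposite.op (ar I b) • p.g d = 0 ∨ MulOpposite.op (ar I b) • h.pt d = 0 := by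
  by_cases h0 : ar I α * ar I b = 0
  · exact Or.inl (p.end_zero α hs.pos hs.left b h0)
  · refine Or.inr (h.left_zero hs.lt hs.right ?_)
    by_contra h1
    exact hs.ne (hI.prev_unique h0 h1)

/-- The generator at the sink is the difference of the two arriving paths. Multiplied by an arrow it
has at most one nonzero component, so each component is itself a relation. -/
theorem glue_mem (hs : IsSink v d c α β) (b : Q.E) :
    (MulOpposite.op (ar I b) • p.g d, 0) ∈ p.glueN h ∧
      (0, MulOpposite.op (ar I b) • h.pt d) ∈ p.glueN h := by
  by_cases hb : Q.s b = v.vtx d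
  · have h1 := p.glueκ_mem h ⟨ar I b, ar_mem_evIdeal hb⟩
    rw [glueκ_apply] at h1
    rcases p.g_ar_or_pt_ar h hs b with h0 | h0
    · rw [h0] at h1 ⊢
      refine ⟨zero_mem _, ?_⟩
      rw [← neg_mem_iff]
      simpa using h1
    · rw [h0] at h1 ⊢
      refine ⟨?_, zero_mem _⟩
      simpa using h1
  · rw [p.g_ar_eq_zero hb, pt_ar_eq_zero h hs.lt.le hb]
    exact ⟨zero_mem _, zero_mem _⟩

/-- The old right summand is generated by arrows applied at `d`, and the new inner summand contains
these elements. So no relation of the old presentation is lost when that summand is dropped. -/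
theorem inl_mem_glueN (hs : IsSink v d c α β) {x : p.P}
    (hx : x ∈ LinearMap.range p.ψ₁ ⊔ LinearMap.range p.ψ₂) : (x, 0) ∈ p.glueN h := by
  have key : LinearMap.range p.ψ₁ ⊔ LinearMap.range p.ψ₂ ≤
      (p.glueN h).comap (LinearMap.inl _ _ _) := by
    refine sup_le ?_ (p.end_le.trans (Submodule.span_le.2 ?_))
    · rintro _ ⟨u, rfl⟩
      exact p.ψ₁_mem_glueN h u
    · rintro _ ⟨b, rfl⟩
      exact (p.glue_mem h hs b).1
  exact key hx

theorem inr_mem_glueN (hs : IsSink v d c α β) {x : evIdeal I (v.vtx c)}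
    (hx : x ∈ LinearMap.range h.armL.embed ⊔ LinearMap.range h.armR.embed) :
    (0, x) ∈ p.glueN h := by
  have key : LinearMap.range h.armL.embed ⊔ LinearMap.range h.armR.embed ≤
      (p.glueN h).comap (LinearMap.inr _ _ _) := by
    refine sup_le (h.left_le.trans (Submodule.span_le.2 ?_)) ?_
    · rintro _ ⟨b, rfl⟩
      exact (p.glue_mem h hs b).2
    · rintro _ ⟨u, rfl⟩
      exact Submodule.mem_sup_right ⟨u, rfl⟩
  exact key hx

/-- Let `u` be the coefficient of the generator at the sink in a vanishing combination. The new
mountain forces `βu = 0`, the old presentation forces `αu = 0`, and `α ≠ β` end at the same vertex,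
so `u = 0`. -/
theorem glueψ_injective (hs : IsSink v d c α β) :
    Function.Injective ((p.glueψ₁ h).coprod (p.glueψ₂ h)) := by
  rw [← LinearMap.ker_eq_bot, LinearMap.ker_eq_bot']
  rintro ⟨⟨l, w⟩, r⟩ h0
  let w₁ : ∀ i, evIdeal I (p.y i) := fun i => w (some i)
  replace h0 : (p.ψ₁ (l, w₁), 0) + (MulOpposite.op (w none).1 • p.g d,
      -(MulOpposite.op (w none).1 • h.pt d)) + (0, h.armR.embed r) = 0 :=
    (congrArg (fun z => (p.ψ₁ (l, w₁), 0) + z + (0, h.armR.embed r))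
      (p.glueκ_apply h (w none)).symm).trans h0
  have h1 : p.ψ₁ (l, w₁) + MulOpposite.op (w none).1 • p.g d = 0 := by
    have := congrArg Prod.fst h0
    simpa using this
  have h2 : MulOpposite.op (w none).1 • h.pt d = h.armR.embed r := by
    have := congrArg Prod.snd h0
    simp only [Prod.snd_add, zero_add, Prod.snd_zero] at this
    rwa [neg_add_eq_zero] at this
  obtain ⟨h3, rfl⟩ := h.eq_zero_of_pt_eq_embed hI hs.lt h2
  have h4 := h.left_inj hI hs.lt hs.right h3
  have hw : ev I (v.vtx d) * (w none).1 = (w none).1 := (w none).2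
  obtain ⟨x, -, hx⟩ := hI.exists_expansion_of_ar_mul_eq_zero
    (by rw [hs.target_right]; exact hw) h4
  -- Since `βu = 0`, the element `u` is a sum of multiples of arrows, so `g d` times `u` lies in the
  -- old right summand. The injectivity of the old presentation can now be applied.
  obtain ⟨r', hr'⟩ : MulOpposite.op (w none).1 • p.g d ∈ LinearMap.range p.ψ₂ := by
    rw [hx, ← orbitMap_apply, map_sum]
    refine sum_mem fun b _ => ?_
    rw [orbitMap_apply, MulOpposite.op_mul, mul_smul]
    exact Submodule.smul_mem _ _ (p.end_mem α hs.pos hs.left b)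
  have h5 : ((l, w₁), r') = 0 := by
    apply p.inj
    rw [LinearMap.coprod_apply, map_zero, hr']
    exact h1
  rw [Prod.mk_eq_zero, Prod.mk_eq_zero] at h5
  obtain ⟨⟨hl, hw'⟩, hr⟩ := h5
  rw [hr, map_zero] at hr'
  have h6 := p.end_inj α hs.pos hs.left _ hr'.symm
  have h7 : (w none).1 = 0 := hI.eq_zero_of_two_ar_mul_eq_zero hs.ne
    (hs.target_left.trans hs.target_right.symm) (by rw [hs.target_left]; exact hw) h6 h4
  have h8 : w = 0 := by
    funext i
    cases i with
    | none => exact Subtype.ext h7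
    | some i => exact congrFun hw' i
  rw [hl, h8]
  rfl

theorem glueG_of_le {i : ℕ} (hi : i ≤ d) : p.glueG h i = (p.g i, 0) := if_pos hi

theorem glueG_of_gt {i : ℕ} (hi : d < i) : p.glueG h i = (0, h.pt i) := if_neg (by omega)

theorem move_glueG_of_le (hs : IsSink v d c α β) {i : ℕ} (hi : i ≤ d) (a : Q.E) :
    v.move (p.glueG h) a i = (v.move p.g a i, 0) := by
  classical
  unfold GString.move
  have h1 : (if v.ltr i = some (a, true) then p.glueG h (i + 1) else 0) =
      ((if v.ltr i = some (a, true) then p.g (i + 1) else 0), 0) := by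
    split_ifs with h1
    · have : i ≠ d := by
        rintro rfl
        rw [hs.right] at h1
        simp at h1
      exact p.glueG_of_le h (by omega)
    · rfl
  have h2 : (if 0 < i ∧ v.ltr (i - 1) = some (a, false) then p.glueG h (i - 1) else 0) =
      ((if 0 < i ∧ v.ltr (i - 1) = some (a, false) then p.g (i - 1) else 0), 0) := by
    split_ifs with h1
    · exact p.glueG_of_le h (by omega)
    · rfl
  rw [h1, h2, Prod.mk_add_mk, add_zero]

/-- Only `i = d` has content: there the lift sits in the old projective, and modulo the generator at
the sink it equals the path from the new peak. -/
theorem glueG_sub_mem {i : ℕ} (hi : d ≤ i) : p.glueG h i - (0, h.pt i) ∈ p.glueN h := by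
  classical
  rcases hi.eq_or_lt with rfl | hi
  · have h1 := p.glueκ_mem h ⟨ev I (v.vtx d), ev_mem_evIdeal _⟩
    rw [glueκ_apply] at h1
    rw [p.glueG_of_le h le_rfl]
    have h2 := p.g_ev d le_rfl (v.vtx d)
    have h3 := h.pt_ev le_rfl (h.le_left.trans h.le_right) (v.vtx d)
    rw [if_pos rfl] at h2 h3
    rw [h2, h3] at h1
    simpa using h1
  · rw [p.glueG_of_gt h hi, sub_self]
    exact zero_mem _

theorem move_glueG_sub_mem {i : ℕ} (hi : d < i) (a : Q.E) :
    v.move (p.glueG h) a i - (0, v.move h.pt a i) ∈ p.glueN h := by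
  classical
  unfold GString.move
  rw [show ((0 : p.P), (if v.ltr i = some (a, true) then h.pt (i + 1) else 0) +
      if 0 < i ∧ v.ltr (i - 1) = some (a, false) then h.pt (i - 1) else 0) =
      (0, (if v.ltr i = some (a, true) then h.pt (i + 1) else 0)) +
      (0, if 0 < i ∧ v.ltr (i - 1) = some (a, false) then h.pt (i - 1) else 0) by
    rw [Prod.mk_add_mk, add_zero], add_sub_add_comm]
  refine add_mem ?_ ?_
  · split_ifs
    · exact p.glueG_sub_mem h (by omega)
    · exact mem_of_eq_zero (sub_self _)
  · split_ifs
    · exact p.glueG_sub_mem h (by omega)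
    · exact mem_of_eq_zero (sub_self _)

theorem glueG_ar (hs : IsSink v d c α β) {i : ℕ} (hi : i ≤ n) (a : Q.E) :
    MulOpposite.op (ar I a) • p.glueG h i - v.move (p.glueG h) a i ∈ p.glueN h := by
  rcases Nat.lt_or_ge d i with hd | hd
  · have h1 := p.inr_mem_glueN h hs (h.pt_ar hI hd.le hi a)
    have h2 := sub_mem h1 (p.move_glueG_sub_mem h hd a)
    convert h2 using 1
    rw [p.glueG_of_gt h hd]
    refine Prod.ext ?_ ?_
    · simp
    · simp only [Prod.smul_snd, Prod.snd_sub]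
      abel
  · rw [p.glueG_of_le h hd, p.move_glueG_of_le h hs hd]
    convert p.inl_mem_glueN h hs (p.g_ar i hd a) using 1
    refine Prod.ext ?_ ?_ <;> simp

theorem glue_gen (hs : IsSink v d c α β) :
    ⊤ ≤ Submodule.span (BoundAlgebra I)ᵐᵒᵖ (p.glueG h '' Set.Iic n) := by
  have hcn := h.le_right
  have hdc := hs.lt
  have h1 : ∀ x : p.P, (x, 0) ∈ Submodule.span (BoundAlgebra I)ᵐᵒᵖ (p.glueG h '' Set.Iic n) := by
    have key : ⊤ ≤ (Submodule.span (BoundAlgebra I)ᵐᵒᵖ (p.glueG h '' Set.Iic n)).comap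
        (LinearMap.inl _ _ _) := by
      refine p.gen.trans (Submodule.span_le.2 ?_)
      rintro _ ⟨i, hi, rfl⟩
      have hi' : i ≤ d := hi
      exact Submodule.subset_span ⟨i, Set.mem_Iic.2 (by omega), p.glueG_of_le h hi⟩
    exact fun x => key trivial
  have h2 : ∀ x : evIdeal I (v.vtx c),
      ((0 : p.P), x) ∈ Submodule.span (BoundAlgebra I)ᵐᵒᵖ (p.glueG h '' Set.Iic n) := by
    intro x
    have : ((0 : p.P), x) = MulOpposite.op x.1 • p.glueG h c := by
      rw [p.glueG_of_gt h hdc]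
      refine Prod.ext (smul_zero _).symm (Subtype.ext ?_)
      change x.1 = (h.pt c).1 * x.1
      rw [h.pt_peak, mem_evIdeal.1 x.2]
    rw [this]
    exact Submodule.smul_mem _ _ (Submodule.subset_span ⟨c, Set.mem_Iic.2 hcn, rfl⟩)
  rintro ⟨x, y⟩ _
  rw [← Prod.fst_add_snd (x, y)]
  exact add_mem (h1 x) (h2 y)

theorem glue_f {i : ℕ} (hi : i ≤ n) :
    (p.f.coprod (h.toModule hI.quadratic)) (p.glueG h i) = v.basisVec hI.quadratic i := by
  rcases Nat.lt_or_ge d i with hd | hd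
  · rw [p.glueG_of_gt h hd, LinearMap.coprod_apply, map_zero, zero_add, h.toModule_pt _ hd.le hi]
  · rw [p.glueG_of_le h hd, LinearMap.coprod_apply, map_zero, add_zero, p.f_g i hd]

open Classical in
theorem glueG_ev {i : ℕ} (hi : i ≤ n) (w : Q.V) : MulOpposite.op (ev I w) • p.glueG h i =
    if v.vtx i = w then p.glueG h i else 0 := by
  rcases Nat.lt_or_ge d i with hd | hd
  · rw [p.glueG_of_gt h hd, Prod.smul_mk, smul_zero, h.pt_ev hd.le hi]
    split_ifs <;> rfl
  · rw [p.glueG_of_le h hd, Prod.smul_mk, smul_zero, p.g_ev i hd]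
    split_ifs <;> rfl

/-- Modulo the old relations, which lie in the radical, the lift at the sink is the preceding lift
times `α`. -/
theorem g_mem_radSub (hs : IsSink v d c α β) : p.g d ∈ radSub hI.quadratic p.P := by
  classical
  obtain ⟨j, rfl⟩ : ∃ j, d = j + 1 := ⟨d - 1, by have := hs.pos; omega⟩
  have hα : v.ltr j = some (α, true) := hs.left
  have h1 := sup_le p.rad_ψ₁ p.rad_ψ₂ (p.g_ar j (by omega) α)
  rw [GString.move, if_pos hα, if_neg, add_zero] at h1
  · rw [← sub_sub_self (MulOpposite.op (ar I α) • p.g j) (p.g (j + 1))]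
    exact sub_mem (smul_mem_radSub _ (aug_ar _ _) _) h1
  · rintro ⟨h2, h3⟩
    rw [show j = j - 1 + 1 by omega] at hα
    exact GString.ltr_reduced h3 hα rfl

theorem pt_mem_radSub (hs : IsSink v d c α β) :
    h.pt d ∈ radSub hI.quadratic (evIdeal I (v.vtx c)) := by
  rw [h.pt_left hs.lt hs.right]
  exact smul_mem_radSub _ (aug_ar _ _) _

theorem range_glueψ₁_le (hs : IsSink v d c α β) : LinearMap.range (p.glueψ₁ h) ≤
    radSub hI.quadratic (p.P × evIdeal I (v.vtx c)) := by
  have h1 : ∀ x ∈ radSub hI.quadratic p.P,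
      (x, 0) ∈ radSub hI.quadratic (p.P × evIdeal I (v.vtx c)) :=
    fun x hx => map_radSub_le _ (LinearMap.inl _ _ _) ⟨x, hx, rfl⟩
  have h2 : ∀ x ∈ radSub hI.quadratic (evIdeal I (v.vtx c)),
      (0, x) ∈ radSub hI.quadratic (p.P × evIdeal I (v.vtx c)) :=
    fun x hx => map_radSub_le _ (LinearMap.inr _ _ _) ⟨x, hx, rfl⟩
  have hg := h1 _ (p.g_mem_radSub hs)
  have ht := h2 _ (pt_mem_radSub (hI := hI) h hs)
  rintro _ ⟨⟨l, w⟩, rfl⟩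
  rw [glueψ₁_apply]
  refine add_mem (h1 _ (p.rad_ψ₁ ⟨_, rfl⟩)) ?_
  have h3 : (p.g d, -h.pt d) ∈ radSub hI.quadratic (p.P × evIdeal I (v.vtx c)) := by
    convert sub_mem hg ht using 1
    refine Prod.ext ?_ ?_ <;> simp
  exact Submodule.smul_mem _ (MulOpposite.op (w none).1) h3

/-- The presentation obtained by adding a mountain. -/
noncomputable def glue (hs : IsSink v d c α β) : Present hI v n :=
  have hdn : d < n := hs.lt.trans_le h.le_right
  { P := p.P × evIdeal I (v.vtx c)
    g := p.glueG h
    f := p.f.coprod (h.toModule hI.quadratic)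
    ι := Option p.ι
    y := p.glueY
    two_arrows := fun i => by
      cases i with
      | none => exact ⟨α, β, hs.ne, hs.target_left, hs.target_right⟩
      | some i => exact p.two_arrows i
    oL := p.oL
    oR := oR
    ψ₁ := p.glueψ₁ h
    ψ₂ := p.glueψ₂ h
    inj := p.glueψ_injective h hs
    f_ψ₁ := by
      rintro ⟨l, w⟩
      rw [glueψ₁_apply, map_add]
      have h1 : (p.f.coprod (h.toModule hI.quadratic)) (p.glueκ h (w none)) = 0 := by
        have h2 := p.glueκ_apply h (w none)
        refine (congrArg _ h2).trans ?_
        rw [LinearMap.coprod_apply, map_neg, map_smul, map_smul, p.f_g d le_rfl,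
          h.toModule_pt _ le_rfl hdn.le, add_neg_cancel]
      rw [h1, add_zero, LinearMap.coprod_apply, map_zero, add_zero]
      exact p.f_ψ₁ _
    f_ψ₂ := by
      intro u
      rw [glueψ₂_apply, LinearMap.coprod_apply, map_zero, zero_add, h.toModule_embed_right]
    rad_ψ₁ := p.range_glueψ₁_le h hs
    rad_ψ₂ := by
      rintro _ ⟨u, rfl⟩
      exact map_radSub_le _ (LinearMap.inr _ _ _)
        ⟨_, h.armR.range_embed_le_radSub hI ⟨u, rfl⟩, rfl⟩
    gen := p.glue_gen h hs
    f_g := fun i hi => p.glue_f h hi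
    g_ev := fun i hi w => p.glueG_ev h hi w
    g_ar := fun i hi a => p.glueG_ar h hs hi a
    end_mem := fun α' h0 hα b => by
      obtain ⟨u, hu⟩ := h.right_mem hI (h.lt_of_direct (Or.inl hs.lt) h0 hα) b
      refine ⟨u, ?_⟩
      rw [p.glueG_of_gt h hdn, glueψ₂_apply, hu, Prod.smul_mk, smul_zero]
    end_zero := fun α' h0 hα b hb => by
      rw [p.glueG_of_gt h hdn, Prod.smul_mk, smul_zero,
        h.right_zero (h.lt_of_direct (Or.inl hs.lt) h0 hα) hα hb]
      rfl
    end_inj := fun α' h0 hα u hu => by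
      rw [p.glueG_of_gt h hdn, Prod.smul_mk] at hu
      exact h.right_inj hI (h.lt_of_direct (Or.inl hs.lt) h0 hα) hα (congrArg Prod.snd hu)
    end_le := by
      have key : LinearMap.range h.armR.embed ≤ (Submodule.span _ (Set.range fun b =>
          MulOpposite.op (ar I b) • p.glueG h n)).comap (LinearMap.inr _ _ _) := by
        refine h.right_le.trans (Submodule.span_le.2 ?_)
        rintro _ ⟨b, rfl⟩
        refine Submodule.subset_span ⟨b, ?_⟩
        change MulOpposite.op (ar I b) • p.glueG h n = _
        rw [p.glueG_of_gt h hdn, Prod.smul_mk, smul_zero]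
        rfl
      rintro _ ⟨u, rfl⟩
      exact key ⟨u, rfl⟩ }

end Present

end Gluing

/-! ### The first syzygy and its decompositions -/

section Decomposition

variable {K : Type u} [Field K] {Q : FinQuiver.{u}} {I : TwoSidedIdeal (PathAlgebra K Q)}

/-- Split off the last mountain. If it does not reach the left end of the string, its left end is a
sink, and the shorter piece up to there is presented by induction. -/
theorem IsGentle.nonempty_present (hI : IsGentle I) (v : GString I) (n : ℕ) (hn : n ≤ v.len)
    (hr : ∀ a, v.ltr n ≠ some (a, true)) : Nonempty (Present hI v n) := by
  induction n using Nat.strong_induction_on with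
  | _ n ih =>
    obtain ⟨d, c, h, hmin⟩ := exists_isMountain v hn hr
    obtain ⟨oL, oR, hL, hR, hcov, hne⟩ := h.exists_arms hI
    have hm : v.Mountain d c n oL oR := ⟨h, hL, hR, hcov, hne⟩
    rcases Nat.eq_zero_or_pos d with rfl | hd
    · exact ⟨hm.present hI⟩
    · have h1 := h.le_left
      have h2 := h.le_right
      obtain ⟨hdc, a, b, ha, hb⟩ := h.exists_sink hd <| by
        rcases h1.lt_or_eq with h3 | rfl
        · exact Or.inl h3
        · exact Or.inr fun a => hmin a hd
      obtain ⟨p⟩ := ih d (by omega) (by omega) (by rw [hb]; simp)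
      exact ⟨p.glue hm ⟨hd, hdc, ha, hb⟩⟩

namespace Present

variable {hI : IsGentle I} {v : GString I} (p : Present hI v v.len)

/-- The combination of the lifts of the basis vectors with coefficients `c`. -/
noncomputable def comb (c : ℕ → K) : p.P :=
  ∑ i ∈ Finset.range (v.len + 1), MulOpposite.op (algebraMap K (BoundAlgebra I) (c i)) • p.g i

theorem f_comb (c : ℕ → K) : p.f (p.comb c) = (fun j : Fin (v.len + 1) => c j : Fin _ → K) := by
  rw [← GString.sum_basisVec_apply hI.quadratic, comb, map_sum]
  refine Finset.sum_congr rfl fun i hi => ?_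
  rw [map_smul, p.f_g i (by simpa [Nat.lt_succ_iff] using hi)]

theorem surjective_f : Function.Surjective p.f := by
  intro x
  let y : Fin (v.len + 1) → K := x
  refine ⟨p.comb fun i => if h : i < v.len + 1 then y ⟨i, h⟩ else 0, ?_⟩
  rw [f_comb]
  funext j
  exact dif_pos j.2

/-- The relations of the presentation. -/
noncomputable def rel : Submodule (BoundAlgebra I)ᵐᵒᵖ p.P :=
  LinearMap.range p.ψ₁ ⊔ LinearMap.range p.ψ₂

/-- The elements that are combinations of the lifts of the basis vectors modulo the relations. -/
noncomputable def combSub : AddSubgroup p.P where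
  carrier := {ξ | ∃ c, ξ - p.comb c ∈ p.rel}
  zero_mem' := ⟨0, by simp [comb]⟩
  add_mem' := by
    rintro ξ η ⟨c, hc⟩ ⟨d, hd⟩
    refine ⟨c + d, ?_⟩
    have : p.comb (c + d) = p.comb c + p.comb d := by
      simp only [comb, Pi.add_apply, map_add, MulOpposite.op_add, add_smul, Finset.sum_add_distrib]
    rw [this, add_sub_add_comm]
    exact add_mem hc hd
  neg_mem' := by
    rintro ξ ⟨c, hc⟩
    refine ⟨-c, ?_⟩
    have : p.comb (-c) = -p.comb c := by
      simp only [comb, Pi.neg_apply, map_neg, MulOpposite.op_neg, neg_smul, Finset.sum_neg_distrib]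
    rw [this, neg_sub_neg, ← neg_sub]
    exact neg_mem hc

theorem g_mem_combSub {i : ℕ} (hi : i ≤ v.len) : p.g i ∈ p.combSub := by
  classical
  refine ⟨Pi.single i 1, ?_⟩
  have : p.comb (Pi.single i 1) = p.g i := by
    rw [comb, Finset.sum_eq_single i]
    · simp
    · intro j _ hj
      simp [hj]
    · intro h
      exact absurd (Finset.mem_range.2 (by omega)) h
  rw [this, sub_self]
  exact zero_mem _

theorem rel_le {ξ : p.P} (h : ξ ∈ p.rel) : ξ ∈ p.combSub := by
  refine ⟨0, ?_⟩
  have : p.comb 0 = 0 := by simp [comb]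
  rwa [this, sub_zero]

theorem smul_comb_mem {x : BoundAlgebra I}
    (h : ∀ i ≤ v.len, MulOpposite.op x • p.g i ∈ p.combSub) {ξ : p.P} (hξ : ξ ∈ p.combSub)
    (hK : ∀ (c : K) (η : p.P), η ∈ p.combSub →
      MulOpposite.op (algebraMap K (BoundAlgebra I) c) • η ∈ p.combSub) :
    MulOpposite.op x • ξ ∈ p.combSub := by
  obtain ⟨c, hc⟩ := hξ
  rw [← sub_add_cancel ξ (p.comb c), smul_add]
  refine add_mem (p.rel_le (Submodule.smul_mem _ _ hc)) ?_
  rw [comb, Finset.smul_sum]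
  refine sum_mem fun i hi => ?_
  rw [← mul_smul, ← MulOpposite.op_mul, Algebra.commutes, MulOpposite.op_mul, mul_smul]
  exact hK _ _ (h i (by simpa [Nat.lt_succ_iff] using hi))

/-- Vertices and arrows permute the lifts, up to zero and up to relations, so linear combinations of
lifts modulo relations form a submodule. It contains the generators, hence everything. -/
theorem smul_mem_combSub (x : BoundAlgebra I) :
    ∀ ξ ∈ p.combSub, MulOpposite.op x • ξ ∈ p.combSub := by
  classical
  have hK : ∀ (c : K) (η : p.P), η ∈ p.combSub →
      MulOpposite.op (algebraMap K (BoundAlgebra I) c) • η ∈ p.combSub := by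
    rintro c η ⟨d, hd⟩
    refine ⟨fun i => c * d i, ?_⟩
    have : p.comb (fun i => c * d i) =
        MulOpposite.op (algebraMap K (BoundAlgebra I) c) • p.comb d := by
      rw [comb, comb, Finset.smul_sum]
      refine Finset.sum_congr rfl fun i _ => ?_
      rw [← mul_smul, ← MulOpposite.op_mul, ← map_mul, mul_comm]
    rw [this, ← smul_sub]
    exact Submodule.smul_mem _ _ hd
  induction x using BoundAlgebra.induction with
  | hC c => exact hK c
  | hv w =>
    refine fun ξ hξ => p.smul_comb_mem (fun i hi => ?_) hξ hK
    rw [p.g_ev i hi]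
    split_ifs
    · exact p.g_mem_combSub hi
    · exact zero_mem _
  | ha a =>
    refine fun ξ hξ => p.smul_comb_mem (fun i hi => ?_) hξ hK
    rw [← sub_add_cancel (MulOpposite.op (ar I a) • p.g i) (v.move p.g a i)]
    refine add_mem (p.rel_le (p.g_ar i hi a)) ?_
    rw [GString.move]
    refine add_mem ?_ ?_
    · split_ifs with h
      · exact p.g_mem_combSub (GString.lt_of_ltr h)
      · exact zero_mem _
    · split_ifs with h
      · exact p.g_mem_combSub (by omega)
      · exact zero_mem _
  | hadd x y hx hy =>
    intro ξ hξ
    rw [MulOpposite.op_add, add_smul]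
    exact add_mem (hx ξ hξ) (hy ξ hξ)
  | hmul x y hx hy =>
    intro ξ hξ
    rw [MulOpposite.op_mul, mul_smul]
    exact hy _ (hx ξ hξ)

theorem mem_combSub (ξ : p.P) : ξ ∈ p.combSub := by
  have h : ξ ∈ Submodule.span (BoundAlgebra I)ᵐᵒᵖ (p.g '' Set.Iic v.len) :=
    p.gen Submodule.mem_top
  induction h using Submodule.span_induction with
  | mem x hx =>
    obtain ⟨i, hi, rfl⟩ := hx
    exact p.g_mem_combSub hi
  | zero => exact zero_mem _
  | add x y _ _ hx hy => exact add_mem hx hy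
  | smul r x _ hx => exact p.smul_mem_combSub r.unop x hx

/-- Modulo the relations every element is a linear combination of the lifts, and its image in the
string module shows the coefficients. For an element of the kernel they all vanish, so the relations
already exhaust the kernel. -/
theorem ker_f : LinearMap.ker p.f = p.rel := by
  have hle : p.rel ≤ LinearMap.ker p.f := by
    refine sup_le ?_ ?_
    · rintro _ ⟨u, rfl⟩; exact p.f_ψ₁ u
    · rintro _ ⟨u, rfl⟩; exact p.f_ψ₂ u
  refine le_antisymm (fun ξ hξ => ?_) hle
  obtain ⟨c, hc⟩ := p.mem_combSub ξ
  have h1 : p.f (p.comb c) = 0 := by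
    have := hle hc
    rwa [LinearMap.mem_ker, map_sub, LinearMap.mem_ker.1 hξ, zero_sub, neg_eq_zero] at this
  have h2 : p.comb c = 0 := by
    rw [f_comb] at h1
    refine Finset.sum_eq_zero fun i hi => ?_
    have : c i = 0 := congrFun h1 ⟨i, Finset.mem_range.1 hi⟩
    rw [this, map_zero, MulOpposite.op_zero, zero_smul]
  rwa [h2, sub_zero] at hc

theorem isFirstSyzygy : IsFirstSyzygy (v.module hI.quadratic)
    (ModuleCat.of (BoundAlgebra I)ᵐᵒᵖ
      ((optIdeal I p.oL × ∀ i, evIdeal I (p.y i)) × optIdeal I p.oR)) := by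
  have hr : LinearMap.range (p.ψ₁.coprod p.ψ₂) = LinearMap.ker p.f := by
    rw [LinearMap.range_coprod, ker_f, rel]
  have : Module.Projective (BoundAlgebra I)ᵐᵒᵖ (ModuleCat.of (BoundAlgebra I)ᵐᵒᵖ p.P) := p.proj
  refine ⟨ModuleCat.of _ p.P, p.f, hI.isProjectiveCover (P := ModuleCat.of _ p.P) p.surjective_f ?_,
    ⟨LinearEquiv.ofInjective _ p.inj ≪≫ₗ LinearEquiv.ofEq _ _ hr⟩⟩
  rw [ker_f]
  exact sup_le p.rad_ψ₁ p.rad_ψ₂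

/-- The summands of the first syzygy. -/
noncomputable def summand : Option (Option p.ι) → RightMod I
  | none => ModuleCat.of _ (optIdeal I p.oL)
  | some none => ModuleCat.of _ (optIdeal I p.oR)
  | some (some i) => ModuleCat.of _ (evIdeal I (p.y i))

/-- The first syzygy is the product of the summands. -/
noncomputable def piSummandEquiv : (∀ o, p.summand o) ≃ₗ[(BoundAlgebra I)ᵐᵒᵖ]
    (optIdeal I p.oL × ∀ i, evIdeal I (p.y i)) × optIdeal I p.oR where
  toFun x := ((x none, fun i => x (some (some i))), x (some none))
  map_add' _ _ := rfl
  map_smul' _ _ := rfl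
  invFun x o := match o with
    | none => x.1.1
    | some none => x.2
    | some (some i) => x.1.2 i
  left_inv x := by funext o; rcases o with _ | _ | i <;> rfl
  right_inv x := rfl

theorem isHollow_summand (o) : IsHollow (A := (BoundAlgebra I)ᵐᵒᵖ) (p.summand o) := by
  have key : ∀ o : Option Q.E, IsHollow (A := (BoundAlgebra I)ᵐᵒᵖ) (optIdeal I o) := by
    rintro (_ | a)
    · intro U V _
      left
      have : Subsingleton (optIdeal I none) :=
        inferInstanceAs (Subsingleton (⊥ : Submodule (BoundAlgebra I)ᵐᵒᵖ (BoundAlgebra I)))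
      exact Subsingleton.elim _ _
    · exact hI.isHollow_arIdeal a
  rcases o with _ | _ | i
  · exact key _
  · exact key _
  · exact hI.isHollow_evIdeal _

theorem isNoetherian_summand (o) : IsNoetherian (BoundAlgebra I)ᵐᵒᵖ (p.summand o) := by
  have := hI.isNoetherian
  rcases o with _ | _ | i
  · exact inferInstanceAs (IsNoetherian _ (optIdeal I p.oL))
  · exact inferInstanceAs (IsNoetherian _ (optIdeal I p.oR))
  · exact inferInstanceAs (IsNoetherian _ (evIdeal I (p.y i)))

theorem _root_.GentleExt.isArrowModuleOrZero_optIdeal (o : Option Q.E) :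
    IsArrowModuleOrZero I (ModuleCat.of (BoundAlgebra I)ᵐᵒᵖ (optIdeal I o)) := by
  rcases o with _ | a
  · exact Or.inl
      (inferInstanceAs (Subsingleton (⊥ : Submodule (BoundAlgebra I)ᵐᵒᵖ (BoundAlgebra I))))
  · exact Or.inr ⟨a, ⟨Iso.refl _⟩⟩

theorem _root_.GentleExt.IsGentle.isUniserialOrZero_optIdeal (hI : IsGentle I) (o : Option Q.E) :
    IsUniserialOrZero (ModuleCat.of (BoundAlgebra I)ᵐᵒᵖ (optIdeal I o)) := by
  rcases o with _ | a
  · intro U V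
    left
    have : Subsingleton (optIdeal I none) :=
      inferInstanceAs (Subsingleton (⊥ : Submodule (BoundAlgebra I)ᵐᵒᵖ (BoundAlgebra I)))
    exact (Subsingleton.elim (α := Submodule (BoundAlgebra I)ᵐᵒᵖ (optIdeal I none)) U V).le
  · exact hI.isUniserialOrZero_arrowModule a

/-- The outer summands have this form by construction. An inner one is the projective at a sink,
where two different arrows end, and uniseriality makes it the right ideal of one of them. -/
theorem isArrowModuleOrZero_summand (o) (h : IsUniserialOrZero (p.summand o)) :
    IsArrowModuleOrZero I (p.summand o) := by
  rcases o with _ | _ | i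
  · exact isArrowModuleOrZero_optIdeal _
  · exact isArrowModuleOrZero_optIdeal _
  · obtain ⟨a, b, hab, ha, hb⟩ := p.two_arrows i
    change IsArrowModuleOrZero I (ModuleCat.of _ (evIdeal I (p.y i)))
    replace h : IsUniserialOrZero (ModuleCat.of (BoundAlgebra I)ᵐᵒᵖ (evIdeal I (p.y i))) := h
    rw [← ha] at hb h ⊢
    exact hI.isArrowModuleOrZero_of_uniserial hab hb.symm h

end Present

theorem exists_equiv_first_last (ι : Type*) [Finite ι] : ∃ (k : ℕ)
    (e : Fin (k + 1) ≃ Option (Option ι)),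
    1 ≤ k ∧ e 0 = none ∧ e (Fin.last k) = some none := by
  classical
  have := Fintype.ofFinite ι
  have hc : Fintype.card (Option (Option ι)) = Fintype.card ι + 1 + 1 := by simp
  let e := (Fintype.equivFinOfCardEq hc).symm
  let e₁ := e.trans (Equiv.swap (e 0) none)
  have h1 : e₁ 0 = none := Equiv.swap_apply_left _ _
  have hne : (0 : Fin (Fintype.card ι + 1 + 1)) ≠ Fin.last _ := by
    intro h; have := congrArg Fin.val h; simp at this
  have h2 : e₁ (Fin.last _) ≠ none := by
    rw [← h1]; exact fun h => hne (e₁.injective h).symm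
  refine ⟨_, e₁.trans (Equiv.swap (e₁ (Fin.last _)) (some none)), by omega, ?_, ?_⟩
  · rw [Equiv.trans_apply, h1]
    -- The second transposition does not disturb the value at `0`, which is neither of the two
    -- values it exchanges.
    exact Equiv.swap_apply_of_ne_of_ne h2.symm (by simp)
  · exact Equiv.swap_apply_left _ _

/-- The first syzygy of a string module over a gentle algebra. -/
theorem IsGentle.exists_isSyzygyDecomposition (hI : IsGentle I) (v : GString I) :
    ∃ (k : ℕ) (L : Fin (k + 1) → RightMod I),
      IsSyzygyDecomposition (v.module hI.quadratic) k L ∧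
      ∀ i, IsHollow (A := (BoundAlgebra I)ᵐᵒᵖ) (L i) ∧ IsNoetherian (BoundAlgebra I)ᵐᵒᵖ (L i) ∧
        (IsUniserialOrZero (L i) → IsArrowModuleOrZero I (L i)) := by
  -- There is no letter at the position `v.len`, so the whole string ends in the required way.
  obtain ⟨p⟩ := hI.nonempty_present v v.len le_rfl fun a ha => (GString.lt_of_ltr ha).false
  obtain ⟨k, e, hk, h0, hl⟩ := exists_equiv_first_last p.ι
  refine ⟨k, fun i => p.summand (e i), ⟨hk, ?_, fun i hi hi' => ?_, ?_, ?_⟩, fun i =>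
    ⟨p.isHollow_summand _, p.isNoetherian_summand _, p.isArrowModuleOrZero_summand _⟩⟩
  · rw [isSyzygy_one]
    exact p.isFirstSyzygy.of_equiv_right
      (LinearEquiv.piCongrLeft _ (fun o => p.summand o) e ≪≫ₗ p.piSummandEquiv)
  · have key : ∀ o, o ≠ none → o ≠ some none →
        Module.Projective (BoundAlgebra I)ᵐᵒᵖ (p.summand o) := by
      rintro (_ | _ | j) h h'
      · exact absurd rfl h
      · exact absurd rfl h'
      · exact projective_evIdeal _
    exact key _ (fun h => hi (e.injective (h.trans h0.symm)))
      (fun h => hi' (e.injective (h.trans hl.symm)))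
  · simp only [h0]
    exact hI.isUniserialOrZero_optIdeal _
  · simp only [hl]
    exact hI.isUniserialOrZero_optIdeal _

/-- Syzygies are unique up to isomorphism, so `L i` is a direct summand of the constructed product.
Being uniserial, it is zero or isomorphic to a factor; that factor is then uniserial too, hence the
right ideal of an arrow or zero. -/
theorem IsSyzygyDecomposition.isArrowModuleOrZero (hI : IsGentle I) {v : GString I} {k : ℕ}
    {L : Fin (k + 1) → RightMod I} (h : IsSyzygyDecomposition (v.module hI.quadratic) k L)
    {i : Fin (k + 1)} (hi : IsUniserialOrZero (L i)) : IsArrowModuleOrZero I (L i) := by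
  classical
  obtain ⟨k', L', h', hL'⟩ := hI.exists_isSyzygyDecomposition v
  obtain ⟨e⟩ := (isSyzygy_one.1 h.syzygy).nonempty_equiv (isSyzygy_one.1 h'.syzygy)
    (LinearEquiv.refl _ _)
  let e' : (∀ i, L i) ≃ₗ[(BoundAlgebra I)ᵐᵒᵖ] (∀ i, L' i) := e
  have := fun i => (hL' i).2.1
  rcases subsingleton_or_equiv_of_uniserial_summand (U := fun i => L' i) (fun i => (hL' i).1) hi
    (e'.toLinearMap ∘ₗ LinearMap.single _ (fun i => L i) i)
    (LinearMap.proj (φ := fun i => L i) i ∘ₗ e'.symm.toLinearMap)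
    (by ext x; simp) with h1 | ⟨j, ⟨f⟩⟩
  · exact Or.inl h1
  · refine ((hL' j).2.2 fun U V => ?_).of_equiv f.symm
    rcases hi (U.comap f.toLinearMap) (V.comap f.toLinearMap) with h2 | h2
    · exact Or.inl ((Submodule.comap_le_comap_iff_of_surjective f.surjective).1 h2)
    · exact Or.inr ((Submodule.comap_le_comap_iff_of_surjective f.surjective).1 h2)

theorem IsSyzygyDecomposition.ext_equiv {M : RightMod I} {k : ℕ}
    {L : Fin (k + 1) → RightMod I} (h : IsSyzygyDecomposition M k L) (N : RightMod I) (n : ℕ) :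
    Nonempty (Abelian.Ext.{u} M N (n + 2) ≃ₗ[K]
      Abelian.Ext.{u} (L 0) N (n + 1) × Abelian.Ext.{u} (L (Fin.last k)) N (n + 1)) := by
  obtain ⟨e⟩ := (isSyzygy_one.1 h.syzygy).ext_equiv (K := K) N n
  obtain ⟨e'⟩ := ext_pi_equiv (K := K) h.one_le L h.inner N n
  exact ⟨e ≪≫ₗ e'⟩

/-- Higher extensions of string modules over a gentle algebra. -/
theorem IsSyzygyDecomposition.ext_syzygy_equiv {M : RightMod I} {k : ℕ}
    {L : Fin (k + 1) → RightMod I} (h : IsSyzygyDecomposition M k L) (N : RightMod I) {n : ℕ}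
    {X Y : RightMod I} (hX : IsSyzygy n (L 0) X) (hY : IsSyzygy n (L (Fin.last k)) Y) :
    Nonempty (Abelian.Ext.{u} M N (n + 2) ≃ₗ[K]
      Abelian.Ext.{u} X N 1 × Abelian.Ext.{u} Y N 1) := by
  obtain ⟨e⟩ := h.ext_equiv N n
  obtain ⟨e₁⟩ := hX.ext_equiv (K := K) N n 0
  obtain ⟨e₂⟩ := hY.ext_equiv (K := K) N n 0
  exact ⟨e ≪≫ₗ e₁.prodCongr e₂⟩

end Decomposition

/-! ### Algebras of triangulations: gentleness and the period three -/

section Triangulations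

namespace TriangleGluing

variable {T : TriangleGluing.{u}} {K : Type u} [Field K]

/-- The side that follows a side in its triangle. -/
def nxt (z : T.Tri × Fin 3) : T.Tri × Fin 3 := (z.1, z.2 + 1)

theorem nxt_injective : Function.Injective (nxt (T := T)) := by
  rintro ⟨t, i⟩ ⟨t', i'⟩ h
  simp only [nxt, Prod.mk.injEq, add_left_inj] at h
  rw [h.1, h.2]

theorem nxt_nxt_nxt (z : T.Tri × Fin 3) : nxt (T := T) (nxt (T := T) (nxt (T := T) z)) = z := by
  obtain ⟨t, i⟩ := z
  simp only [nxt, Prod.mk.injEq, true_and]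
  fin_cases i <;> rfl

theorem glue_injective : Function.Injective T.glue :=
  Function.LeftInverse.injective T.glue_glue

theorem mk_arc_eq_iff {x y : T.InternalSide} :
    Quotient.mk T.arcSetoid x = Quotient.mk T.arcSetoid y ↔ y.1 = x.1 ∨ y.1 = T.glue x.1 :=
  Quotient.eq

/-- An arc has two sides: the second angle starts either at the same side, within the triangle of
`a`, or at the side glued to it. -/
theorem target_eq_source_iff {a b : T.quiver.E} :
    T.quiver.t a = T.quiver.s b ↔ b.1 = nxt (T := T) a.1 ∨ b.1 = T.glue (nxt (T := T) a.1) :=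
  mk_arc_eq_iff

theorem arrow_mul_arrow_mem_of_nxt {a b : T.quiver.E} (h : b.1 = nxt (T := T) a.1) :
    arrow K a * arrow K b ∈ T.ideal K :=
  TwoSidedIdeal.subset_span ⟨(a, b), h, rfl⟩

theorem eq_nxt_of_mem {a b : T.quiver.E} (hab : T.quiver.t a = T.quiver.s b)
    (h : arrow K a * arrow K b ∈ T.ideal K) : b.1 = nxt (T := T) a.1 :=
  mem_relations_of_arrow_mul_arrow_mem (ρ := T.relationPairs) rfl hab h

theorem eq_glue_nxt_of_notMem {a b : T.quiver.E} (h : arrow K a * arrow K b ∉ T.ideal K) :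
    b.1 = T.glue (nxt (T := T) a.1) := by
  by_cases hab : T.quiver.t a = T.quiver.s b
  · exact (target_eq_source_iff.1 hab).resolve_left fun h' => h (arrow_mul_arrow_mem_of_nxt h')
  · rw [arrow_mul_arrow_of_ne hab] at h
    exact absurd (zero_mem _) h

/-- Consecutive arrows of a nonzero path are consecutive angles around one vertex of the surface, so
all the sides met in turning along the path begin angles. -/
theorem exists_angle_iterate (l : List T.quiver.E) (a : T.quiver.E)
    (h : arrow K a * (l.map (arrow K)).prod ∉ T.ideal K) (i : ℕ) (hi : i ≤ l.length) :
    ∃ b : T.quiver.E, b.1 = (fun z : T.Tri × Fin 3 => T.glue (z.1, z.2 + 1))^[i] a.1 := by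
  induction l generalizing a i with
  | nil => exact ⟨a, by rw [Nat.le_zero.1 hi]; rfl⟩
  | cons b l ih =>
    rcases i with _ | i
    · exact ⟨a, rfl⟩
    · rw [List.map_cons, List.prod_cons] at h
      have hab : b.1 = T.glue (nxt (T := T) a.1) := eq_glue_nxt_of_notMem fun h' => h <| by
        rw [← mul_assoc]
        exact TwoSidedIdeal.mul_mem_right _ _ _ h'
      obtain ⟨c, hc⟩ := ih b (fun h' => h (TwoSidedIdeal.mul_mem_left _ _ _ h')) i
        (by simpa using hi)
      exact ⟨c, by rw [hc, hab]; rfl⟩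

theorem isAdmissible (T : TriangleGluing.{u}) (K : Type u) [Field K] : IsAdmissible
    (T.ideal K) := by
  constructor
  · choose n y hy hg using T.vertex_on_boundary
    obtain ⟨N, hN⟩ := Finite.exists_le n
    -- Turning from any side meets an unglued side within `N` steps. A nonzero path of `N + 2`
    -- arrows turns `N + 1` times, so one of its angles would be bounded by an unglued side; the
    -- bound is also at least two.
    refine ⟨N + 2, by omega, TwoSidedIdeal.span_le.2 ?_⟩
    rintro _ ⟨_ | ⟨a, l⟩, hl, rfl⟩
    · simp at hl
    · by_contra h
      obtain ⟨b, hb⟩ := exists_angle_iterate (K := K) l a h (n a.1)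
        ((hN a.1).trans (by rw [List.length_cons] at hl; omega))
      rw [← hy a.1] at hb
      refine b.2.2 ?_
      rw [hb]
      exact hg a.1
  · refine TwoSidedIdeal.span_le.2 ?_
    rintro _ ⟨⟨a, b⟩, -, rfl⟩
    exact TwoSidedIdeal.subset_span ⟨[a, b], rfl, by simp⟩

theorem ncard_le_two {s : Set T.quiver.E} {f : T.Tri × Fin 3 → T.Tri × Fin 3}
    (hf : Function.Injective f) (x y : T.Tri × Fin 3) (h : ∀ a ∈ s, f a.1 = x ∨ f a.1 = y) :
    s.ncard ≤ 2 := by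
  refine (Set.ncard_le_ncard_of_injOn (t := {x, y}) (fun a => f a.1) h
    (fun a _ b _ hab => Subtype.ext (hf hab)) (Set.toFinite _)).trans ?_
  exact (Set.ncard_insert_le _ _).trans (by simp)

theorem isGentle (T : TriangleGluing.{u}) (K : Type u) [Field K] : IsGentle (T.ideal K) where
  admissible := T.isAdmissible K
  start_le v := by
    obtain ⟨x, rfl⟩ := Quotient.exists_rep v
    exact ncard_le_two Function.injective_id x.1 (T.glue x.1) fun a ha => mk_arc_eq_iff.1 ha.symm
  end_le v := by
    obtain ⟨x, rfl⟩ := Quotient.exists_rep v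
    exact ncard_le_two nxt_injective x.1 (T.glue x.1) fun a ha => mk_arc_eq_iff.1 ha.symm
  right_notMem a b b' h h' :=
    Subtype.ext ((eq_glue_nxt_of_notMem h).trans (eq_glue_nxt_of_notMem h').symm)
  left_notMem a c c' h h' := Subtype.ext (nxt_injective (glue_injective
    ((eq_glue_nxt_of_notMem h).symm.trans (eq_glue_nxt_of_notMem h'))))
  right_mem a b b' hb hb' h h' :=
    Subtype.ext ((eq_nxt_of_mem hb h).trans (eq_nxt_of_mem hb' h').symm)
  left_mem a c c' hc hc' h h' := Subtype.ext (nxt_injective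
    ((eq_nxt_of_mem hc h).symm.trans (eq_nxt_of_mem hc' h')))
  quadratic := T.ideal_quadratic K

theorem isFirstSyzygy_of_nxt {a b : T.quiver.E} (h : b.1 = nxt (T := T) a.1) :
    IsFirstSyzygy (arrowModule (T.ideal K) a) (arrowModule (T.ideal K) b) :=
  (T.isGentle K).isFirstSyzygy_arrowModule (target_eq_source_iff.2 (Or.inl h))
    (ar_mul_ar_eq_zero_iff.2 (arrow_mul_arrow_mem_of_nxt h))

/-- If the third side of the triangle of `a` is on the boundary, no relation begins with `a` and
both spaces vanish. Otherwise the triangle has three angles `a`, `b`, `c`, and three syzygies lead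
from `aΛ` through `bΛ` and `cΛ` back to `aΛ`. -/
theorem ext_arrowModule_equiv (a : T.quiver.E) (N : RightMod (T.ideal K)) (j : ℕ) :
    Nonempty (Abelian.Ext.{u} (arrowModule (T.ideal K) a) N (j + 1) ≃ₗ[K]
      Abelian.Ext.{u} (arrowModule (T.ideal K) a) N (j + 4)) := by
  by_cases h : T.glue (nxt (T := T) (nxt (T := T) a.1)) = nxt (T := T) (nxt (T := T) a.1)
  · have : Module.Projective (BoundAlgebra (T.ideal K))ᵐᵒᵖ (arrowModule (T.ideal K) a) := by
      refine (T.isGentle K).projective_arrowModule fun b hb h0 => b.2.2 ?_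
      rw [eq_nxt_of_mem hb (ar_mul_ar_eq_zero_iff.1 h0)]
      exact h
    have h1 := subsingleton_ext_of_projective (arrowModule (T.ideal K) a) N j
    have h2 := subsingleton_ext_of_projective (arrowModule (T.ideal K) a) N (j + 3)
    exact ⟨LinearEquiv.ofSubsingleton _ _⟩
  · let b : T.quiver.E := ⟨nxt (T := T) a.1, a.2.2, h⟩
    let c : T.quiver.E := ⟨nxt (T := T) b.1, h, by
      change T.glue (nxt (T := T) (nxt (T := T) (nxt (T := T) a.1))) ≠
        nxt (T := T) (nxt (T := T) (nxt (T := T) a.1))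
      rw [nxt_nxt_nxt]
      exact a.2.1⟩
    obtain ⟨e₁⟩ := (isFirstSyzygy_of_nxt (a := a) (b := b) rfl).ext_equiv (K := K) N (j + 2)
    obtain ⟨e₂⟩ := (isFirstSyzygy_of_nxt (a := b) (b := c) rfl).ext_equiv (K := K) N (j + 1)
    obtain ⟨e₃⟩ := (isFirstSyzygy_of_nxt (a := c) (b := a)
      (nxt_nxt_nxt a.1).symm).ext_equiv (K := K) N j
    exact ⟨(e₁ ≪≫ₗ e₂ ≪≫ₗ e₃).symm⟩

theorem ext_periodic {X : RightMod (T.ideal K)} (hX : IsArrowModuleOrZero (T.ideal K) X)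
    (N : RightMod (T.ideal K)) (j : ℕ) :
    Nonempty (Abelian.Ext.{u} X N (j + 1) ≃ₗ[K] Abelian.Ext.{u} X N (j + 4)) := by
  rcases hX with h | ⟨a, ⟨i⟩⟩
  · have h1 := subsingleton_ext_of_subsingleton X N j
    have h2 := subsingleton_ext_of_subsingleton X N (j + 3)
    exact ⟨LinearEquiv.ofSubsingleton _ _⟩
  · obtain ⟨e⟩ := ext_arrowModule_equiv a N j
    obtain ⟨e₁⟩ := ext_equiv_of_equiv (K := K) i.toLinearEquiv N (j + 1)
    obtain ⟨e₂⟩ := ext_equiv_of_equiv (K := K) i.toLinearEquiv N (j + 4)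
    exact ⟨e₁ ≪≫ₗ e ≪≫ₗ e₂.symm⟩

end TriangleGluing

end Triangulations

end GentleExt

/-! ### The main theorem -/

open CategoryTheory GentleExt in
theorem mainTheorem2 (K : Type u) [Field K] [IsAlgClosed K] :
    (∀ (Q : FinQuiver.{u}) (I : TwoSidedIdeal (PathAlgebra K Q)) (hI : IsGentle I)
        (v w : GString I),
      (∃ (k : ℕ) (L : Fin (k + 1) → RightMod I),
        IsSyzygyDecomposition (v.module hI.quadratic) k L) ∧
      ∀ (k : ℕ) (L : Fin (k + 1) → RightMod I),
        IsSyzygyDecomposition (v.module hI.quadratic) k L →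
        Nonempty (Abelian.Ext.{u} (v.module hI.quadratic) (w.module hI.quadratic) 2 ≃ₗ[K]
          Abelian.Ext.{u} (L 0) (w.module hI.quadratic) 1 ×
            Abelian.Ext.{u} (L (Fin.last k)) (w.module hI.quadratic) 1) ∧
        ∀ n : ℕ, 2 ≤ n →
          (∃ X : RightMod I, IsSyzygy (n - 2) (L 0) X) ∧
          (∃ Y : RightMod I, IsSyzygy (n - 2) (L (Fin.last k)) Y) ∧
          ∀ X Y : RightMod I, IsSyzygy (n - 2) (L 0) X →
            IsSyzygy (n - 2) (L (Fin.last k)) Y →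
            Nonempty (Abelian.Ext.{u} (v.module hI.quadratic) (w.module hI.quadratic) n ≃ₗ[K]
              Abelian.Ext.{u} X (w.module hI.quadratic) 1 ×
                Abelian.Ext.{u} Y (w.module hI.quadratic) 1) ∧
            (Subsingleton X ∨ ∃ a : Q.E, Nonempty (X ≅ arrowModule I a)) ∧
            (Subsingleton Y ∨ ∃ a : Q.E, Nonempty (Y ≅ arrowModule I a))) ∧
    (∀ (S : Type u) [TopologicalSpace S] (P : Set S) (T : Triangulation S P)
        (v w : GString (T.ideal K)) (n : ℕ), 2 ≤ n →
      Nonempty (Abelian.Ext.{u} (v.module (T.ideal_quadratic K)) (w.module (T.ideal_quadratic K)) n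
        ≃ₗ[K]
        Abelian.Ext.{u} (v.module (T.ideal_quadratic K)) (w.module (T.ideal_quadratic K)) (n + 3))) := by
  constructor
  · intro Q I hI v w
    refine ⟨?_, fun k L h => ⟨h.ext_equiv _ 0, fun n hn => ?_⟩⟩
    · obtain ⟨k, L, h, -⟩ := hI.exists_isSyzygyDecomposition v
      exact ⟨k, L, h⟩
    obtain ⟨n, rfl⟩ := Nat.exists_eq_add_of_le' hn
    have h0 := h.isArrowModuleOrZero hI h.first
    have hl := h.isArrowModuleOrZero hI h.last
    exact ⟨h0.exists_isSyzygy hI n, hl.exists_isSyzygy hI n, fun X Y hX hY =>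
      ⟨h.ext_syzygy_equiv _ hX hY, h0.of_isSyzygy hI n X hX, hl.of_isSyzygy hI n Y hY⟩⟩
  · intro S _ P T v w n hn
    obtain ⟨n, rfl⟩ := Nat.exists_eq_add_of_le' hn
    obtain ⟨k, L, h, -⟩ := (T.isGentle K).exists_isSyzygyDecomposition v
    -- Degrees `n + 2` and `n + 5` of the string module correspond to degrees `n + 1` and `n + 4` of
    -- the outer summands. Periodicity of the summands holds from degree one on, which is why that
    -- of the string module is claimed from degree two on.
    obtain ⟨e⟩ := h.ext_equiv (w.module (T.ideal_quadratic K)) n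
    obtain ⟨e'⟩ := h.ext_equiv (w.module (T.ideal_quadratic K)) (n + 3)
    obtain ⟨e₀⟩ := TriangleGluing.ext_periodic (h.isArrowModuleOrZero (T.isGentle K) h.first)
      (w.module (T.ideal_quadratic K)) n
    obtain ⟨e₁⟩ := TriangleGluing.ext_periodic (h.isArrowModuleOrZero (T.isGentle K) h.last)
      (w.module (T.ideal_quadratic K)) n
    rw [show n + 2 + 3 = n + 3 + 2 by omega]
    exact ⟨e ≪≫ₗ e₀.prodCongr e₁ ≪≫ₗ e'.symm⟩
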